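/- **Setting.** Let $V$ be the space of traceless $2\times 2$ matrices over $\mathbb Q$ with $(\mathbf x,\mathbf y)=\operatorname{tr}(\mathbf x\mathbf y)$ (signature $(2,1)$), on which $g\in\mathrm{SL}_2$ acts by $g\mathbf x=g\mathbf xg^{-1}$. Let $e_1=\frac1{\sqrt2}\begin{pmatrix}0&1\\1&0\end{pmatrix}$, $e_2=\frac1{\sqrt2}\begin{pmatrix}1&0\\0&-1\end{pmatrix}$, $e_3=\frac1{\sqrt2}\begin{pmatrix}0&1\\-1&0\end{pmatrix}$, with coordinates $x_i$ of $\mathbf x=\sum x_ie_i$, and $u_\infty=\begin{pmatrix}0&1\\0&0\end{pmatrix}$, $u'=\begin{pmatrix}0&0\\-1&0\end{pmatrix}$, $n(x)=\begin{pmatrix}1&x\\0&1\end{pmatrix}$, $a(t)=\begin{pmatrix}t&0\\0&t^{-1}\end{pmatrix}$, $g_z=n(x)a(\sqrt y)$ for $z=x+iy\in\mathbb H$. Let $k\ge 0$; let $\mathcal H_k\subset \operatorname{Sym}^k(V_{\mathbb C})$ be the kernel of $\partial_1^2+\partial_2^2-\partial_3^2$ and $\pi_k$ the projection onto it along $(e_1^2+e_2^2-e_3^2)\operatorname{Sym}^{k-2}(V_{\mathbb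 C})$. For $k>0$ let $v_{-2}=\frac{(-2)^k(k!)^2}{(2k)!\,(k-1)!}R^{k-1}u'^k\in\mathcal H_k$, where $R$ is the action of $u_\infty\in\mathfrak{sl}_2$; it satisfies $Rv_{-2}=k\,2^{k/2}\pi_k(e_2^k)$. Let $L\subset V$ be an even lattice of full rank, $h\in L^\#$, $\mathcal L=L+h$, and $\Gamma\subset\mathrm{SL}_2(\mathbb Z)$ a torsion-free congruence subgroup with $\Gamma\mathcal L=\mathcal L$; put $X=\Gamma\backslash\mathbb H$. Its Borel–Serre compactification $\overline X=\Gamma\backslash\overline D$ is the quotient of the surface with boundary $\overline D$ that is covered by the charts $\{(x,t):t\ge0\}$ indexed by $\sigma\in\mathrm{SL}_2(\mathbb Z)$, in which $(x,t)$, $t>0$, is the point $\sigma(x+i/t)$ of $\mathbb H$, and $(x,0)$ is the point with coordinate $x$ of the boundary line $N_\ell\simeq\mathbb R$ of the cusp $\ell=\sigma\ell_\infty$, $\ell_\infty=\mathbb Qu_\infty$. Then $\partial\overline X$ is the union of the circles $X_\ell=\Gamma_\ell\backslash N_\ell$ over the $\Gamma$-classes of cusps; let $\iota_\ell:X_\ell\to\overline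 X$ be the inclusion. Forms on $\overline X$, $\partial\overline X$ have values in the flat bundle of $\mathcal H_k$, i.e. they are smooth $\Gamma$-equivariant $\mathcal H_k$-valued forms on $\overline D$, $\partial\overline D$. Let $\tau=u+iv\in\mathbb H$, $\varphi_0(\mathbf x)=e^{-\pi(x_1^2+x_2^2+x_3^2)}$, $\mathcal D_j=x_j-\frac1{2\pi}\partial_{x_j}$, $\omega_1=\frac{dy}y$, $\omega_2=-\frac{dx}y$, and $$\varphi^V_{1,[k]}(\mathbf x,z)=\frac1{2^{k+1/2}}\sum_{\alpha=1}^2\ \sum_{\beta_1,\dots,\beta_k=1}^2(\mathcal D_\alpha\mathcal D_{\beta_1}\cdots\mathcal D_{\beta_k}\varphi_0)(g_z^{-1}\mathbf x)\,\omega_\alpha\otimes g_z\pi_k(e_{\beta_1}\cdots e_{\beta_k}),$$ $$\theta_{\mathcal L}(\tau,z,\varphi^V_{1,[k]})=v^{-k/2}\sum_{\mathbf x\in\mathcal L}\varphi^V_{1,[k]}(\sqrt v\,\mathbf x,z)\,e^{\pi i(\mathbf x,\mathbf x)u}.$$ For a cusp $\ell=\sigma\ell_\infty$, $\sigma\in\mathrm{SL}_2(\mathbb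 Z)$, let $u_\ell=\sigma u_\infty$, $\ell'=\mathbb Q\,\sigma u'$, $W_\ell=\ell^\perp\cap\ell'^\perp$, and let $w$ be the coordinate on $W_\ell$ with respect to $\sigma e_2$. Write $L\cap\ell=\mathbb Z\,(\det L_\ell)\,u_\ell$ with $\det L_\ell>0$, $L_{W_\ell}=L\cap W_\ell$, and $\mathcal L\cap\ell^\perp=\coprod_j\big((L\cap\ell)+h_{\ell,j}\big)\oplus\big(L_{W_\ell}+h_{W_\ell,j}\big)$ with $h_{\ell,j}\in\ell$, $h_{W_\ell,j}\in W_\ell$; let $\hat{\mathcal L}_{W_\ell}=\frac1{\det L_\ell}\sum_j\mathbf 1_{L_{W_\ell}+h_{W_\ell,j}}$, a function on $W_\ell$. With $H_j(t)=(-1)^je^{t^2}\frac{d^j}{dt^j}e^{-t^2}$ and $\widetilde H_j(w)=(2\pi)^{-j/2}H_j(\sqrt{2\pi}\,w)$ define, on $N_\ell$ with coordinate $x$, $$\varphi^{N_\ell}_{1,[k]}(w,x)=-\frac{1}{2^{k+1/2}}\widetilde H_{k+1}(w)e^{-\pi w^2}dx\otimes\sigma n(x)\pi_k(e_2^k),\qquad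 \phi^{N_\ell}_{[k]}(w,x)=-\frac{1}{2^{3k/2+1/2}k}\widetilde H_{k+1}(w)e^{-\pi w^2}\,\sigma n(x)v_{-2}\ (k>0),$$ and, for $\varphi=\varphi^{N_\ell}_{1,[k]}$ or $\phi^{N_\ell}_{[k]}$, $\ \theta_{\hat{\mathcal L}_{W_\ell}}(\tau,\varphi)=v^{-(k+1)/2}\sum_{\mathbf w\in W_\ell}\hat{\mathcal L}_{W_\ell}(\mathbf w)\,\varphi(\sqrt v\,\mathbf w)\,e^{\pi i(\mathbf w,\mathbf w)u}$. **Theorem.** All these series converge. For every $k\ge0$ and $\tau\in\mathbb H$ the 1-form $\theta_{\mathcal L}(\tau,\varphi^V_{1,[k]})$ on $X$ extends to a smooth 1-form on $\overline X$ with values in the flat bundle of $\mathcal H_k$, and for every cusp $\ell$ the restriction of the extension is $$\iota_\ell^*\theta_{\mathcal L}(\tau,\varphi^V_{1,[k]})=\theta_{\hat{\mathcal L}_{W_\ell}}(\tau,\varphi^{N_\ell}_{1,[k]}).$$ If $k>0$, then the functions $\theta_{\hat{\mathcal L}_{W_\ell}}(\tau,\phi^{N_\ell}_{[k]})$ define a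 smooth section over $\partial\overline X$, and $\iota_\ell^*\theta_{\mathcal L}(\tau,\varphi^V_{1,[k]})=d\,\theta_{\hat{\mathcal L}_{W_\ell}}(\tau,\phi^{N_\ell}_{[k]})$ for every $\ell$, so the restriction is exact. Moreover, for $k>0$ the pair $\big(\theta_{\mathcal L}(\tau,\varphi^V_{1,[k]}),\sum_{[\ell]}\theta_{\hat{\mathcal L}_{W_\ell}}(\tau,\phi^{N_\ell}_{[k]})\big)$ is a cocycle of degree $1$ in the mapping cone of $\iota^*:A^\bullet(\overline X,\mathcal H_k)\to A^\bullet(\partial\overline X,\mathcal H_k)$, with differential $d(a,b)=(da,\iota^*a-db)$. -/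

import Mathlib

open scoped MatrixGroups ContDiff Topology
open UpperHalfPlane

noncomputable section

namespace Spectacle

/-! ### The quadratic space `V` of traceless `2 × 2` matrices, `(X, Y) = tr (X Y)` -/

/-- `SL₂` acts on `2 × 2` matrices by conjugation. -/
def conj {R : Type*} [CommRing R] (g : SL(2, R)) (X : Matrix (Fin 2) (Fin 2) R) :
    Matrix (Fin 2) (Fin 2) R :=
  (g : Matrix (Fin 2) (Fin 2) R) * X * ((g⁻¹ : SL(2, R)) : Matrix (Fin 2) (Fin 2) R)

/-- The orthogonal basis `e₁, e₂, e₃` of `V(ℝ)`, of norms `1, 1, -1` (indexed by `0, 1, 2`). -/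
def e : Fin 3 → Matrix (Fin 2) (Fin 2) ℝ :=
  ![(1 / √2) • !![0, 1; 1, 0], (1 / √2) • !![1, 0; 0, -1], (1 / √2) • !![0, 1; -1, 0]]

/-- The coordinates of a traceless real matrix with respect to `e₁, e₂, e₃`. -/
def coord (X : Matrix (Fin 2) (Fin 2) ℝ) : Fin 3 → ℝ :=
  ![(X 0 1 + X 1 0) / √2, (X 0 0 - X 1 1) / √2, (X 0 1 - X 1 0) / √2]

/-- The signs `(e_i, e_i)`. -/
def sgn : Fin 3 → ℝ := ![1, 1, -1]

/-- The isotropic vector `u`, spanning the line of the cusp `∞`. -/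
def uVec (R : Type*) [CommRing R] : Matrix (Fin 2) (Fin 2) R := !![0, 1; 0, 0]

/-- The isotropic vector `u'`, spanning the line of the cusp `0`; `(u, u') = -1`. -/
def uVec' (R : Type*) [CommRing R] : Matrix (Fin 2) (Fin 2) R := !![0, 0; -1, 0]

theorem eq_sum_coord (X : Matrix (Fin 2) (Fin 2) ℝ) (hX : X.trace = 0) :
    X = ∑ i, coord X i • e i := by
  have h2 : (√2 : ℝ) ≠ 0 := by positivity
  have h22 : (√2 : ℝ) * √2 = 2 := Real.mul_self_sqrt (by norm_num)
  rw [Matrix.trace_fin_two] at hX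
  ext i j
  fin_cases i <;> fin_cases j <;>
    simp [Fin.sum_univ_three, coord, e] <;> field_simp <;> rw [pow_two, h22] <;> linarith

theorem sum_sgn_coord (X Y : Matrix (Fin 2) (Fin 2) ℝ) (hX : X.trace = 0) (hY : Y.trace = 0) :
    ∑ i, sgn i * coord X i * coord Y i = (X * Y).trace := by
  have h2 : (√2 : ℝ) ≠ 0 := by positivity
  have h22 : (√2 : ℝ) ^ 2 = 2 := Real.sq_sqrt (by norm_num)
  rw [Matrix.trace_fin_two] at hX hY
  have hX' : X 1 1 = - X 0 0 := by linarith
  have hY' : Y 1 1 = - Y 0 0 := by linarith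
  simp [Fin.sum_univ_three, coord, sgn, Matrix.trace_fin_two, Matrix.mul_apply, Fin.sum_univ_two,
    hX', hY']
  field_simp
  rw [h22]
  ring

theorem trace_e (i : Fin 3) : (e i).trace = 0 := by
  fin_cases i <;> simp [e, Matrix.trace_fin_two]

theorem trace_e_mul_e (i j : Fin 3) : (e i * e j).trace = if i = j then sgn i else 0 := by
  have h2 : (√2 : ℝ) ≠ 0 := by positivity
  have h22 : (√2 : ℝ) ^ 2 = 2 := Real.sq_sqrt (by norm_num)
  fin_cases i <;> fin_cases j <;>
    simp [e, sgn, Matrix.trace_fin_two] <;> field_simp <;> (try rw [h22]) <;> norm_num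

theorem conj_mul_conj {R : Type*} [CommRing R] (g : SL(2, R)) (X Y : Matrix (Fin 2) (Fin 2) R) :
    conj g X * conj g Y = conj g (X * Y) := by
  have h : ((g⁻¹ : SL(2, R)) : Matrix (Fin 2) (Fin 2) R) * (g : Matrix (Fin 2) (Fin 2) R) = 1 := by
    rw [← Matrix.SpecialLinearGroup.coe_mul]; simp
  unfold conj
  calc _ = (g : Matrix (Fin 2) (Fin 2) R) * X *
        (((g⁻¹ : SL(2, R)) : Matrix (Fin 2) (Fin 2) R) * (g : Matrix (Fin 2) (Fin 2) R)) * Y *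
        ((g⁻¹ : SL(2, R)) : Matrix (Fin 2) (Fin 2) R) := by simp only [Matrix.mul_assoc]
    _ = _ := by rw [h]; simp only [Matrix.mul_assoc, Matrix.mul_one]

theorem trace_conj {R : Type*} [CommRing R] (g : SL(2, R)) (X : Matrix (Fin 2) (Fin 2) R) :
    (conj g X).trace = X.trace := by
  have h : ((g⁻¹ : SL(2, R)) : Matrix (Fin 2) (Fin 2) R) * (g : Matrix (Fin 2) (Fin 2) R) = 1 := by
    rw [← Matrix.SpecialLinearGroup.coe_mul]; simp
  rw [conj, Matrix.trace_mul_comm, ← Matrix.mul_assoc, h, Matrix.one_mul]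

/-! ### `Sym^k(V_ℂ)` and its harmonic part

The symmetric algebra of `V_ℂ` is the polynomial algebra in `e₁, e₂, e₃` (the variables
`X 0, X 1, X 2`), and `Sym^k(V_ℂ)` is its homogeneous part of degree `k`. -/

/-- The symmetric algebra of `V_ℂ`. -/
abbrev SymV : Type := MvPolynomial (Fin 3) ℂ

/-- A vector of `V(ℝ)` as an element of degree one of the symmetric algebra. -/
def toSym (X : Matrix (Fin 2) (Fin 2) ℝ) : SymV :=
  ∑ i, MvPolynomial.C (coord X i : ℂ) * MvPolynomial.X i

/-- The indefinite Laplacian `∂₁² + ∂₂² - ∂₃²` of `( , )`. -/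
def lap : SymV →ₗ[ℂ] SymV :=
  ∑ i, (sgn i : ℂ) • ((MvPolynomial.pderiv i).toLinearMap ∘ₗ (MvPolynomial.pderiv i).toLinearMap)

/-- `r² = e₁² + e₂² - e₃²`. -/
def rSq : SymV := ∑ i, MvPolynomial.C (sgn i : ℂ) * MvPolynomial.X i ^ 2

theorem lap_apply (p : SymV) : lap p = ∑ i, MvPolynomial.C (sgn i : ℂ) *
    MvPolynomial.pderiv i (MvPolynomial.pderiv i p) := by
  simp only [lap, LinearMap.sum_apply, LinearMap.smul_apply, LinearMap.comp_apply,
    Derivation.coeFn_coe, MvPolynomial.smul_eq_C_mul]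

/-- The harmonic elements `ℋ_k(V_ℂ)` of `Sym^k(V_ℂ)`, as a submodule. -/
def harmSub (k : ℕ) : Submodule ℂ SymV :=
  MvPolynomial.homogeneousSubmodule (Fin 3) ℂ k ⊓ LinearMap.ker lap

theorem mem_harmSub {k : ℕ} {p : SymV} : p ∈ harmSub k ↔ p.IsHomogeneous k ∧ lap p = 0 := by
  simp [harmSub, MvPolynomial.mem_homogeneousSubmodule]

/-- The coefficient space `ℋ_k(V_ℂ)`. -/
def Harm (k : ℕ) : Type := harmSub k

instance (k : ℕ) : AddCommGroup (Harm k) := inferInstanceAs (AddCommGroup (harmSub k))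

instance (k : ℕ) : Module ℂ (Harm k) := inferInstanceAs (Module ℂ (harmSub k))

/-- The coefficients of an element of `ℋ_k(V_ℂ)` at the monomials of degree `k`. -/
def harmCoeff (k : ℕ) :
    Harm k →ₗ[ℂ] (((Finset.univ : Finset (Fin 3)).finsuppAntidiag k : Finset (Fin 3 →₀ ℕ)) → ℂ) :=
  (LinearMap.pi fun d => MvPolynomial.lcoeff ℂ d.1) ∘ₗ (harmSub k).subtype

theorem harmCoeff_injective (k : ℕ) : Function.Injective (harmCoeff k) := by
  rw [← LinearMap.ker_eq_bot, LinearMap.ker_eq_bot']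
  intro p hp
  apply Subtype.ext
  refine MvPolynomial.ext _ _ fun d => ?_
  change MvPolynomial.coeff d p.1 = 0
  by_cases hd : d.degree = k
  · have := congrFun hp ⟨d, by
      rw [Finset.mem_finsuppAntidiag']
      refine ⟨?_, Finset.subset_univ _⟩
      rw [← hd]; rfl⟩
    exact this
  · exact (mem_harmSub.1 p.2).1.coeff_eq_zero hd

/-- The (canonical) topology of the finite-dimensional space `ℋ_k(V_ℂ)`, given by the norm
`max |coefficient|`. -/
instance (k : ℕ) : NormedAddCommGroup (Harm k) :=
  NormedAddCommGroup.induced _ _ (harmCoeff k) (harmCoeff_injective k)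

instance (k : ℕ) : NormedSpace ℂ (Harm k) := NormedSpace.induced ℂ _ _ (harmCoeff k)

/-! ### The projection `π_k : Sym^k(V_ℂ) → ℋ_k(V_ℂ)` -/

theorem lap_isHomogeneous {p : SymV} {d : ℕ} (hp : p.IsHomogeneous d) :
    (lap p).IsHomogeneous (d - 2) := by
  rw [lap_apply]
  refine MvPolynomial.IsHomogeneous.sum _ _ _ fun i _ => ?_
  have := (hp.pderiv (i := i)).pderiv (i := i)
  simpa [Nat.sub_sub] using (MvPolynomial.isHomogeneous_C (Fin 3) (sgn i : ℂ)).mul this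

theorem lap_eq_zero_of_lt {p : SymV} {d : ℕ} (hp : p.IsHomogeneous d) (hd : d < 2) :
    lap p = 0 := by
  rw [lap_apply]
  refine Finset.sum_eq_zero fun i _ => ?_
  have h1 : (MvPolynomial.pderiv i p).IsHomogeneous 0 := by
    have := hp.pderiv (i := i)
    rwa [show d - 1 = 0 by omega] at this
  have h2 := (MvPolynomial.totalDegree_eq_zero_iff_eq_C).1
    ((MvPolynomial.totalDegree_zero_iff_isHomogeneous _).2 h1)
  rw [h2, MvPolynomial.pderiv_C, mul_zero]

theorem rSq_isHomogeneous : rSq.IsHomogeneous 2 := by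
  refine MvPolynomial.IsHomogeneous.sum _ _ _ fun i _ => ?_
  simpa using (MvPolynomial.isHomogeneous_C (Fin 3) (sgn i : ℂ)).mul
    ((MvPolynomial.isHomogeneous_X ℂ i).pow 2)

theorem lap_rSq_mul {p : SymV} {d : ℕ} (hp : p.IsHomogeneous d) :
    lap (rSq * p) = MvPolynomial.C (6 + 4 * d : ℂ) * p + rSq * lap p := by
  have hE := hp.sum_X_mul_pderiv
  rw [Fin.sum_univ_three] at hE
  have hE' : MvPolynomial.C (6 + 4 * d : ℂ) * p = 6 * p +
      4 * (MvPolynomial.X 0 * MvPolynomial.pderiv 0 p +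
      MvPolynomial.X 1 * MvPolynomial.pderiv 1 p + MvPolynomial.X 2 * MvPolynomial.pderiv 2 p) := by
    have h6 : (MvPolynomial.C (6 : ℂ) : SymV) = 6 := map_ofNat _ 6
    have h4 : (MvPolynomial.C (4 : ℂ) : SymV) = 4 := map_ofNat _ 4
    have hd : (MvPolynomial.C (d : ℂ) : SymV) = d := map_natCast _ d
    rw [hE, map_add, map_mul, h6, h4, hd, nsmul_eq_mul]
    ring
  have h2 : (MvPolynomial.C (2 : ℂ) : SymV) = 2 := map_ofNat _ 2
  rw [hE']
  simp only [lap_apply, rSq, Fin.sum_univ_three, sgn, pow_two, MvPolynomial.pderiv_mul, map_add,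
    MvPolynomial.pderiv_C]
  simp [MvPolynomial.pderiv_X]
  ring

theorem lap_rSq_pow_mul {p : SymV} {d : ℕ} (hp : p.IsHomogeneous d) (j : ℕ) :
    lap (rSq ^ (j + 1) * p) =
      MvPolynomial.C (2 * (j + 1) * (2 * (j + 1) + 2 * d + 1) : ℂ) * (rSq ^ j * p) +
        rSq ^ (j + 1) * lap p := by
  induction j with
  | zero =>
    rw [zero_add, pow_one, lap_rSq_mul hp, pow_zero, one_mul]
    congr 3
    push_cast
    ring
  | succ j ih =>
    have hq : (rSq ^ (j + 1) * p).IsHomogeneous (2 * (j + 1) + d) :=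
      (rSq_isHomogeneous.pow (j + 1)).mul hp
    rw [pow_succ' rSq (j + 1), mul_assoc, lap_rSq_mul hq, ih]
    have : (MvPolynomial.C (2 * ((j + 1 : ℕ) + 1) * (2 * ((j + 1 : ℕ) + 1) + 2 * d + 1) : ℂ)
        : SymV) = MvPolynomial.C (6 + 4 * (2 * (j + 1) + d : ℕ) : ℂ) +
          MvPolynomial.C (2 * (j + 1) * (2 * (j + 1) + 2 * d + 1) : ℂ) := by
      rw [← map_add]
      congr 1
      push_cast
      ring
    rw [this]
    ring

theorem lap_iterate_isHomogeneous {p : SymV} {d : ℕ} (hp : p.IsHomogeneous d) (j : ℕ) :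
    (lap^[j] p).IsHomogeneous (d - 2 * j) := by
  induction j with
  | zero => simpa using hp
  | succ j ih =>
    rw [Function.iterate_succ_apply']
    have := lap_isHomogeneous ih
    rwa [Nat.sub_sub, ← Nat.mul_succ] at this

/-- The coefficient `(-1)^j (2k-2j-1)‼ / ((2j)‼ (2k-1)‼)` of the harmonic projection. -/
def projCoeff (k j : ℕ) : ℂ :=
  ∏ i ∈ Finset.range j, (-1 / (2 * (i + 1) * (2 * k - 2 * (i + 1) + 1)) : ℂ)

/-- The harmonic projection `∑_j c_{k,j} r^{2j} Δ^j f` of `f ∈ Sym^k(V_ℂ)`. -/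
def harmPoly (k : ℕ) (f : SymV) : SymV :=
  ∑ j ∈ Finset.range (k / 2 + 1), MvPolynomial.C (projCoeff k j) * (rSq ^ j * lap^[j] f)

theorem harmPoly_isHomogeneous {k : ℕ} {f : SymV} (hf : f.IsHomogeneous k) :
    (harmPoly k f).IsHomogeneous k := by
  refine MvPolynomial.IsHomogeneous.sum _ _ _ fun j hj => ?_
  have hj' : 2 * j ≤ k := by
    have := Finset.mem_range.1 hj
    omega
  have := (MvPolynomial.isHomogeneous_C (Fin 3) (projCoeff k j)).mul
    ((rSq_isHomogeneous.pow j).mul (lap_iterate_isHomogeneous hf j))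
  rwa [zero_add, Nat.add_sub_cancel' hj'] at this

theorem lap_harmPoly {k : ℕ} {f : SymV} (hf : f.IsHomogeneous k) : lap (harmPoly k f) = 0 := by
  have key : ∀ n, n ≤ k / 2 → ∑ j ∈ Finset.range (n + 1),
      lap (MvPolynomial.C (projCoeff k j) * (rSq ^ j * lap^[j] f)) =
        MvPolynomial.C (projCoeff k n) * (rSq ^ n * lap^[n + 1] f) := by
    intro n
    induction n with
    | zero => intro _; simp [projCoeff]
    | succ n ih =>
      intro hn
      have hn' : 2 * (n + 1) ≤ k := by omega
      rw [Finset.sum_range_succ, ih (by omega), ← MvPolynomial.smul_eq_C_mul _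
        (projCoeff k (n + 1)), map_smul, MvPolynomial.smul_eq_C_mul,
        lap_rSq_pow_mul (lap_iterate_isHomogeneous hf (n + 1)),
        Function.iterate_succ_apply' _ (n + 1)]
      have hc : projCoeff k (n + 1) *
          (2 * (n + 1) * (2 * (n + 1) + 2 * (k - 2 * (n + 1) : ℕ) + 1)) = - projCoeff k n := by
        rw [projCoeff, Finset.prod_range_succ, ← projCoeff]
        have h1 : ((k - 2 * (n + 1) : ℕ) : ℂ) = k - 2 * (n + 1) := by
          rw [Nat.cast_sub hn']; push_cast; ring
        have h2 : (2 * (n + 1) : ℂ) ≠ 0 := by exact_mod_cast (by omega : 2 * (n + 1) ≠ 0)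
        have h3 : (2 * k - 2 * (n + 1) + 1 : ℂ) ≠ 0 := by
          have : (2 * k - 2 * (n + 1) + 1 : ℂ) = ((2 * (k - (n + 1)) + 1 : ℕ) : ℂ) := by
            push_cast [Nat.cast_sub (by omega : n + 1 ≤ k)]; ring
          rw [this]
          exact_mod_cast (by omega : 2 * (k - (n + 1)) + 1 ≠ 0)
        rw [h1]
        have h4 : (2 * (n + 1) + 2 * (k - 2 * (n + 1)) + 1 : ℂ) = 2 * k - 2 * (n + 1) + 1 := by
          ring
        rw [h4]
        generalize (2 * k - 2 * (n + 1) + 1 : ℂ) = A at h3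
        field_simp
      have hC := congrArg (MvPolynomial.C (σ := Fin 3)) hc
      rw [map_mul, map_neg] at hC
      linear_combination (rSq ^ n * lap^[n + 1] f) * hC
  rw [harmPoly, map_sum, key _ le_rfl, Function.iterate_succ_apply',
    lap_eq_zero_of_lt (lap_iterate_isHomogeneous hf (k / 2)) (by omega), mul_zero, mul_zero]

/-- `f - π_k f` lies in `r² Sym^{k-2}(V_ℂ)`; together with `lap_harmPoly` this says that
`harmPoly k` is the projection for the decomposition `Sym^k = ℋ_k ⊕ r² Sym^{k-2}`. -/
theorem rSq_dvd_sub_harmPoly (k : ℕ) (f : SymV) : rSq ∣ f - harmPoly k f := by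
  rw [harmPoly, Finset.sum_range_succ']
  simp only [projCoeff, Finset.range_zero, Finset.prod_empty, map_one, pow_zero, one_mul,
    Function.iterate_zero, id_eq]
  rw [sub_add_cancel_right, dvd_neg]
  refine Finset.dvd_sum fun j _ => ?_
  exact Dvd.dvd.mul_left (Dvd.dvd.mul_right (dvd_pow_self _ (Nat.succ_ne_zero j)) _) _

/-- The orthogonal projection `π_k : Sym^k(V_ℂ) → ℋ_k(V_ℂ)` (precomposed with the projection of
the symmetric algebra to its part of degree `k`). -/
def harmProj (k : ℕ) (f : SymV) : Harm k :=
  ⟨harmPoly k (MvPolynomial.homogeneousComponent k f), mem_harmSub.2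
    ⟨harmPoly_isHomogeneous (MvPolynomial.homogeneousComponent_isHomogeneous k f),
      lap_harmPoly (MvPolynomial.homogeneousComponent_isHomogeneous k f)⟩⟩

/-! ### The action of `SL₂(ℝ)` on `ℋ_k(V_ℂ)` -/

/-- The matrix of `g ∈ SL₂(ℝ)` on `V(ℝ)` in the basis `e₁, e₂, e₃`. -/
def adMat (g : SL(2, ℝ)) (i j : Fin 3) : ℝ := coord (conj g (e j)) i

/-- The action of `g` on the symmetric algebra of `V_ℂ`. -/
def symAct (g : SL(2, ℝ)) : SymV →ₐ[ℂ] SymV :=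
  MvPolynomial.aeval fun j => toSym (conj g (e j))

theorem symAct_X (g : SL(2, ℝ)) (j : Fin 3) : symAct g (MvPolynomial.X j) =
    ∑ i, MvPolynomial.C (adMat g i j : ℂ) * MvPolynomial.X i := by
  simp [symAct, toSym, adMat]

theorem sum_adMat (g : SL(2, ℝ)) (j l : Fin 3) :
    ∑ i, sgn i * adMat g i j * adMat g i l = if j = l then sgn j else 0 := by
  unfold adMat
  rw [sum_sgn_coord _ _ (by rw [trace_conj, trace_e]) (by rw [trace_conj, trace_e]),
    conj_mul_conj, trace_conj, trace_e_mul_e]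

theorem pderiv_symAct (g : SL(2, ℝ)) (i : Fin 3) (p : SymV) :
    MvPolynomial.pderiv i (symAct g p) =
      ∑ j, MvPolynomial.C (adMat g i j : ℂ) * symAct g (MvPolynomial.pderiv j p) := by
  induction p using MvPolynomial.induction_on with
  | C a => simp [symAct]
  | add p q hp hq => simp only [map_add, hp, hq, mul_add, Finset.sum_add_distrib]
  | mul_X p j hp =>
    have hX : MvPolynomial.pderiv i (symAct g (MvPolynomial.X j)) =
        MvPolynomial.C (adMat g i j : ℂ) := by
      rw [symAct_X, map_sum]
      simp [MvPolynomial.pderiv_X, Pi.single_apply]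
    rw [map_mul, MvPolynomial.pderiv_mul, hp, hX]
    have h : ∀ l, MvPolynomial.C (adMat g i l : ℂ) *
        symAct g (MvPolynomial.pderiv l (p * MvPolynomial.X j)) =
        MvPolynomial.C (adMat g i l : ℂ) * symAct g (MvPolynomial.pderiv l p) *
          symAct g (MvPolynomial.X j) +
        if l = j then symAct g p * MvPolynomial.C (adMat g i l : ℂ) else 0 := by
      intro l
      rw [MvPolynomial.pderiv_mul, map_add, map_mul, mul_add]
      congr 1
      · ring
      · split_ifs with hl
        · subst hl
          rw [MvPolynomial.pderiv_X_self, mul_one, mul_comm]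
        · rw [MvPolynomial.pderiv_X_of_ne (Ne.symm hl), mul_zero, map_zero, mul_zero]
    rw [Finset.sum_congr rfl fun l _ => h l, Finset.sum_add_distrib, ← Finset.sum_mul,
      Finset.sum_ite_eq' Finset.univ j, if_pos (Finset.mem_univ j)]

theorem lap_symAct (g : SL(2, ℝ)) (p : SymV) : lap (symAct g p) = symAct g (lap p) := by
  have h1 : ∀ i, MvPolynomial.pderiv i (MvPolynomial.pderiv i (symAct g p)) =
      ∑ j, ∑ l, MvPolynomial.C ((adMat g i j * adMat g i l : ℝ) : ℂ) *
        symAct g (MvPolynomial.pderiv l (MvPolynomial.pderiv j p)) := by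
    intro i
    rw [pderiv_symAct, map_sum]
    refine Finset.sum_congr rfl fun j _ => ?_
    rw [MvPolynomial.pderiv_C_mul, pderiv_symAct, Finset.mul_sum]
    refine Finset.sum_congr rfl fun l _ => ?_
    rw [Complex.ofReal_mul, map_mul, mul_assoc]
  have h2 : ∀ j l, ∑ i, MvPolynomial.C (sgn i : ℂ) *
      MvPolynomial.C ((adMat g i j * adMat g i l : ℝ) : ℂ) =
        (MvPolynomial.C (((if j = l then sgn j else 0 : ℝ)) : ℂ) : SymV) := by
    intro j l
    rw [← sum_adMat g j l]
    push_cast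
    simp only [map_sum, map_mul, mul_assoc]
  rw [lap_apply, lap_apply, map_sum]
  simp only [h1, Finset.mul_sum]
  rw [Finset.sum_comm]
  refine Finset.sum_congr rfl fun j _ => ?_
  rw [Finset.sum_comm]
  have h3 : ∀ l, ∑ i, MvPolynomial.C (sgn i : ℂ) *
      (MvPolynomial.C ((adMat g i j * adMat g i l : ℝ) : ℂ) *
        symAct g (MvPolynomial.pderiv l (MvPolynomial.pderiv j p))) =
      MvPolynomial.C (((if j = l then sgn j else 0 : ℝ)) : ℂ) *
        symAct g (MvPolynomial.pderiv l (MvPolynomial.pderiv j p)) := by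
    intro l
    rw [← h2, Finset.sum_mul]
    exact Finset.sum_congr rfl fun _ _ => by ring
  simp only [h3]
  rw [Finset.sum_eq_single j]
  · rw [map_mul, if_pos rfl]; simp [symAct]
  · intro l _ hl
    rw [if_neg (Ne.symm hl)]; simp
  · simp

theorem symAct_mem {k : ℕ} (g : SL(2, ℝ)) {p : SymV} (hp : p ∈ harmSub k) :
    symAct g p ∈ harmSub k := by
  rw [mem_harmSub] at hp ⊢
  refine ⟨?_, by rw [lap_symAct, hp.2, map_zero]⟩
  have := hp.1.aeval (fun j => toSym (conj g (e j))) (n := 1) fun j => by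
    refine MvPolynomial.IsHomogeneous.sum _ _ _ fun i _ => ?_
    simpa using (MvPolynomial.isHomogeneous_C (Fin 3) (coord (conj g (e j)) i : ℂ)).mul
      (MvPolynomial.isHomogeneous_X ℂ i)
  rwa [one_mul] at this

/-- The representation of `SL₂(ℝ)` on `ℋ_k(V_ℂ)`. -/
def rho (k : ℕ) (g : SL(2, ℝ)) : Harm k →ₗ[ℂ] Harm k :=
  (symAct g).toLinearMap.restrict fun _ hp => symAct_mem g hp

/-- The raising operator `R`, i.e. the derivation of the symmetric algebra that extends
the action `X ↦ [u, X]` on `V` of the infinitesimal generator `u = (0 1; 0 0)` of `N`. -/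
def raise : Derivation ℂ SymV SymV :=
  MvPolynomial.mkDerivation ℂ fun j => toSym (uVec ℝ * e j - e j * uVec ℝ)

theorem raise_X : raise (MvPolynomial.X 0) = MvPolynomial.X 1 ∧
    raise (MvPolynomial.X 1) = - (MvPolynomial.X 0 + MvPolynomial.X 2) ∧
    raise (MvPolynomial.X 2) = - MvPolynomial.X 1 := by
  have h2 : (√2 : ℝ) ≠ 0 := by positivity
  have h22 : (√2 : ℝ) * √2 = 2 := Real.mul_self_sqrt (by norm_num)
  have h3 : (√2 : ℝ)⁻¹ / √2 = 1 / 2 := by field_simp; rw [pow_two, h22]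
  have h4 : (-(√2 : ℂ)⁻¹ - (√2 : ℂ)⁻¹) / √2 = -1 := by
    have : (-(√2 : ℝ)⁻¹ - (√2)⁻¹) / √2 = -1 := by rw [sub_div, neg_div, h3]; norm_num
    exact_mod_cast congrArg (Complex.ofReal) this
  have h5 : ((√2 : ℂ)⁻¹ + (√2 : ℂ)⁻¹) / √2 = 1 := by
    have : ((√2 : ℝ)⁻¹ + (√2)⁻¹) / √2 = 1 := by rw [add_div, h3]; norm_num
    exact_mod_cast congrArg (Complex.ofReal) this
  refine ⟨?_, ?_, ?_⟩ <;>
    simp [raise, MvPolynomial.mkDerivation_X, toSym, Fin.sum_univ_three, coord, e, uVec]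
  · rw [h5, map_one]
  · rw [h4, map_neg, map_one]; ring
  · rw [h4, map_neg, map_one]; ring

theorem pderiv_raise (p : SymV) :
    MvPolynomial.pderiv 0 (raise p) = raise (MvPolynomial.pderiv 0 p) - MvPolynomial.pderiv 1 p ∧
    MvPolynomial.pderiv 1 (raise p) = raise (MvPolynomial.pderiv 1 p) + MvPolynomial.pderiv 0 p
      - MvPolynomial.pderiv 2 p ∧
    MvPolynomial.pderiv 2 (raise p) = raise (MvPolynomial.pderiv 2 p) - MvPolynomial.pderiv 1 p := by
  obtain ⟨r0, r1, r2⟩ := raise_X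
  have h0 : (⁅MvPolynomial.pderiv (R := ℂ) (0 : Fin 3), raise⁆ : Derivation ℂ SymV SymV) = - MvPolynomial.pderiv (R := ℂ) (1 : Fin 3) :=
    MvPolynomial.derivation_ext fun i => by
      rw [Derivation.commutator_apply]
      fin_cases i <;> simp [r0, r1, r2, MvPolynomial.pderiv_X]
  have h1 : (⁅MvPolynomial.pderiv (R := ℂ) (1 : Fin 3), raise⁆ : Derivation ℂ SymV SymV) =
      MvPolynomial.pderiv (R := ℂ) (0 : Fin 3) - MvPolynomial.pderiv 2 :=
    MvPolynomial.derivation_ext fun i => by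
      rw [Derivation.commutator_apply]
      fin_cases i <;> simp [r0, r1, r2, MvPolynomial.pderiv_X]
  have h2 : (⁅MvPolynomial.pderiv (R := ℂ) (2 : Fin 3), raise⁆ : Derivation ℂ SymV SymV) = - MvPolynomial.pderiv (R := ℂ) (1 : Fin 3) :=
    MvPolynomial.derivation_ext fun i => by
      rw [Derivation.commutator_apply]
      fin_cases i <;> simp [r0, r1, r2, MvPolynomial.pderiv_X]
  have k0 := DFunLike.congr_fun h0 p
  have k1 := DFunLike.congr_fun h1 p
  have k2 := DFunLike.congr_fun h2 p
  rw [Derivation.commutator_apply] at k0 k1 k2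
  simp only [Derivation.neg_apply, Derivation.sub_apply] at k0 k1 k2
  refine ⟨?_, ?_, ?_⟩
  · linear_combination k0
  · linear_combination k1
  · linear_combination k2

theorem lap_raise (p : SymV) : lap (raise p) = raise (lap p) := by
  simp only [lap_apply, Fin.sum_univ_three, sgn]
  simp [(pderiv_raise _).1, (pderiv_raise _).2.1, (pderiv_raise _).2.2]
  ring

theorem raise_mem {k : ℕ} {p : SymV} (hp : p ∈ harmSub (k + 1)) : raise p ∈ harmSub (k + 1) := by
  rw [mem_harmSub] at hp ⊢
  refine ⟨?_, by rw [lap_raise, hp.2, map_zero]⟩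
  have h : raise p = ∑ j, MvPolynomial.pderiv j p * raise (MvPolynomial.X j) := by
    have : raise = ∑ j, raise (MvPolynomial.X j) • MvPolynomial.pderiv (R := ℂ) (j : Fin 3) :=
      MvPolynomial.derivation_ext fun i => by
        rw [Fin.sum_univ_three]
        fin_cases i <;> simp [MvPolynomial.pderiv_X]
    conv_lhs => rw [this]
    simp [Fin.sum_univ_three, mul_comm]
  rw [h]
  refine MvPolynomial.IsHomogeneous.sum _ _ _ fun j _ => ?_
  have h1 : (raise (MvPolynomial.X j)).IsHomogeneous 1 := by
    rw [raise, MvPolynomial.mkDerivation_X]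
    refine MvPolynomial.IsHomogeneous.sum _ _ _ fun i _ => ?_
    simpa using (MvPolynomial.isHomogeneous_C (Fin 3)
      (coord (uVec ℝ * e j - e j * uVec ℝ) i : ℂ)).mul (MvPolynomial.isHomogeneous_X ℂ i)
  exact (hp.1.pderiv (i := j)).mul h1

theorem uVec'_pow_mem (k : ℕ) : toSym (uVec' ℝ) ^ k ∈ harmSub k := by
  have hu : (toSym (uVec' ℝ)).IsHomogeneous 1 := by
    refine MvPolynomial.IsHomogeneous.sum _ _ _ fun i _ => ?_
    simpa using (MvPolynomial.isHomogeneous_C (Fin 3) (coord (uVec' ℝ) i : ℂ)).mul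
      (MvPolynomial.isHomogeneous_X ℂ i)
  rw [mem_harmSub]
  refine ⟨by simpa using hu.pow k, ?_⟩
  have hd : ∀ i, MvPolynomial.pderiv i (toSym (uVec' ℝ)) =
      MvPolynomial.C (coord (uVec' ℝ) i : ℂ) := by
    intro i
    fin_cases i <;> simp [toSym, Fin.sum_univ_three, MvPolynomial.pderiv_X]
  rw [lap_apply]
  simp only [MvPolynomial.pderiv_pow, hd, MvPolynomial.pderiv_mul, Fin.sum_univ_three, sgn]
  simp [coord, uVec', neg_div]

theorem raise_iterate_mem (k j : ℕ) : raise^[j] (toSym (uVec' ℝ) ^ (k + 1)) ∈ harmSub (k + 1) := by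
  induction j with
  | zero => exact uVec'_pow_mem (k + 1)
  | succ j ih => rw [Function.iterate_succ_apply']; exact raise_mem ih

/-- The weight vector `v_{-2} = (-2)^k (k!)² / ((2k)! (k-1)!) R^{k-1} u'^k` of `ℋ_k(V_ℂ)`, for
`k > 0` (and `0` for `k = 0`); it is normalized by `R v_{-2} = k v₀` for
`v₀ = 2^{k/2} π_k(e₂^k)`. -/
def vMinusTwo : (k : ℕ) → Harm k
  | 0 => 0
  | k + 1 => ((-2) ^ (k + 1) * ((k + 1).factorial : ℂ) ^ 2 /
      ((2 * (k + 1)).factorial * k.factorial) : ℂ) •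
        (⟨raise^[k] (toSym (uVec' ℝ) ^ (k + 1)), raise_iterate_mem k k⟩ : harmSub (k + 1))

/-! ### The Borel–Serre compactification

The Borel–Serre enlargement `D̄` of `D ≃ ℍ` replaces every rational boundary point `ℓ` by the
line `N_ℓ ≃ ℝ`. Its charts, as a surface with boundary, are indexed by `σ ∈ SL₂(ℤ)`: the chart
`σ` is the closed half plane of all `(x, t)`, `t ≥ 0`, where `(x, t)` with `t > 0` is the point
`σ (x + i / t)` of `ℍ` and `(x, 0)` is the point `n_ℓ(x) z_ℓ = σ n(x) z_∞` of the boundary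
component of the cusp `ℓ = σ ∞`. -/

/-- The closed half plane of all `(x, t)` with `t ≥ 0`. -/
def halfPlane : Set (ℝ × ℝ) := {q | 0 ≤ q.2}

/-- The point `σ (x + i / t)`, for `t > 0`. -/
def chartPt (σ : SL(2, ℤ)) (q : ℝ × ℝ) : ℂ :=
  ((σ 0 0 : ℂ) * (q.1 + Complex.I / q.2) + σ 0 1) / ((σ 1 0 : ℂ) * (q.1 + Complex.I / q.2) + σ 1 1)

/-- The change of charts given by `σ ∈ SL₂(ℤ)`: the coordinates `(x', t')` with
`x' + i / t' = σ (x + i / t)`. If `σ ∞ = ∞`, i.e. `σ = ± n(m)`, then it is the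
translation `(x, t) ↦ (x + m, t)`, also for `t = 0`. -/
def trans (σ : SL(2, ℤ)) (q : ℝ × ℝ) : ℝ × ℝ :=
  ((chartPt σ q).re, ((chartPt σ q).im)⁻¹)

/-- The points `q` of the chart `σ` and `q'` of the chart `σ'` are the same point of `D̄`. -/
def SamePoint (σ : SL(2, ℤ)) (q : ℝ × ℝ) (σ' : SL(2, ℤ)) (q' : ℝ × ℝ) : Prop :=
  (0 < q.2 ∨ q.2 = 0 ∧ (σ'⁻¹ * σ) 1 0 = 0) ∧ q' = trans (σ'⁻¹ * σ) q

/-- The Borel–Serre compactification `X̄ = Γ \ D̄`, with the quotient topology. An element `γ` of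
`Γ` sends the point `q` of the chart `σ` to the point `q` of the chart `γ σ`. -/
def BorelSerre (Γ : Subgroup SL(2, ℤ)) : Type :=
  Quot fun p p' : SL(2, ℤ) × halfPlane => ∃ γ ∈ Γ, SamePoint (γ * p.1) p.2 p'.1 p'.2

instance (Γ : Subgroup SL(2, ℤ)) : TopologicalSpace (BorelSerre Γ) :=
  inferInstanceAs (TopologicalSpace (Quot _))

/-! ### Differential forms and the mapping cone

A `p`-form on `X̄` (or `∂X̄`) with values in the flat bundle of `ℋ_k(V_ℂ)` is a `Γ`-equivariant
`ℋ_k(V_ℂ)`-valued `p`-form on `D̄` (or `∂D̄`). It is given by its expressions in the charts. -/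

/-- Chart expressions of `ℋ_k(V_ℂ)`-valued `p`-forms on `D̄` (only the values on the half plane
are relevant). -/
abbrev ChartForm (k p : ℕ) : Type := SL(2, ℤ) → ℝ × ℝ → (ℝ × ℝ) [⋀^Fin p]→L[ℝ] Harm k

/-- Chart expressions of `ℋ_k(V_ℂ)`-valued `p`-forms on `∂D̄`; the boundary component of the cusp
`σ ∞` has the coordinate `x ∈ ℝ`. -/
abbrev BdForm (k p : ℕ) : Type := SL(2, ℤ) → ℝ → ℝ [⋀^Fin p]→L[ℝ] Harm k

/-- `η` is a smooth `p`-form on `X̄` with values in the flat bundle of `ℋ_k(V_ℂ)`: it is smooth up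
to the boundary in all charts, and its expressions are compatible with the changes of charts and
the action of `Γ`, that is, `γ^* η = γ ∘ η`. -/
structure IsForm (Γ : Subgroup SL(2, ℤ)) {k p : ℕ} (η : ChartForm k p) : Prop where
  smooth : ∀ σ, ContDiffOn ℝ ∞ (η σ) halfPlane
  compat : ∀ γ ∈ Γ, ∀ σ σ' q q', SamePoint (γ * σ) q σ' q' →
    ∀ ξ, η σ' q' (fun i => fderiv ℝ (trans (σ'⁻¹ * (γ * σ))) q (ξ i)) =
      rho k (γ : SL(2, ℝ)) (η σ q ξ)

/-- `β` is a smooth `p`-form on `∂X̄`, the disjoint union of the circles `X_ℓ = Γ_ℓ \ N_ℓ`, with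
values in the flat bundle of `ℋ_k(V_ℂ)`. -/
structure IsBdForm (Γ : Subgroup SL(2, ℤ)) {k p : ℕ} (β : BdForm k p) : Prop where
  smooth : ∀ σ, ContDiff ℝ ∞ (β σ)
  compat : ∀ γ ∈ Γ, ∀ σ σ' x x', SamePoint (γ * σ) (x, 0) σ' (x', 0) →
    ∀ ξ, β σ' x' ξ = rho k (γ : SL(2, ℝ)) (β σ x ξ)

/-- The exterior derivative of forms on `X̄`. -/
def dForm {k p : ℕ} (η : ChartForm k p) : ChartForm k (p + 1) :=
  fun σ q => extDerivWithin (η σ) halfPlane q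

/-- The exterior derivative of forms on `∂X̄`. -/
def dBd {k p : ℕ} (β : BdForm k p) : BdForm k (p + 1) := fun σ x => extDeriv (β σ) x

/-- The pullback `ι^* η` of a form on `X̄` to `∂X̄`. Its component at `σ` is `ι_ℓ^* η` for the
boundary circle of the cusp `ℓ = σ ∞`. -/
def restrBd {k p : ℕ} (η : ChartForm k p) : BdForm k p := fun σ x =>
  (η σ (x, 0)).compContinuousLinearMap (ContinuousLinearMap.inl ℝ ℝ ℝ)

/-- The differential `d (a, b) = (d a, ι^* a - d b)` of the mapping cone of `ι^*`. -/
def dCone {k p : ℕ} (c : ChartForm k (p + 1) × BdForm k p) :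
    ChartForm k (p + 2) × BdForm k (p + 1) :=
  (dForm c.1, restrBd c.1 - dBd c.2)

/-- `(a, b)` is a cocycle of degree `p + 1` in the mapping cone of
`ι^* : A^•(X̄, ℋ_k) → A^•(∂X̄, ℋ_k)`. -/
structure IsConeCocycle (Γ : Subgroup SL(2, ℤ)) {k p : ℕ} (c : ChartForm k (p + 1) × BdForm k p) :
    Prop where
  isForm : IsForm Γ c.1
  isBdForm : IsBdForm Γ c.2
  closed : ∀ σ, ∀ q ∈ halfPlane, (dCone c).1 σ q = 0
  closed_bd : (dCone c).2 = 0

/-- The 1-form `η ⊗ v` for a linear form `η`. -/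
def oneForm {E F : Type*} [NormedAddCommGroup E] [NormedSpace ℝ E] [NormedAddCommGroup F]
    [NormedSpace ℝ F] (η : E →L[ℝ] ℝ) (v : F) : E [⋀^Fin 1]→L[ℝ] F :=
  ContinuousAlternatingMap.ofSubsingleton ℝ E F 0 (η.smulRight v)

/-! ### The Schwartz form `φ^V_{1,[k]}` on `D` -/

/-- `n(x) ∈ N`. -/
def nMat (x : ℝ) : SL(2, ℝ) := ⟨!![1, x; 0, 1], by simp⟩

/-- `a(t)`, for `t > 0` (and the identity matrix otherwise). -/
def aMat (t : ℝ) : SL(2, ℝ) :=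
  if h : 0 < t then ⟨!![t, 0; 0, t⁻¹], by simp [h.ne']⟩ else 1

/-- `g_z = n(x) a(√y)`, which moves `i` to `z = x + i y`. -/
def gMat (z : ℍ) : SL(2, ℝ) := nMat z.re * aMat √z.im

/-- The Gaussian at the base point, in the coordinates of `e₁, e₂, e₃`. -/
def gauss (x : Fin 3 → ℝ) : ℝ := Real.exp (-Real.pi * ∑ i, x i ^ 2)

/-- The Howe operator `𝒟_j = x_j - (1 / 2π) ∂ / ∂x_j`. -/
def howe (j : Fin 3) (f : (Fin 3 → ℝ) → ℝ) (x : Fin 3 → ℝ) : ℝ :=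
  x j * f x - 1 / (2 * Real.pi) * deriv (fun t => f (Function.update x j t)) (x j)

/-- `(𝒟_α ∘ 𝒟_{β₁} ∘ ⋯ ∘ 𝒟_{β_k}) φ₀`, with `α, β_i ∈ {1, 2}`. -/
def howeGauss {k : ℕ} (α : Fin 2) (β : Fin k → Fin 2) : (Fin 3 → ℝ) → ℝ :=
  howe α.castSucc ((List.ofFn β).foldr (fun j f => howe j.castSucc f) gauss)

/-- The 1-forms `ω₁ = dy / y` and `ω₂ = - dx / y` at `z ∈ ℍ`: the translates under `g_z` of the
basis of `𝔭^*` that is dual to the basis `e₁, e₂` of `T_{z₀} D = e₃^⊥`. -/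
def omega (z : ℍ) : Fin 2 → ℂ →L[ℝ] ℝ :=
  ![z.im⁻¹ • Complex.imCLM, -(z.im⁻¹ • Complex.reCLM)]

/-- The `ℋ_k(V_ℂ)`-valued 1-form `φ^V_{1,[k]}(x, z)`, at `x ∈ V(ℝ)` and `z ∈ ℍ`:
`2^{-(k+1/2)} ∑_{α, β} (𝒟_α 𝒟_{β₁} ⋯ 𝒟_{β_k} φ₀)(g_z⁻¹ x) ω_α ⊗ g_z π_k(e_{β₁} ⋯ e_{β_k})`. -/
def phiV (k : ℕ) (x : Matrix (Fin 2) (Fin 2) ℝ) (z : ℍ) : ℂ [⋀^Fin 1]→L[ℝ] Harm k :=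
  (1 / (2 : ℝ) ^ ((k : ℝ) + 1 / 2)) • ∑ α : Fin 2, ∑ β : Fin k → Fin 2,
    howeGauss α β (coord (conj (gMat z)⁻¹ x)) •
      oneForm (omega z α) (rho k (gMat z)
        (harmProj k (∏ i, MvPolynomial.X (β i).castSucc)))

/-! ### The theta series of `L + h` -/

/-- Rational matrices as real ones. -/
def toReal (x : Matrix (Fin 2) (Fin 2) ℚ) : Matrix (Fin 2) (Fin 2) ℝ := x.map (fun a => (a : ℝ))

/-- `L` is an even lattice of full rank in `V(ℚ)`, the space of traceless rational matrices. -/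
structure IsEvenLattice (L : Submodule ℤ (Matrix (Fin 2) (Fin 2) ℚ)) : Prop where
  fg : L.FG
  span_eq : Submodule.span ℚ (L : Set (Matrix (Fin 2) (Fin 2) ℚ)) =
    LinearMap.ker (Matrix.traceLinearMap (Fin 2) ℚ ℚ)
  even : ∀ x ∈ L, ∃ n : ℤ, (x * x).trace = 2 * n

/-- `h` lies in the dual lattice `L^#` of `L`. -/
def IsDual (L : Submodule ℤ (Matrix (Fin 2) (Fin 2) ℚ)) (h : Matrix (Fin 2) (Fin 2) ℚ) : Prop :=
  h.trace = 0 ∧ ∀ x ∈ L, ∃ n : ℤ, (h * x).trace = n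

/-- The coset `ℒ = L + h`. -/
def latCoset (L : Submodule ℤ (Matrix (Fin 2) (Fin 2) ℚ)) (h : Matrix (Fin 2) (Fin 2) ℚ) :
    Set (Matrix (Fin 2) (Fin 2) ℚ) := {x | x - h ∈ L}

/-- `e^{π i (x, x) Re τ}`. -/
def phase (τ : ℍ) (x : Matrix (Fin 2) (Fin 2) ℚ) : ℂ :=
  Complex.exp (Real.pi * Complex.I * ((x * x).trace : ℂ) * τ.re)

/-- The term `φ^V_{1,[k]}(√v x, z) e^{π i (x, x) u}` of the theta series, `τ = u + i v`. -/
def thetaVTerm (k : ℕ) (τ z : ℍ) (x : Matrix (Fin 2) (Fin 2) ℚ) : ℂ [⋀^Fin 1]→L[ℝ] Harm k :=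
  phase τ x • phiV k (√τ.im • toReal x) z

/-- `θ_{ℒ_V}(τ, z, φ^V_{1,[k]}) = v^{-k/2} ∑_{x ∈ L + h} φ^V_{1,[k]}(√v x, z) e^{π i (x, x) u}`. -/
def thetaV (k : ℕ) (L : Submodule ℤ (Matrix (Fin 2) (Fin 2) ℚ)) (h : Matrix (Fin 2) (Fin 2) ℚ)
    (τ z : ℍ) : ℂ [⋀^Fin 1]→L[ℝ] Harm k :=
  (τ.im ^ (-(k : ℝ) / 2)) • ∑' x : latCoset L h, thetaVTerm k τ z x

/-- The form `Θ` on `X̄` extends the 1-form `θ` on `ℍ`: in every chart it is, for `t > 0`, the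
pullback of `θ` under `(x, t) ↦ σ (x + i / t)`. -/
def Extends {k : ℕ} (Θ : ChartForm k 1) (θ : ℍ → ℂ [⋀^Fin 1]→L[ℝ] Harm k) : Prop :=
  ∀ σ q, 0 < q.2 → Θ σ q =
    (θ (ofComplex (chartPt σ q))).compContinuousLinearMap (fderiv ℝ (chartPt σ) q)

/-! ### Boundary data at the cusp `ℓ = σ ∞`, with `σ_ℓ = σ ∈ SL₂(ℤ)` -/

/-- `σ ∈ SL₂(ℤ)` as an element of `SL₂(ℚ)`. -/
def toQ (σ : SL(2, ℤ)) : SL(2, ℚ) := Matrix.SpecialLinearGroup.map (Int.castRingHom ℚ) σ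

/-- The positively oriented basis vector `u_ℓ = σ u` of `ℓ`. -/
def uCusp (σ : SL(2, ℤ)) : Matrix (Fin 2) (Fin 2) ℚ := conj (toQ σ) (uVec ℚ)

/-- The vector `u'_ℓ = σ u'`. -/
def uCusp' (σ : SL(2, ℤ)) : Matrix (Fin 2) (Fin 2) ℚ := conj (toQ σ) (uVec' ℚ)

/-- The positive definite line `W_ℓ = ℓ^⊥ ∩ ℓ'^⊥` of `V(ℚ)`. -/
def wLine (σ : SL(2, ℤ)) : Submodule ℚ (Matrix (Fin 2) (Fin 2) ℚ) where
  carrier := {w | w.trace = 0 ∧ (w * uCusp σ).trace = 0 ∧ (w * uCusp' σ).trace = 0}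
  add_mem' := by
    rintro a b ⟨h1, h2, h3⟩ ⟨h4, h5, h6⟩
    simp [add_mul, Matrix.trace_add, h1, h2, h3, h4, h5, h6]
  zero_mem' := by simp
  smul_mem' := by
    rintro c a ⟨h1, h2, h3⟩
    simp [Matrix.trace_smul, h1, h2, h3]

/-- `L_ℓ = L ∩ ℓ`. -/
def latL (L : Submodule ℤ (Matrix (Fin 2) (Fin 2) ℚ)) (σ : SL(2, ℤ)) :
    Submodule ℤ (Matrix (Fin 2) (Fin 2) ℚ) :=
  L ⊓ (Submodule.span ℚ {uCusp σ}).restrictScalars ℤ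

/-- `L_{W_ℓ} = L ∩ W_ℓ`. -/
def latW (L : Submodule ℤ (Matrix (Fin 2) (Fin 2) ℚ)) (σ : SL(2, ℤ)) :
    Submodule ℤ (Matrix (Fin 2) (Fin 2) ℚ) :=
  L ⊓ (wLine σ).restrictScalars ℤ

/-- `det L_ℓ`: the number `M > 0` with `L ∩ ℓ = ℤ M u_ℓ`. -/
def detL (L : Submodule ℤ (Matrix (Fin 2) (Fin 2) ℚ)) (σ : SL(2, ℤ)) : ℝ :=
  sInf {m : ℝ | 0 < m ∧ ∃ r : ℚ, (r : ℝ) = m ∧ r • uCusp σ ∈ L}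

/-- The set of cosets `C_j = (L_ℓ + h_{ℓ,j}) ⊕ (L_{W_ℓ} + h_{W_ℓ,j})` of `L_ℓ ⊕ L_{W_ℓ}` whose
disjoint union is `ℒ ∩ ℓ^⊥`. -/
def cuspCosets (L : Submodule ℤ (Matrix (Fin 2) (Fin 2) ℚ)) (h : Matrix (Fin 2) (Fin 2) ℚ)
    (σ : SL(2, ℤ)) : Set (Set (Matrix (Fin 2) (Fin 2) ℚ)) :=
  {C | ∃ x ∈ latCoset L h, (x * uCusp σ).trace = 0 ∧ C = {y | y - x ∈ latL L σ ⊔ latW L σ}}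

open Classical in
/-- The function `ℒ̂_{W_ℓ} = (det L_ℓ)⁻¹ ∑_j 1_{L_{W_ℓ} + h_{W_ℓ,j}}` on `W_ℓ`, extended by zero.
Here `L_{W_ℓ} + h_{W_ℓ,j}` is the image of `C_j` under the projection `ℓ ⊕ W_ℓ → W_ℓ`. -/
def hatL (L : Submodule ℤ (Matrix (Fin 2) (Fin 2) ℚ)) (h : Matrix (Fin 2) (Fin 2) ℚ)
    (σ : SL(2, ℤ)) (w : Matrix (Fin 2) (Fin 2) ℚ) : ℝ :=
  if w ∈ wLine σ then
    ({C ∈ cuspCosets L h σ | ∃ a : ℚ, a • uCusp σ + w ∈ C}.ncard : ℝ) / detL L σ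
  else 0

/-- The Hermite polynomial `H_j(t) = (-1)^j e^{t²} (d/dt)^j e^{-t²}`. -/
def hermiteH (j : ℕ) (t : ℝ) : ℝ :=
  (-1) ^ j * Real.exp (t ^ 2) * iteratedDeriv j (fun s => Real.exp (-s ^ 2)) t

/-- `H̃_j(x) = (2π)^{-j/2} H_j(√(2π) x)`. -/
def hermiteHt (j : ℕ) (x : ℝ) : ℝ :=
  (2 * Real.pi) ^ (-(j : ℝ) / 2) * hermiteH j (√(2 * Real.pi) * x)

/-- The coordinate of `w ∈ W_ℓ` with respect to `σ e₂`. -/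
def wCoord (σ : SL(2, ℤ)) (w : Matrix (Fin 2) (Fin 2) ℚ) : ℝ :=
  coord (toReal (conj (toQ σ)⁻¹ w)) 1

/-- The 1-form `φ^{N_ℓ}_{1,[k]}(w, x) = -2^{-(k+1/2)} H̃_{k+1}(w) e^{-π w²} dx ⊗ σ n(x) π_k(e₂^k)`
on `N_ℓ`, where `w` is the coordinate on `W_ℓ(ℝ)` with respect to `σ e₂`. -/
def phiN (k : ℕ) (σ : SL(2, ℤ)) (w x : ℝ) : ℝ [⋀^Fin 1]→L[ℝ] Harm k :=
  (-(1 / (2 : ℝ) ^ ((k : ℝ) + 1 / 2)) * hermiteHt (k + 1) w * Real.exp (-Real.pi * w ^ 2)) •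
    oneForm (ContinuousLinearMap.id ℝ ℝ)
      (rho k ((σ : SL(2, ℝ)) * nMat x) (harmProj k (MvPolynomial.X 1 ^ k)))

/-- The function `ϕ^{N_ℓ}_{[k]}(w, x) = -(2^{3k/2+1/2} k)⁻¹ H̃_{k+1}(w) e^{-π w²} σ n(x) v_{-2}`,
for `k > 0`. -/
def psiN (k : ℕ) (σ : SL(2, ℤ)) (w x : ℝ) : ℝ [⋀^Fin 0]→L[ℝ] Harm k :=
  (-(1 / ((2 : ℝ) ^ (3 * (k : ℝ) / 2 + 1 / 2) * k)) * hermiteHt (k + 1) w *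
    Real.exp (-Real.pi * w ^ 2)) •
      ContinuousAlternatingMap.constOfIsEmpty ℝ ℝ (Fin 0)
        (rho k ((σ : SL(2, ℝ)) * nMat x) (vMinusTwo k))

/-- The term `ℒ̂_{W_ℓ}(w) φ(√v w, x) e^{π i (w, w) u}` of the unary theta series of a family `φ` of
forms on the `N_ℓ`. -/
def thetaBdTerm {k p : ℕ} (φ : SL(2, ℤ) → ℝ → ℝ → ℝ [⋀^Fin p]→L[ℝ] Harm k)
    (L : Submodule ℤ (Matrix (Fin 2) (Fin 2) ℚ)) (h : Matrix (Fin 2) (Fin 2) ℚ)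
    (τ : ℍ) (σ : SL(2, ℤ)) (x : ℝ) (w : Matrix (Fin 2) (Fin 2) ℚ) : ℝ [⋀^Fin p]→L[ℝ] Harm k :=
  hatL L h σ w • phase τ w • φ σ (√τ.im * wCoord σ w) x

/-- The unary theta series
`θ_{ℒ̂_{W_ℓ}}(τ, φ) = v^{-(k+1)/2} ∑_{w ∈ W_ℓ} ℒ̂_{W_ℓ}(w) φ(√v w) e^{π i (w, w) u}`, for all
cusps `ℓ = σ ∞` at a time. -/
def thetaBd {k p : ℕ} (φ : SL(2, ℤ) → ℝ → ℝ → ℝ [⋀^Fin p]→L[ℝ] Harm k)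
    (L : Submodule ℤ (Matrix (Fin 2) (Fin 2) ℚ)) (h : Matrix (Fin 2) (Fin 2) ℚ)
    (τ : ℍ) : BdForm k p := fun σ x =>
  (τ.im ^ (-((k : ℝ) + 1) / 2)) • ∑' w : wLine σ, thetaBdTerm φ L h τ σ x w

end Spectacle

end

/-!
The theorem is an asymptotic statement at each cusp, made exact by Poisson summation, together with
an equivariant primitive of the Schwartz form that yields closedness and equivariance.

In the chart of `σ ∈ SL₂(ℤ)` write `z = σ (x + i / t)` and `σ⁻¹ X = (b a; c -b)` for `X ∈ L + h`. The
Howe operators applied to the Gaussian are Hermite functions, so a coefficient of the theta series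
is a sum over `(b, a, c)` of terms `p e^Φ` with `p`, `Φ` polynomials in `x, t, t⁻¹, a, b, c`, where `Φ`
is `-π Im τ (t² (a + 2bx - cx²)² + (c/t)² + 2 (b - cx)²)` (`exists_chartForm_expansion`).
The class of functions `∑ ε p e^Φ` is closed under both partial derivatives, and if `e^Φ` is at most
`e^{C - δ (|a| + |b| + |c| + t⁻²)}` locally in `(x, t)`, then the sum, extended by zero to `t ≤ 0`, is
smooth on the whole plane (`contDiff_tsum_expPoly`). The vectors with `c ≠ 0` satisfy this bound,
because `c` has bounded denominators. Those with `c = 0` lie in `ℓ^⊥`; for fixed `b` they form a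
coset of `ℤ (det L_ℓ)` in `a`, and Poisson summation (`tsum_expPoly_lat_eq_cusp`) replaces the sum over
this coset by a sum over frequencies `n` of terms with exponent `-const (n/t)² - 2π Im τ b²`, which
satisfy the bound for `n ≠ 0`. For `n = 0` the factor `(n/t)^m` kills all terms but those without a
Hermite polynomial in `x₁`, i.e. with every Howe operator in the direction of `e₂`, and these are
independent of `t`: they add up to a unary theta series times `dx ⊗ σ n(x) π_k(e₂^k)`. Hence
the theta form extends to a smooth form with the asserted restriction (`IsCuspSet.exists_form`,
`exists_isChartExtension`); the weights `𝓛̂_{W_ℓ}` are computed in `hatL_wEquiv`.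

For a fixed `X` the form `φ^V_{1,[k]}(X, ·)` is the differential of an explicit function `prim k X` of
`z`, a combination of the `π_k(X^{k-i} E^i)` whose coefficients are functions of `(X, E)`, where `E = E(z)`
spans the negative line of `z` (`hasFDerivAt_prim`). The identity behind this holds only
modulo `r² = e₁² + e₂² - e₃²`: both sides are built from two-variable Hermite polynomials whose data
agree since `e₁² + e₂² ≡ e₃²` (`rSq_dvd_howe_sub`), and `π_k` kills the multiples of `r²`. As `E(z)` is
visibly `SL₂(ℝ)`-equivariant, so are the primitives and the forms (`prim_moebius`, `chartForm_mul`).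
Equivariance of the theta form for `t > 0` follows by permuting `L + h`, and closedness follows term by
term; both pass to `t = 0` by continuity, the changes of charts there being translations.

On the boundary, `R^j u'^k` is computed modulo `r²` (`rSq_dvd_raise_iterate`), which gives
`R v_{-2} = k 2^{k/2} π_k(e₂^k)`; since `d/dx n(x) v = n(x) R v`, the section `σ n(x) v_{-2}` is a
primitive of the boundary form. That these sections are `Γ`-equivariant requires the unary theta series at
`Γ`-equivalent cusps to agree. This needs no lattice argument: their products with the nonzero
form `dx ⊗ σ n(x) π_k(e₂^k)` are restrictions of one equivariant form
(`IsChartExtension.const_eq`).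
-/

noncomputable section

namespace Spectacle

/-! ### Series of exponential polynomials in the coordinates of a chart -/

section ExpPoly

/-- The point `(x, t, t⁻¹, a, b, c)` at which polynomials in six variables are evaluated: `(x, t)`
are the coordinates of a chart and `v = (a, b, c)` are the parameters of a term of a series. -/
def evalPt (v : Fin 3 → ℝ) (q : ℝ × ℝ) : Fin 6 → ℂ :=
  ![(q.1 : ℂ), (q.2 : ℂ), ((q.2)⁻¹ : ℂ), (v 0 : ℂ), (v 1 : ℂ), (v 2 : ℂ)]

/-- The polynomials in `x, t, t⁻¹, a, b, c`. -/
abbrev Poly6 : Type := MvPolynomial (Fin 6) ℂ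

/-- `∂/∂x` on polynomials in `x, t, t⁻¹, a, b, c`. -/
def dX (p : Poly6) : Poly6 := MvPolynomial.pderiv 0 p

/-- `∂/∂t` on polynomials in `x, t, t⁻¹, a, b, c`. -/
def dT (p : Poly6) : Poly6 :=
  MvPolynomial.pderiv 1 p - MvPolynomial.X 2 ^ 2 * MvPolynomial.pderiv 2 p

/-- The function `(x, t) ↦ p e^Φ` for polynomials `p` and `Φ` in `x, t, t⁻¹, a, b, c`, extended by
zero to `t ≤ 0`. -/
def expPoly (Φ p : Poly6) (v : Fin 3 → ℝ) (q : ℝ × ℝ) : ℂ :=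
  if 0 < q.2 then MvPolynomial.eval (evalPt v q) p * Complex.exp (MvPolynomial.eval (evalPt v q) Φ)
  else 0

/-- The `ℂ`-valued real-linear form `A dx + B dt`. -/
def lin2 (A B : ℂ) : ℝ × ℝ →L[ℝ] ℂ :=
  (ContinuousLinearMap.fst ℝ ℝ ℝ).smulRight A + (ContinuousLinearMap.snd ℝ ℝ ℝ).smulRight B

@[simp] theorem lin2_apply (A B : ℂ) (ξ : ℝ × ℝ) : lin2 A B ξ = ξ.1 • A + ξ.2 • B := rfl

theorem norm_lin2_le (A B : ℂ) : ‖lin2 A B‖ ≤ ‖A‖ + ‖B‖ := by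
  refine ContinuousLinearMap.opNorm_le_bound _ (by positivity) fun ξ => ?_
  rw [lin2_apply]
  refine (norm_add_le _ _).trans ?_
  rw [norm_smul, norm_smul, add_mul, mul_comm ‖A‖, mul_comm ‖B‖]
  gcongr
  · exact norm_fst_le ξ
  · exact norm_snd_le ξ

theorem hasFDerivAt_eval_evalPt (p : Poly6) (v : Fin 3 → ℝ) {q : ℝ × ℝ} (hq : 0 < q.2) :
    HasFDerivAt (fun q => MvPolynomial.eval (evalPt v q) p)
      (lin2 (MvPolynomial.eval (evalPt v q) (dX p)) (MvPolynomial.eval (evalPt v q) (dT p))) q := by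
  have h1 : HasFDerivAt (fun q : ℝ × ℝ => ((q.1 : ℝ) : ℂ)) (lin2 1 0) q := by
    have := (Complex.ofRealCLM.hasFDerivAt (x := q.1)).comp q hasFDerivAt_fst
    refine this.congr_fderiv ?_
    ext <;> simp
  have h2 : HasFDerivAt (fun q : ℝ × ℝ => ((q.2 : ℝ) : ℂ)) (lin2 0 1) q := by
    have := (Complex.ofRealCLM.hasFDerivAt (x := q.2)).comp q hasFDerivAt_snd
    refine this.congr_fderiv ?_
    ext <;> simp
  have hq2 : ((q.2 : ℝ) : ℂ) ≠ 0 := by exact_mod_cast hq.ne'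
  have h3 : HasFDerivAt (fun q : ℝ × ℝ => (((q.2 : ℝ) : ℂ))⁻¹)
      (lin2 0 (-((q.2 : ℂ)⁻¹) ^ 2)) q := by
    have := ((hasDerivAt_inv hq2).hasFDerivAt.restrictScalars ℝ).comp q h2
    refine this.congr_fderiv ?_
    ext <;> simp
  induction p using MvPolynomial.induction_on with
  | C a =>
    simp only [MvPolynomial.eval_C, dX, dT, MvPolynomial.pderiv_C, mul_zero, sub_zero, map_zero]
    refine (hasFDerivAt_const a q).congr_fderiv ?_
    ext <;> simp
  | add p r hp hr =>
    simp only [map_add, dX, dT, mul_add] at hp hr ⊢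
    refine (hp.add hr).congr_fderiv ?_
    ext <;> simp; ring
  | mul_X p i hp =>
    have hX : HasFDerivAt (fun q => evalPt v q i)
        (lin2 (MvPolynomial.eval (evalPt v q) (dX (MvPolynomial.X i)))
          (MvPolynomial.eval (evalPt v q) (dT (MvPolynomial.X i)))) q := by
      have hc : ∀ a : ℂ, HasFDerivAt (fun _ : ℝ × ℝ => a) (lin2 0 0) q := fun a => by
        refine (hasFDerivAt_const a q).congr_fderiv ?_
        ext <;> simp
      fin_cases i
      · simpa [evalPt, dX, dT, MvPolynomial.pderiv_X] using h1
      · simpa [evalPt, dX, dT, MvPolynomial.pderiv_X] using h2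
      · simpa [evalPt, dX, dT, MvPolynomial.pderiv_X] using h3
      · simpa [evalPt, dX, dT, MvPolynomial.pderiv_X] using hc _
      · simpa [evalPt, dX, dT, MvPolynomial.pderiv_X] using hc _
      · simpa [evalPt, dX, dT, MvPolynomial.pderiv_X] using hc _
    simp only [map_mul, MvPolynomial.eval_X]
    refine (hp.mul hX).congr_fderiv ?_
    ext <;> simp [dX, dT]; ring

/-- The polynomial `r` with `∂(p e^Φ)/∂x = r e^Φ`. -/
def expDX (Φ p : Poly6) : Poly6 := dX p + p * dX Φ

/-- The polynomial `r` with `∂(p e^Φ)/∂t = r e^Φ`. -/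
def expDT (Φ p : Poly6) : Poly6 := dT p + p * dT Φ

theorem hasFDerivAt_expPoly (Φ p : Poly6) (v : Fin 3 → ℝ) {q : ℝ × ℝ} (hq : 0 < q.2) :
    HasFDerivAt (expPoly Φ p v)
      (lin2 (expPoly Φ (expDX Φ p) v q) (expPoly Φ (expDT Φ p) v q)) q := by
  have h := (hasFDerivAt_eval_evalPt p v hq).mul (hasFDerivAt_eval_evalPt Φ v hq).cexp
  have hev : expPoly Φ p v =ᶠ[𝓝 q] fun q => MvPolynomial.eval (evalPt v q) p *
      Complex.exp (MvPolynomial.eval (evalPt v q) Φ) := by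
    filter_upwards [(isOpen_lt continuous_const continuous_snd).mem_nhds hq] with r hr
    exact if_pos hr
  refine HasFDerivAt.congr_of_eventuallyEq ?_ hev
  refine h.congr_fderiv ?_
  simp only [expPoly, if_pos hq]
  ext <;> simp [expDX, expDT] <;> ring

/-- The size `|a| + |b| + |c|` of the parameters. -/
def parNorm (v : Fin 3 → ℝ) : ℝ := |v 0| + |v 1| + |v 2|

theorem parNorm_nonneg (v : Fin 3 → ℝ) : 0 ≤ parNorm v := by unfold parNorm; positivity

/-- The exponentials `e^Φ` decay on the region `S` of the chart, uniformly in the family of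
parameters, exponentially in the parameters, and like `e^{-δ / t²}` for `t → 0`. -/
def Decays {ι : Type*} (Φ : Poly6) (par : ι → Fin 3 → ℝ) (S : Set (ℝ × ℝ)) : Prop :=
  ∃ δ > 0, ∃ C : ℝ, ∀ i, ∀ q ∈ S, 0 < q.2 →
    (MvPolynomial.eval (evalPt (par i) q) Φ).re ≤ C - δ * (parNorm (par i) + (q.2⁻¹) ^ 2)

theorem exists_norm_eval_le (p : Poly6) : ∃ K : ℝ, ∃ d : ℕ, 0 ≤ K ∧ ∀ (y : Fin 6 → ℂ) (r : ℝ),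
    1 ≤ r → (∀ i, ‖y i‖ ≤ r) → ‖MvPolynomial.eval y p‖ ≤ K * r ^ d := by
  induction p using MvPolynomial.induction_on with
  | C a => exact ⟨‖a‖, 0, norm_nonneg _, fun y r _ _ => by simp⟩
  | add p p' hp hp' =>
    obtain ⟨K, d, hK, h⟩ := hp
    obtain ⟨K', d', hK', h'⟩ := hp'
    refine ⟨K + K', max d d', by positivity, fun y r hr hy => ?_⟩
    rw [map_add]
    refine (norm_add_le _ _).trans ?_
    rw [add_mul]
    gcongr
    · refine (h y r hr hy).trans ?_
      gcongr
      exact le_max_left _ _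
    · refine (h' y r hr hy).trans ?_
      gcongr
      exact le_max_right _ _
  | mul_X p i hp =>
    obtain ⟨K, d, hK, h⟩ := hp
    refine ⟨K, d + 1, hK, fun y r hr hy => ?_⟩
    rw [map_mul, norm_mul, MvPolynomial.eval_X, pow_succ, ← mul_assoc]
    gcongr
    · exact h y r hr hy
    · exact hy i

theorem exists_pow_le_exp (d : ℕ) {δ : ℝ} (hδ : 0 < δ) (R : ℝ) :
    ∃ C : ℝ, 0 ≤ C ∧ ∀ y : ℝ, 0 ≤ y → (R + y) ^ d ≤ C * Real.exp (δ * y) := by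
  have h2 : Filter.Tendsto (fun y : ℝ => (R + y) ^ d * Real.exp (-δ * y)) Filter.atTop (𝓝 0) := by
    have := (Real.tendsto_pow_mul_exp_neg_atTop_nhds_zero d).comp
      ((Filter.tendsto_id.atTop_add (tendsto_const_nhds (x := R))).const_mul_atTop hδ)
    have h3 := this.const_mul (δ⁻¹ ^ d * Real.exp (δ * R))
    rw [mul_zero] at h3
    refine h3.congr fun y => ?_
    simp only [Function.comp, id]
    rw [mul_pow, show -(δ * (y + R)) = -(δ * R) + -δ * y by ring, Real.exp_add,
      show δ⁻¹ ^ d * Real.exp (δ * R) * (δ ^ d * (y + R) ^ d * (Real.exp (-(δ * R)) *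
        Real.exp (-δ * y))) = (δ⁻¹ ^ d * δ ^ d) * (Real.exp (δ * R) * Real.exp (-(δ * R))) *
        ((R + y) ^ d * Real.exp (-δ * y)) by rw [add_comm y R]; ring,
      ← mul_pow, inv_mul_cancel₀ hδ.ne', ← Real.exp_add]
    simp
  obtain ⟨Y, hY⟩ := Filter.eventually_atTop.1 (h2.eventually (ge_mem_nhds (show (0 : ℝ) < 1 by norm_num)))
  obtain ⟨C, hC⟩ := (isCompact_Icc (a := (0 : ℝ)) (b := max Y 0)).exists_bound_of_continuousOn
    (f := fun y : ℝ => (R + y) ^ d * Real.exp (-δ * y)) (by fun_prop)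
  refine ⟨max C 1, by positivity, fun y hy => ?_⟩
  have h : (R + y) ^ d * Real.exp (-δ * y) ≤ max C 1 := by
    by_cases hyY : y ≤ max Y 0
    · exact (le_abs_self _).trans ((hC y ⟨hy, hyY⟩).trans (le_max_left _ _))
    · exact (hY y ((le_max_left Y 0).trans (not_le.1 hyY).le)).trans (le_max_right _ _)
  calc (R + y) ^ d = (R + y) ^ d * Real.exp (-δ * y) * Real.exp (δ * y) := by
        rw [mul_assoc, ← Real.exp_add]; simp
    _ ≤ _ := by gcongr

/-- Under `Decays`, half of the exponent absorbs the polynomial, and the other half remains as a bound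
that is uniform on `S` and exponential in the parameters. -/
theorem exists_norm_expPoly_le {ι : Type*} {Φ : Poly6} {par : ι → Fin 3 → ℝ} {S : Set (ℝ × ℝ)}
    (hS : Bornology.IsBounded S) (h : Decays Φ par S) :
    ∃ δ > 0, ∀ p : Poly6, ∃ C : ℝ, ∀ i, ∀ q ∈ S,
      ‖expPoly Φ p (par i) q‖ ≤ C * Real.exp (-δ * parNorm (par i)) := by
  obtain ⟨δ, hδ, C, hC⟩ := h
  obtain ⟨R, hR⟩ := hS.exists_norm_le
  refine ⟨δ / 2, by positivity, fun p => ?_⟩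
  obtain ⟨K, d, hK, hp⟩ := exists_norm_eval_le p
  obtain ⟨C', hC', hd⟩ := exists_pow_le_exp d (half_pos hδ) (|R| + 2)
  refine ⟨K * C' * Real.exp C, fun i q hq => ?_⟩
  rw [expPoly]
  split_ifs with hq2
  · rw [norm_mul, Complex.norm_exp]
    have hN := parNorm_nonneg (par i)
    have hs : q.2⁻¹ ≤ 1 + q.2⁻¹ ^ 2 := by nlinarith [sq_nonneg (q.2⁻¹ - 1)]
    have hqR : ‖q‖ ≤ |R| := (hR q hq).trans (le_abs_self _)
    have h1 : ‖q.1‖ ≤ |R| := (norm_fst_le q).trans hqR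
    have h2 : ‖q.2‖ ≤ |R| := (norm_snd_le q).trans hqR
    have hs2 : 0 ≤ q.2⁻¹ ^ 2 := by positivity
    have hs3 : 0 < q.2⁻¹ := by positivity
    have hR0 := abs_nonneg R
    have hN0 : |par i 0| ≤ parNorm (par i) := by
      unfold parNorm; linarith [abs_nonneg (par i 1), abs_nonneg (par i 2)]
    have hN1 : |par i 1| ≤ parNorm (par i) := by
      unfold parNorm; linarith [abs_nonneg (par i 0), abs_nonneg (par i 2)]
    have hN2 : |par i 2| ≤ parNorm (par i) := by
      unfold parNorm; linarith [abs_nonneg (par i 1), abs_nonneg (par i 0)]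
    have h3 := hp (evalPt (par i) q) (|R| + 2 + (parNorm (par i) + q.2⁻¹ ^ 2)) (by linarith)
      (fun j => by
        fin_cases j <;> simp [evalPt, -abs_inv, -inv_pow] <;> try rw [Real.norm_eq_abs] at h1 h2
        · linarith
        · linarith
        · rw [abs_of_pos hq2]; linarith
        · linarith
        · linarith
        · linarith)
    have h4 := hd (parNorm (par i) + q.2⁻¹ ^ 2) (by linarith)
    calc _ ≤ K * (|R| + 2 + (parNorm (par i) + q.2⁻¹ ^ 2)) ^ d *
          Real.exp (C - δ * (parNorm (par i) + (q.2⁻¹) ^ 2)) := by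
          gcongr
          exact hC i q hq hq2
      _ ≤ K * (C' * Real.exp (δ / 2 * (parNorm (par i) + q.2⁻¹ ^ 2))) *
          Real.exp (C - δ * (parNorm (par i) + (q.2⁻¹) ^ 2)) := by gcongr
      _ = K * C' * Real.exp (C + -(δ / 2) * (parNorm (par i) + q.2⁻¹ ^ 2)) := by
          rw [mul_assoc, mul_assoc C', ← Real.exp_add, ← mul_assoc]; congr 2; ring
      _ ≤ K * C' * Real.exp (C + -(δ / 2) * parNorm (par i)) := by
          gcongr K * C' * Real.exp ?_
          nlinarith
      _ = _ := by rw [Real.exp_add]; ring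
  · rw [norm_zero]; positivity

/-- Where the exponentials decay, `expPoly` is differentiable at the points with `t ≤ 0`, too:
its value at `t > 0` is `t²` times a bounded function of the same kind. -/
theorem Decays.hasFDerivAt_expPoly {ι : Type*} {Φ : Poly6} {par : ι → Fin 3 → ℝ} {S : Set (ℝ × ℝ)}
    (hS : Bornology.IsBounded S) (hSo : IsOpen S) (h : Decays Φ par S) (p : Poly6) (i : ι)
    {q : ℝ × ℝ} (hq : q ∈ S) : HasFDerivAt (expPoly Φ p (par i))
      (lin2 (expPoly Φ (expDX Φ p) (par i) q) (expPoly Φ (expDT Φ p) (par i) q)) q := by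
  rcases lt_trichotomy q.2 0 with hq2 | hq2 | hq2
  · have hev : expPoly Φ p (par i) =ᶠ[𝓝 q] fun _ => 0 := by
      filter_upwards [(isOpen_lt continuous_snd continuous_const).mem_nhds hq2] with r hr
      exact if_neg (not_lt.2 (le_of_lt hr))
    refine HasFDerivAt.congr_of_eventuallyEq ?_ hev
    refine (hasFDerivAt_const (0 : ℂ) q).congr_fderiv ?_
    ext <;> simp [expPoly, not_lt.2 hq2.le]
  · obtain ⟨δ, -, hb⟩ := exists_norm_expPoly_le hS h
    obtain ⟨C, hC⟩ := hb (MvPolynomial.X 2 ^ 2 * p)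
    have h0 : lin2 (expPoly Φ (expDX Φ p) (par i) q) (expPoly Φ (expDT Φ p) (par i) q) = 0 := by
      ext <;> simp [expPoly, hq2]
    rw [h0]
    -- `p e^Φ = t² (t⁻² p) e^Φ`, where the second factor is again bounded
    have hb' : expPoly Φ p (par i) =O[𝓝 q] fun r => ‖r - q‖ ^ 2 := by
      refine Asymptotics.IsBigO.of_bound (C * Real.exp (-δ * parNorm (par i))) ?_
      filter_upwards [hSo.mem_nhds hq] with r hr
      have hCr := hC i r hr
      have hr2 : |r.2| ≤ ‖r - q‖ := by
        have := norm_snd_le (r - q)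
        simpa [hq2] using this
      by_cases hr0 : 0 < r.2
      · have : expPoly Φ p (par i) r = (r.2 : ℂ) ^ 2 *
            expPoly Φ (MvPolynomial.X 2 ^ 2 * p) (par i) r := by
          have : (r.2 : ℂ) ≠ 0 := by exact_mod_cast hr0.ne'
          simp only [expPoly, if_pos hr0, map_mul, map_pow, MvPolynomial.eval_X]
          rw [show evalPt (par i) r 2 = (r.2 : ℂ)⁻¹ from rfl]
          field_simp
        rw [this, norm_mul, norm_pow, Complex.norm_real, norm_pow, norm_norm, mul_comm]
        have h1 : ‖r.2‖ ^ 2 ≤ ‖r - q‖ ^ 2 := by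
          rw [Real.norm_eq_abs]; gcongr
        exact mul_le_mul hCr h1 (by positivity) ((norm_nonneg _).trans hCr)
      · rw [expPoly, if_neg hr0, norm_zero]
        exact mul_nonneg ((norm_nonneg _).trans hCr) (by positivity)
    exact hb'.hasFDerivAt one_lt_two
  · exact Spectacle.hasFDerivAt_expPoly Φ p (par i) hq2

variable {ι : Type*} {Φ : Poly6} {par : ι → Fin 3 → ℝ} {S : Set (ℝ × ℝ)} {ε : ι → ℂ}

theorem summable_expPoly (hS : Bornology.IsBounded S) (h : Decays Φ par S)
    (hpar : ∀ δ > 0, Summable fun i => Real.exp (-δ * parNorm (par i)))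
    (hε : ∀ i, ‖ε i‖ ≤ 1) (p : Poly6) {q : ℝ × ℝ} (hq : q ∈ S) :
    Summable fun i => ε i * expPoly Φ p (par i) q := by
  obtain ⟨δ, hδ, hb⟩ := exists_norm_expPoly_le hS h
  obtain ⟨C, hC⟩ := hb p
  refine Summable.of_norm_bounded ((hpar δ hδ).mul_left C) fun i => ?_
  rw [norm_mul]
  exact (mul_le_of_le_one_left (norm_nonneg _) (hε i)).trans (hC i q hq)

/-- Termwise differentiation: the derivatives of a series of exponential polynomials are series of
exponential polynomials with the same exponent. -/
theorem hasFDerivAt_tsum_expPoly (hS : Bornology.IsBounded S) (hSo : IsOpen S)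
    (hSc : IsPreconnected S) (h : Decays Φ par S)
    (hpar : ∀ δ > 0, Summable fun i => Real.exp (-δ * parNorm (par i)))
    (hε : ∀ i, ‖ε i‖ ≤ 1) (p : Poly6) {q : ℝ × ℝ} (hq : q ∈ S) :
    HasFDerivAt (fun q => ∑' i, ε i * expPoly Φ p (par i) q)
      (lin2 (∑' i, ε i * expPoly Φ (expDX Φ p) (par i) q)
        (∑' i, ε i * expPoly Φ (expDT Φ p) (par i) q)) q := by
  obtain ⟨δ, hδ, hb⟩ := exists_norm_expPoly_le hS h
  obtain ⟨C, hC⟩ := hb (expDX Φ p)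
  obtain ⟨C', hC'⟩ := hb (expDT Φ p)
  have hl : ∀ i q, ε i • lin2 (expPoly Φ (expDX Φ p) (par i) q) (expPoly Φ (expDT Φ p) (par i) q) =
      lin2 (ε i * expPoly Φ (expDX Φ p) (par i) q) (ε i * expPoly Φ (expDT Φ p) (par i) q) := by
    intro i q
    ext <;> simp
  have key := hasFDerivAt_tsum_of_isPreconnected (𝕜 := ℝ)
    (f := fun i q => ε i * expPoly Φ p (par i) q)
    (f' := fun i q => lin2 (ε i * expPoly Φ (expDX Φ p) (par i) q)
      (ε i * expPoly Φ (expDT Φ p) (par i) q))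
    (u := fun i => (C + C') * Real.exp (-δ * parNorm (par i)))
    ((hpar δ hδ).mul_left _) hSo hSc
    (fun i r hr => by
      rw [← hl]
      exact (h.hasFDerivAt_expPoly hS hSo p i hr).const_mul (ε i))
    (fun i r hr => by
      refine (norm_lin2_le _ _).trans ?_
      rw [norm_mul, norm_mul, add_mul]
      exact add_le_add
        ((mul_le_of_le_one_left (norm_nonneg _) (hε i)).trans (hC i r hr))
        ((mul_le_of_le_one_left (norm_nonneg _) (hε i)).trans (hC' i r hr)))
    hq (summable_expPoly hS h hpar hε p hq) hq
  refine key.congr_fderiv ?_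
  have s1 := summable_expPoly hS h hpar hε (expDX Φ p) hq
  have s2 := summable_expPoly hS h hpar hε (expDT Φ p) hq
  have hs := (((ContinuousLinearMap.smulRightL ℝ (ℝ × ℝ) ℂ (ContinuousLinearMap.fst ℝ ℝ ℝ)).hasSum
    s1.hasSum).add ((ContinuousLinearMap.smulRightL ℝ (ℝ × ℝ) ℂ
      (ContinuousLinearMap.snd ℝ ℝ ℝ)).hasSum s2.hasSum))
  exact hs.tsum_eq

/-- A function is smooth on an open set of the plane if it belongs to a family of functions that is
closed under both partial derivatives. -/
theorem contDiffOn_of_closed_family {A : Type*} (F : A → ℝ × ℝ → ℂ) (dx dt : A → A)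
    (hSo : IsOpen S) (hF : ∀ a, ∀ q ∈ S, HasFDerivAt (F a) (lin2 (F (dx a) q) (F (dt a) q)) q)
    (a : A) : ContDiffOn ℝ ∞ (F a) S := by
  rw [contDiffOn_infty]
  intro n
  induction n generalizing a with
  | zero =>
    rw [Nat.cast_zero, contDiffOn_zero]
    exact fun q hq => (hF a q hq).continuousAt.continuousWithinAt
  | succ n ih =>
    rw [Nat.cast_succ, contDiffOn_succ_iff_hasFDerivWithinAt_of_uniqueDiffOn hSo.uniqueDiffOn]
    refine ⟨by simp, fun q => lin2 (F (dx a) q) (F (dt a) q), ?_,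
      fun q hq => (hF a q hq).hasFDerivWithinAt⟩
    exact ((ContinuousLinearMap.smulRightL ℝ (ℝ × ℝ) ℂ
      (ContinuousLinearMap.fst ℝ ℝ ℝ)).contDiff.comp_contDiffOn (ih (dx a))).add
      ((ContinuousLinearMap.smulRightL ℝ (ℝ × ℝ) ℂ
      (ContinuousLinearMap.snd ℝ ℝ ℝ)).contDiff.comp_contDiffOn (ih (dt a)))

theorem contDiffOn_tsum_expPoly (hS : Bornology.IsBounded S) (hSo : IsOpen S)
    (hSc : IsPreconnected S) (h : Decays Φ par S)
    (hpar : ∀ δ > 0, Summable fun i => Real.exp (-δ * parNorm (par i)))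
    (hε : ∀ i, ‖ε i‖ ≤ 1) (p : Poly6) :
    ContDiffOn ℝ ∞ (fun q => ∑' i, ε i * expPoly Φ p (par i) q) S :=
  contDiffOn_of_closed_family (fun p q => ∑' i, ε i * expPoly Φ p (par i) q) (expDX Φ) (expDT Φ)
    hSo (fun p _ hq => hasFDerivAt_tsum_expPoly hS hSo hSc h hpar hε p hq) p

/-- The rectangle `|x| < R`, `T₁ < t < T₂`. -/
def box (R T₁ T₂ : ℝ) : Set (ℝ × ℝ) := Set.Ioo (-R) R ×ˢ Set.Ioo T₁ T₂

theorem isBounded_box (R T₁ T₂ : ℝ) : Bornology.IsBounded (box R T₁ T₂) :=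
  (Metric.isBounded_Ioo _ _).prod (Metric.isBounded_Ioo _ _)

theorem isOpen_box (R T₁ T₂ : ℝ) : IsOpen (box R T₁ T₂) := isOpen_Ioo.prod isOpen_Ioo

theorem isPreconnected_box (R T₁ T₂ : ℝ) : IsPreconnected (box R T₁ T₂) :=
  ((convex_Ioo _ _).prod (convex_Ioo _ _)).isPreconnected

/-- If the exponentials decay on all rectangles `|x| < R`, `|t| < T`, then the series, extended by
zero to `t ≤ 0`, is smooth on the whole plane. -/
theorem contDiff_tsum_expPoly (h : ∀ R T, Decays Φ par (box R (-T) T))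
    (hpar : ∀ δ > 0, Summable fun i => Real.exp (-δ * parNorm (par i)))
    (hε : ∀ i, ‖ε i‖ ≤ 1) (p : Poly6) :
    ContDiff ℝ ∞ (fun q => ∑' i, ε i * expPoly Φ p (par i) q) := by
  rw [contDiff_iff_contDiffAt]
  intro q
  have hq : q ∈ box (|q.1| + 1) (-(|q.2| + 1)) (|q.2| + 1) := by
    refine ⟨⟨?_, ?_⟩, ?_, ?_⟩
    · linarith [neg_abs_le q.1]
    · linarith [le_abs_self q.1]
    · linarith [neg_abs_le q.2]
    · linarith [le_abs_self q.2]
  exact (contDiffOn_tsum_expPoly (isBounded_box _ _ _) (isOpen_box _ _ _) (isPreconnected_box _ _ _)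
    (h _ _) hpar hε p).contDiffAt ((isOpen_box _ _ _).mem_nhds hq)

end ExpPoly

/-! ### Summability over lattices -/

theorem summable_exp_neg_abs_int {δ : ℝ} (hδ : 0 < δ) :
    Summable fun n : ℤ => Real.exp (-δ * |(n : ℝ)|) := by
  have h : Summable fun n : ℕ => Real.exp (-δ * (n : ℝ)) := by
    have := Real.summable_exp_nat_mul_iff.2 (neg_lt_zero.2 hδ)
    exact this.congr fun n => by rw [mul_comm]
  refine Summable.of_nat_of_neg ?_ ?_ <;> simpa using h

/-- If the parameters are integral multiples of a positive number, up to a bounded distortion, then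
the exponentials of their sizes are summable. -/
theorem summable_exp_parNorm {ι : Type*} {par : ι → Fin 3 → ℝ} (f : ι → ℤ × ℤ × ℤ)
    (hf : Function.Injective f) {η : ℝ} (hη : 0 < η)
    (h : ∀ i, η * (|((f i).1 : ℝ)| + |((f i).2.1 : ℝ)| + |((f i).2.2 : ℝ)|) ≤ parNorm (par i)) :
    ∀ δ > 0, Summable fun i => Real.exp (-δ * parNorm (par i)) := by
  intro δ hδ
  have h1 := summable_exp_neg_abs_int (mul_pos hδ hη)
  have h2 := (h1.mul_of_nonneg (h1.mul_of_nonneg h1 (fun _ => (Real.exp_pos _).le)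
    (fun _ => (Real.exp_pos _).le)) (fun _ => (Real.exp_pos _).le)
    (fun _ => mul_nonneg (Real.exp_pos _).le (Real.exp_pos _).le)).comp_injective hf
  refine Summable.of_nonneg_of_le (fun _ => (Real.exp_pos _).le) (fun i => ?_) h2
  simp only [Function.comp]
  rw [← Real.exp_add, ← Real.exp_add]
  refine Real.exp_le_exp.2 ?_
  have := mul_le_mul_of_nonneg_left (h i) hδ.le
  linarith

/-! ### Hermite functions -/

/-- The Hermite polynomial `H̃_j` of the weight `e^{-2π x²}`. -/
def herm : ℕ → Polynomial ℝ
  | 0 => 1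
  | j + 1 => Polynomial.C 2 * Polynomial.X * herm j -
      Polynomial.C (1 / (2 * Real.pi)) * Polynomial.derivative (herm j)

theorem derivative_herm (j : ℕ) : Polynomial.derivative (herm (j + 1)) =
    Polynomial.C (2 * (j + 1 : ℝ)) * herm j := by
  induction j with
  | zero => simp [herm]
  | succ j ih =>
    have h : herm (j + 1) = Polynomial.C 2 * Polynomial.X * herm j -
      Polynomial.C (1 / (2 * Real.pi)) * Polynomial.derivative (herm j) := rfl
    rw [herm, Polynomial.derivative_sub, Polynomial.derivative_mul, Polynomial.derivative_mul,
      Polynomial.derivative_mul, ih]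
    simp only [Polynomial.derivative_C, Polynomial.derivative_X, Polynomial.derivative_mul,
      zero_mul, zero_add, mul_one]
    push_cast
    have h3 : (Polynomial.C (2 * ((j : ℝ) + 1 + 1)) : Polynomial ℝ) =
      Polynomial.C 2 + Polynomial.C (2 * ((j : ℝ) + 1)) := by rw [← Polynomial.C_add]; congr 1; ring
    rw [h3]
    linear_combination (-Polynomial.C (2 * ((j : ℝ) + 1))) * h

theorem herm_add_two (j : ℕ) : herm (j + 2) = Polynomial.C 2 * Polynomial.X * herm (j + 1) -
    Polynomial.C ((j + 1) / Real.pi) * herm j := by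
  rw [herm, derivative_herm, ← mul_assoc, ← Polynomial.C_mul]
  congr 3
  field_simp

/-- The Hermite function `H̃_j(x) e^{-2π x²}`. -/
def psi (j : ℕ) (x : ℝ) : ℝ := (herm j).eval x * Real.exp (-2 * Real.pi * x ^ 2)

theorem hasDerivAt_psi (j : ℕ) (x : ℝ) :
    HasDerivAt (psi j) (-2 * Real.pi * psi (j + 1) x) x := by
  have h := ((herm j).hasDerivAt x).mul
    (((hasDerivAt_pow 2 x).const_mul (-2 * Real.pi)).exp)
  refine h.congr_deriv ?_
  have := Real.pi_ne_zero
  simp [psi, herm]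
  field_simp
  ring

theorem hermiteHt_eq (j : ℕ) (x : ℝ) : hermiteHt j x = (herm j).eval x := by
  have hpi := Real.pi_pos
  have hr : 0 < √(2 * Real.pi) := Real.sqrt_pos.2 (by positivity)
  have hr2 : √(2 * Real.pi) ^ 2 = 2 * Real.pi := Real.sq_sqrt (by positivity)
  have key : ∀ j, iteratedDeriv j (fun s : ℝ => Real.exp (-s ^ 2)) =
      fun s => (-√(2 * Real.pi)) ^ j * psi j (s / √(2 * Real.pi)) := by
    intro j
    induction j with
    | zero =>
      funext s
      simp only [iteratedDeriv_zero, psi, herm, Polynomial.eval_one, pow_zero, one_mul, div_pow, hr2]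
      congr 1
      field_simp
    | succ j ih =>
      rw [iteratedDeriv_succ, ih]
      funext s
      have h1 := (hasDerivAt_psi j (s / √(2 * Real.pi))).comp s
        ((hasDerivAt_id s).div_const (√(2 * Real.pi)))
      refine (h1.const_mul ((-√(2 * Real.pi)) ^ j)).deriv.trans ?_
      rw [pow_succ]
      have : -2 * Real.pi = - √(2 * Real.pi) ^ 2 := by rw [hr2]; ring
      rw [this]
      field_simp
  rw [hermiteHt, hermiteH, key]
  have h1 : √(2 * Real.pi) * x / √(2 * Real.pi) = x := by field_simp
  have h2 : (2 * Real.pi) ^ (-(j : ℝ) / 2) = (√(2 * Real.pi) ^ j)⁻¹ := by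
    rw [Real.sqrt_eq_rpow, ← Real.rpow_natCast, ← Real.rpow_mul (by positivity),
      ← Real.rpow_neg (by positivity)]
    congr 1
    ring
  beta_reduce
  rw [h1, h2, psi, mul_pow, hr2, neg_pow √(2 * Real.pi)]
  have h3 : ((-1 : ℝ) ^ j) * (-1) ^ j = 1 := by rw [← mul_pow]; simp
  have h4 : Real.exp (2 * Real.pi * x ^ 2) * Real.exp (-2 * Real.pi * x ^ 2) = 1 := by
    rw [← Real.exp_add]; simp
  have h5 : (√(2 * Real.pi) ^ j)⁻¹ * √(2 * Real.pi) ^ j = 1 := inv_mul_cancel₀ (by positivity)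
  calc _ = ((√(2 * Real.pi) ^ j)⁻¹ * √(2 * Real.pi) ^ j) * ((-1) ^ j * (-1) ^ j) *
        (Real.exp (2 * Real.pi * x ^ 2) * Real.exp (-2 * Real.pi * x ^ 2)) *
          (herm j).eval x := by ring
    _ = _ := by rw [h3, h4, h5]; ring

/-- A Howe operator raises by one the degree of the Hermite polynomial in its variable. -/
theorem howe_herm_mul_gauss (i : Fin 2) (m : Fin 2 → ℕ) :
    howe i.castSucc (fun x => (herm (m 0)).eval (x 0) * (herm (m 1)).eval (x 1) * gauss x) =
      fun x => (herm (m 0 + if i = 0 then 1 else 0)).eval (x 0) *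
        (herm (m 1 + if i = 1 then 1 else 0)).eval (x 1) * gauss x := by
  funext x
  have hpi := Real.pi_ne_zero
  have hg : ∀ y : Fin 3 → ℝ, gauss y = Real.exp (-Real.pi * y 0 ^ 2) *
      Real.exp (-Real.pi * y 1 ^ 2) * Real.exp (-Real.pi * y 2 ^ 2) := fun y => by
    rw [gauss, Fin.sum_univ_three, mul_add, mul_add, Real.exp_add, Real.exp_add]
  have hd : ∀ (p : Polynomial ℝ) (y : ℝ), HasDerivAt (fun t => p.eval t * Real.exp (-Real.pi * t ^ 2))
      (p.derivative.eval y * Real.exp (-Real.pi * y ^ 2) +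
        p.eval y * (Real.exp (-Real.pi * y ^ 2) * (-Real.pi * (2 * y)))) y := fun p y => by
    exact ((p.hasDerivAt y).mul (((hasDerivAt_pow 2 y).const_mul (-Real.pi)).exp)).congr_deriv
      (by simp)
  fin_cases i
  · have h := (hd (herm (m 0)) (x 0)).mul_const ((herm (m 1)).eval (x 1) *
      Real.exp (-Real.pi * x 1 ^ 2) * Real.exp (-Real.pi * x 2 ^ 2))
    have hf : (fun t => (herm (m 0)).eval (Function.update x 0 t 0) *
        (herm (m 1)).eval (Function.update x 0 t 1) * gauss (Function.update x 0 t)) =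
        fun t => (herm (m 0)).eval t * Real.exp (-Real.pi * t ^ 2) * ((herm (m 1)).eval (x 1) *
      Real.exp (-Real.pi * x 1 ^ 2) * Real.exp (-Real.pi * x 2 ^ 2)) := by
      funext t
      rw [hg]
      simp
      ring
    simp only [howe, Fin.zero_eta, Fin.castSucc_zero, hf, h.deriv]
    simp [hg, herm]
    field_simp
    ring
  · have h := (hd (herm (m 1)) (x 1)).mul_const ((herm (m 0)).eval (x 0) *
      Real.exp (-Real.pi * x 0 ^ 2) * Real.exp (-Real.pi * x 2 ^ 2))
    have hf : (fun t => (herm (m 0)).eval (Function.update x 1 t 0) *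
        (herm (m 1)).eval (Function.update x 1 t 1) * gauss (Function.update x 1 t)) =
        fun t => (herm (m 1)).eval t * Real.exp (-Real.pi * t ^ 2) * ((herm (m 0)).eval (x 0) *
      Real.exp (-Real.pi * x 0 ^ 2) * Real.exp (-Real.pi * x 2 ^ 2)) := by
      funext t
      rw [hg]
      simp
      ring
    simp only [howe, Fin.mk_one, Fin.castSucc_one, hf, h.deriv]
    simp [hg, herm]
    field_simp
    ring

theorem foldr_howe_gauss (l : List (Fin 2)) :
    l.foldr (fun j f => howe j.castSucc f) gauss =
      fun x => (herm (l.count 0)).eval (x 0) * (herm (l.count 1)).eval (x 1) * gauss x := by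
  induction l with
  | nil => funext x; simp [herm]
  | cons i l ih =>
    rw [List.foldr_cons, ih]
    refine (howe_herm_mul_gauss i ![l.count 0, l.count 1]).trans ?_
    funext x
    fin_cases i <;> simp

/-- The Howe operators applied to the Gaussian give products of Hermite functions. -/
theorem howeGauss_eq {k : ℕ} (α : Fin 2) (β : Fin k → Fin 2) (x : Fin 3 → ℝ) :
    howeGauss α β x = (herm ((α :: List.ofFn β).count 0)).eval (x 0) *
      (herm ((α :: List.ofFn β).count 1)).eval (x 1) * gauss x :=
  congrFun (foldr_howe_gauss (α :: List.ofFn β)) x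

theorem count_add_count (l : List (Fin 2)) : l.count 0 + l.count 1 = l.length := by
  induction l with
  | nil => rfl
  | cons i l ih => fin_cases i <;> simp <;> omega

/-! ### Poisson summation for Hermite functions -/

theorem eval_aeval_poly (P : Poly6) (K : Polynomial ℝ) (y : Fin 6 → ℂ) :
    MvPolynomial.eval y (Polynomial.aeval P K) = Polynomial.aeval (MvPolynomial.eval y P) K := by
  rw [← MvPolynomial.coe_aeval_eq_eval, RingHom.coe_coe,
    ← AlgHom.coe_restrictScalars' ℝ, ← Polynomial.aeval_algHom_apply]

theorem aeval_ofReal (K : Polynomial ℝ) (x : ℝ) : Polynomial.aeval (x : ℂ) K = ((K.eval x : ℝ) : ℂ) :=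
  Polynomial.aeval_algebraMap_apply_eq_algebraMap_eval (A := ℂ) x K

theorem pderiv_aeval (i : Fin 6) (P : Poly6) (K : Polynomial ℝ) :
    MvPolynomial.pderiv i (Polynomial.aeval P K) =
      Polynomial.aeval P (Polynomial.derivative K) * MvPolynomial.pderiv i P :=
  ((MvPolynomial.pderiv (R := ℂ) i).restrictScalars ℝ).map_aeval K P

open MvPolynomial (X C) in
/-- The exponent `-2π t² (a + x)²`. -/
def gaussExp : Poly6 := C (-2 * Real.pi : ℂ) * (X 1 * (X 3 + X 0)) ^ 2

open MvPolynomial (X C) in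
/-- The exponent `-π a² t⁻² / 2 + 2π i a x`. -/
def dualExp : Poly6 := C (-(Real.pi / 2) : ℂ) * (X 3 * X 2) ^ 2 +
  C (2 * Real.pi * Complex.I) * (X 3 * X 0)

open MvPolynomial (X C) in
/-- The polynomial `H̃_j(t (a + x))`. -/
def gaussPoly (j : ℕ) : Poly6 := Polynomial.aeval (X 1 * (X 3 + X 0) : Poly6) (herm j)

open MvPolynomial (X C) in
/-- The polynomial `(-i a / t)^j / (√2 t)`. -/
def dualPoly (j : ℕ) : Poly6 := C (1 / √2 : ℂ) * X 2 * (C (-Complex.I) * X 3 * X 2) ^ j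

/-- The integers as parameters `(n, 0, 0)`. -/
def intPar (n : ℤ) : Fin 3 → ℝ := ![n, 0, 0]

theorem summable_intPar : ∀ δ > 0, Summable fun n => Real.exp (-δ * parNorm (intPar n)) :=
  summable_exp_parNorm (fun n => (n, 0, 0)) (fun m n h => congrArg Prod.fst h) one_pos
    (fun n => by simp [parNorm, intPar])

theorem eval_gaussExp (n : ℤ) (q : ℝ × ℝ) : MvPolynomial.eval (evalPt (intPar n) q) gaussExp =
    ((-2 * Real.pi * (q.2 * (n + q.1)) ^ 2 : ℝ) : ℂ) := by
  simp [gaussExp, evalPt, intPar]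

theorem eval_dualExp (n : ℤ) (q : ℝ × ℝ) : MvPolynomial.eval (evalPt (intPar n) q) dualExp =
    ((-(Real.pi / 2) * (n * q.2⁻¹) ^ 2 : ℝ) : ℂ) + (2 * Real.pi * n * q.1 : ℝ) * Complex.I := by
  simp [dualExp, evalPt, intPar]
  ring

theorem decays_gaussExp (R : ℝ) {T₁ T₂ : ℝ} (hT : 0 < T₁) :
    Decays gaussExp intPar (box R T₁ T₂) := by
  refine ⟨T₁ ^ 2, by positivity, T₁ ^ 2 * (R + 1) + 1, fun n q hq hq2 => ?_⟩
  obtain ⟨⟨h1, h2⟩, h3, h4⟩ := hq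
  rw [eval_gaussExp, Complex.ofReal_re]
  have hn : parNorm (intPar n) = |(n : ℝ)| := by simp [parNorm, intPar]
  have hs : T₁ ^ 2 * q.2⁻¹ ^ 2 ≤ 1 := by
    rw [← mul_pow]
    refine pow_le_one₀ (by positivity) ?_
    rw [mul_inv_le_iff₀ hq2]; linarith
  have hx : |q.1| ≤ R := abs_le.2 ⟨h1.le, h2.le⟩
  have hy : |(n : ℝ)| ≤ |n + q.1| + R := by
    have := abs_sub (n + q.1) q.1
    rw [add_sub_cancel_right] at this
    linarith
  have hy2 : |n + q.1| - 1 ≤ (n + q.1) ^ 2 := by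
    rw [← sq_abs]; nlinarith [sq_nonneg (|n + q.1| - 1), abs_nonneg (n + q.1)]
  have hq : T₁ ^ 2 * (n + q.1) ^ 2 ≤ (q.2 * (n + q.1)) ^ 2 := by
    rw [mul_pow]; gcongr
  have hpi := Real.pi_gt_three
  have h5 : T₁ ^ 2 * (|n + q.1| - 1) ≤ T₁ ^ 2 * (n + q.1) ^ 2 := by gcongr
  have h6 : T₁ ^ 2 * |(n : ℝ)| ≤ T₁ ^ 2 * (|n + q.1| + R) := by gcongr
  have h7 : (q.2 * (n + q.1)) ^ 2 ≤ 2 * Real.pi * (q.2 * (n + q.1)) ^ 2 :=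
    le_mul_of_one_le_left (sq_nonneg _) (by linarith)
  rw [hn]
  linarith

theorem decays_dualExp (R : ℝ) {T₁ T₂ : ℝ} (hT : 0 < T₁) :
    Decays dualExp intPar (box R T₁ T₂) := by
  by_cases hT2 : T₁ < T₂
  swap
  · exact ⟨1, one_pos, 0, fun n q hq _ => absurd (hq.2.1.trans hq.2.2) hT2⟩
  have hT2' : 0 < T₂ := hT.trans hT2
  refine ⟨(T₂⁻¹) ^ 2, by positivity, (T₂⁻¹) ^ 2 * (1 + T₁⁻¹ ^ 2), fun n q hq hq2 => ?_⟩
  obtain ⟨⟨h1, h2⟩, h3, h4⟩ := hq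
  have hn : parNorm (intPar n) = |(n : ℝ)| := by simp [parNorm, intPar]
  rw [eval_dualExp, Complex.add_re, Complex.ofReal_re, Complex.re_ofReal_mul, Complex.I_re,
    mul_zero, add_zero, hn]
  have hn2 : |(n : ℝ)| - 1 ≤ (n : ℝ) ^ 2 := by
    rw [← sq_abs]; nlinarith [sq_nonneg (|(n : ℝ)| - 1), abs_nonneg (n : ℝ)]
  have hpi := Real.pi_gt_three
  have h5 : q.2⁻¹ ^ 2 ≤ T₁⁻¹ ^ 2 := by gcongr
  have h6 : T₂⁻¹ ^ 2 ≤ q.2⁻¹ ^ 2 := by gcongr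
  have h7 : T₂⁻¹ ^ 2 * q.2⁻¹ ^ 2 ≤ T₂⁻¹ ^ 2 * T₁⁻¹ ^ 2 := by gcongr
  have h8 : T₂⁻¹ ^ 2 * (|(n : ℝ)| - 1) ≤ T₂⁻¹ ^ 2 * (n : ℝ) ^ 2 := by gcongr
  have h9 : T₂⁻¹ ^ 2 * (n : ℝ) ^ 2 ≤ (n * q.2⁻¹) ^ 2 := by
    rw [mul_pow, mul_comm]; gcongr
  have h10 : (n * q.2⁻¹) ^ 2 ≤ Real.pi / 2 * (n * q.2⁻¹) ^ 2 :=
    le_mul_of_one_le_left (sq_nonneg _) (by linarith)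
  linarith

/-- Poisson summation for the Hermite functions: for `j = 0` it is the transformation formula of the
theta function, and differentiation in `x` passes from `j` to `j + 1` on both sides. -/
theorem tsum_expPoly_gauss_eq_dual (j : ℕ) {q : ℝ × ℝ} (hq : 0 < q.2) :
    ∑' n, expPoly gaussExp (gaussPoly j) (intPar n) q =
      ∑' n, expPoly dualExp (dualPoly j) (intPar n) q := by
  induction j generalizing q with
  | zero =>
    have hpi := Real.pi_pos
    have h2 : (√2 : ℝ) ^ 2 = 2 := Real.sq_sqrt (by norm_num)
    have hs : 0 < √2 := by positivity
    have hκ : (0 : ℝ) < 1 / (2 * q.2 ^ 2) := by positivity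
    -- the Gaussian has the parameter `a = 1 / (2 t²)`, and `i x` gives the shift by `x`
    have hP := Complex.tsum_exp_neg_quadratic (a := ((1 / (2 * q.2 ^ 2) : ℝ) : ℂ))
      (by rwa [Complex.ofReal_re]) (Complex.I * q.1)
    have hc : ((1 / (2 * q.2 ^ 2) : ℝ) : ℂ) ^ (1 / 2 : ℂ) = ((√2 * q.2)⁻¹ : ℝ) := by
      rw [show (1 / 2 : ℂ) = ((1 / 2 : ℝ) : ℂ) by push_cast; rfl, ← Complex.ofReal_cpow hκ.le,
        ← Real.sqrt_eq_rpow]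
      congr 1
      rw [show 1 / (2 * q.2 ^ 2) = ((√2 * q.2)⁻¹) ^ 2 by rw [inv_pow, mul_pow, h2, one_div],
        Real.sqrt_sq (by positivity)]
    rw [hc] at hP
    have hq' : (q.2 : ℂ) ≠ 0 := by exact_mod_cast hq.ne'
    have hs' : (√2 : ℂ) ≠ 0 := by exact_mod_cast hs.ne'
    have hL : ∑' n, expPoly gaussExp (gaussPoly 0) (intPar n) q =
        ∑' n : ℤ, Complex.exp (-Real.pi / ((1 / (2 * q.2 ^ 2) : ℝ) : ℂ) *
          (n + Complex.I * (Complex.I * q.1)) ^ 2) := by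
      rw [← (Equiv.neg ℤ).tsum_eq]
      refine tsum_congr fun n => ?_
      rw [expPoly, if_pos hq, eval_gaussExp]
      simp only [gaussPoly, herm, map_one, one_mul, Equiv.neg_apply]
      congr 1
      push_cast
      rw [← mul_assoc, Complex.I_mul_I]
      field_simp
      ring
    have hR : ∑' n, expPoly dualExp (dualPoly 0) (intPar n) q = ((√2 * q.2)⁻¹ : ℝ) *
        ∑' n : ℤ, Complex.exp (-Real.pi * ((1 / (2 * q.2 ^ 2) : ℝ) : ℂ) * n ^ 2 +
          2 * Real.pi * (Complex.I * q.1) * n) := by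
      rw [← tsum_mul_left]
      refine tsum_congr fun n => ?_
      rw [expPoly, if_pos hq, eval_dualExp]
      congr 1
      · simp [dualPoly, evalPt]
        ring
      · congr 1
        push_cast
        field_simp
    rw [hL, hR, hP, ← mul_assoc]
    have : (((√2 * q.2)⁻¹ : ℝ) : ℂ) ≠ 0 := by
      exact_mod_cast (by positivity : (√2 * q.2)⁻¹ ≠ 0)
    field_simp
  | succ j ih =>
    have hq0 : q.2 / 2 < q.2 := by linarith
    have hmem : q ∈ box (|q.1| + 1) (q.2 / 2) (q.2 + 1) :=
      ⟨⟨by linarith [neg_abs_le q.1], by linarith [le_abs_self q.1]⟩, hq0, by linarith⟩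
    have hε : ∀ _ : ℤ, ‖(1 : ℂ)‖ ≤ 1 := fun _ => by simp
    have d1 := hasFDerivAt_tsum_expPoly (isBounded_box _ _ _) (isOpen_box _ _ _)
      (isPreconnected_box _ _ _) (decays_gaussExp (|q.1| + 1) (T₂ := q.2 + 1) (half_pos hq))
      summable_intPar hε (gaussPoly j) hmem
    have d2 := hasFDerivAt_tsum_expPoly (isBounded_box _ _ _) (isOpen_box _ _ _)
      (isPreconnected_box _ _ _) (decays_dualExp (|q.1| + 1) (T₂ := q.2 + 1) (half_pos hq))
      summable_intPar hε (dualPoly j) hmem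
    simp only [one_mul] at d1 d2
    have hev : (fun q => ∑' n, expPoly gaussExp (gaussPoly j) (intPar n) q) =ᶠ[𝓝 q]
        fun q => ∑' n, expPoly dualExp (dualPoly j) (intPar n) q := by
      filter_upwards [(isOpen_lt continuous_const continuous_snd).mem_nhds hq] with r hr
      exact ih hr
    -- compare the coefficients of `dx`; both sides acquire the factor `-2π t`
    have h := DFunLike.congr_fun (d1.unique (d2.congr_of_eventuallyEq hev)) (1, 0)
    simp only [lin2_apply, one_smul, zero_smul, add_zero] at h
    have hc : (-2 * Real.pi * q.2 : ℂ) ≠ 0 := by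
      have : (-2 * Real.pi * q.2 : ℝ) ≠ 0 := by
        have := Real.pi_pos
        have : 0 < 2 * Real.pi * q.2 := by positivity
        linarith
      exact_mod_cast this
    have hq' : (q.2 : ℂ) ≠ 0 := by exact_mod_cast hq.ne'
    have hpi' : (Real.pi : ℂ) ≠ 0 := by exact_mod_cast Real.pi_ne_zero
    have e1 : ∀ n, expPoly gaussExp (expDX gaussExp (gaussPoly j)) (intPar n) q =
        (-2 * Real.pi * q.2) * expPoly gaussExp (gaussPoly (j + 1)) (intPar n) q := by
      intro n
      simp only [expPoly, if_pos hq, expDX, dX, gaussPoly, pderiv_aeval, herm]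
      rw [← mul_assoc]
      congr 1
      simp only [map_add, map_mul, map_sub, Polynomial.aeval_C, Polynomial.aeval_X, gaussExp,
        Derivation.leibniz_pow, MvPolynomial.pderiv_mul]
      simp [MvPolynomial.pderiv_X, evalPt]
      field_simp
      ring
    have e2 : ∀ n, expPoly dualExp (expDX dualExp (dualPoly j)) (intPar n) q =
        (-2 * Real.pi * q.2) * expPoly dualExp (dualPoly (j + 1)) (intPar n) q := by
      intro n
      simp only [expPoly, if_pos hq, expDX, dX, dualPoly]
      rw [← mul_assoc]
      congr 1
      have hqq := mul_inv_cancel₀ hq'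
      simp [dualExp, MvPolynomial.pderiv_X, evalPt]
      rw [pow_succ]
      generalize (-(Complex.I * ((intPar n 0 : ℝ) : ℂ) * (q.2 : ℂ)⁻¹)) ^ j = A
      linear_combination (-((√2 : ℂ)⁻¹ * (q.2 : ℂ)⁻¹ * A *
        (2 * Real.pi * Complex.I * ((intPar n 0 : ℝ) : ℂ)))) * hqq
    simp only [e1, e2, tsum_mul_left] at h
    exact mul_left_cancel₀ hc h

/-! ### Harmonic polynomials and their `SL₂(ℝ)`-action -/

instance (k : ℕ) : FiniteDimensional ℂ (Harm k) :=
  FiniteDimensional.of_injective (harmCoeff k) (harmCoeff_injective k)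

instance (k : ℕ) : FiniteDimensional ℝ (Harm k) := FiniteDimensional.complexToReal (Harm k)

/-- The inclusion of `ℋ_k` into the symmetric algebra. -/
def harmVal (k : ℕ) : Harm k →ₗ[ℂ] SymV := (harmSub k).subtype

theorem harmVal_injective (k : ℕ) : Function.Injective (harmVal k) := Subtype.val_injective

theorem harmVal_rho {k : ℕ} (g : SL(2, ℝ)) (v : Harm k) :
    harmVal k (rho k g v) = symAct g (harmVal k v) := rfl

/-- The vector `∑ y_i e_i` of `V_ℂ` in the symmetric algebra. -/
def vecSym (y : Fin 3 → ℂ) : SymV := ∑ i, MvPolynomial.C (y i) * MvPolynomial.X i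

theorem toSym_eq_vecSym (X : Matrix (Fin 2) (Fin 2) ℝ) :
    toSym X = vecSym fun i => (coord X i : ℂ) := rfl

theorem vecSym_isHomogeneous (y : Fin 3 → ℂ) : (vecSym y).IsHomogeneous 1 := by
  refine MvPolynomial.IsHomogeneous.sum _ _ _ fun i _ => ?_
  simpa using (MvPolynomial.isHomogeneous_C (Fin 3) (y i)).mul (MvPolynomial.isHomogeneous_X ℂ i)

theorem coord_add (X Y : Matrix (Fin 2) (Fin 2) ℝ) (i : Fin 3) :
    coord (X + Y) i = coord X i + coord Y i := by
  fin_cases i <;> simp [coord] <;> ring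

theorem coord_smul (a : ℝ) (X : Matrix (Fin 2) (Fin 2) ℝ) (i : Fin 3) :
    coord (a • X) i = a * coord X i := by
  fin_cases i <;> simp [coord] <;> ring

theorem conj_add {R : Type*} [CommRing R] (g : SL(2, R)) (X Y : Matrix (Fin 2) (Fin 2) R) :
    conj g (X + Y) = conj g X + conj g Y := by
  simp [conj, mul_add, add_mul]

theorem conj_smul {R : Type*} [CommRing R] (g : SL(2, R)) (a : R)
    (X : Matrix (Fin 2) (Fin 2) R) : conj g (a • X) = a • conj g X := by
  simp [conj]

theorem conj_conj {R : Type*} [CommRing R] (g h : SL(2, R)) (X : Matrix (Fin 2) (Fin 2) R) :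
    conj g (conj h X) = conj (g * h) X := by
  simp [conj, mul_assoc]

theorem conj_one {R : Type*} [CommRing R] (X : Matrix (Fin 2) (Fin 2) R) :
    conj (1 : SL(2, R)) X = X := by
  simp [conj]

theorem conj_inv_conj {R : Type*} [CommRing R] (g : SL(2, R)) (X : Matrix (Fin 2) (Fin 2) R) :
    conj g⁻¹ (conj g X) = X := by
  rw [conj_conj, inv_mul_cancel, conj_one]

theorem conj_conj_inv {R : Type*} [CommRing R] (g : SL(2, R)) (X : Matrix (Fin 2) (Fin 2) R) :
    conj g (conj g⁻¹ X) = X := by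
  rw [conj_conj, mul_inv_cancel, conj_one]

theorem conj_neg_left {R : Type*} [CommRing R] (g : SL(2, R)) (X : Matrix (Fin 2) (Fin 2) R) :
    conj (-g) X = conj g X := by
  have : (-g)⁻¹ = -g⁻¹ := by simp
  simp [conj, this]

theorem toSym_add (X Y : Matrix (Fin 2) (Fin 2) ℝ) : toSym (X + Y) = toSym X + toSym Y := by
  simp [toSym, coord_add, add_mul, Finset.sum_add_distrib]

theorem toSym_smul (a : ℝ) (X : Matrix (Fin 2) (Fin 2) ℝ) :
    toSym (a • X) = MvPolynomial.C (a : ℂ) * toSym X := by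
  simp [toSym, coord_smul, mul_assoc, Finset.mul_sum]

theorem symAct_toSym (g : SL(2, ℝ)) {Y : Matrix (Fin 2) (Fin 2) ℝ} (hY : Y.trace = 0) :
    symAct g (toSym Y) = toSym (conj g Y) := by
  conv_rhs => rw [eq_sum_coord Y hY]
  rw [Fin.sum_univ_three, conj_add, conj_add, toSym_add, toSym_add, conj_smul, conj_smul,
    conj_smul, toSym_smul, toSym_smul, toSym_smul]
  simp [toSym, Fin.sum_univ_three, symAct]

theorem symAct_mul (g h : SL(2, ℝ)) (p : SymV) : symAct (g * h) p = symAct g (symAct h p) := by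
  have : symAct (g * h) = (symAct g).comp (symAct h) := by
    refine MvPolynomial.algHom_ext fun j => ?_
    rw [AlgHom.comp_apply]
    simp only [symAct, MvPolynomial.aeval_X]
    rw [← symAct, symAct_toSym g (by rw [trace_conj, trace_e]), conj_conj]
  rw [this]; rfl

theorem symAct_neg (g : SL(2, ℝ)) : symAct (-g) = symAct g := by
  refine MvPolynomial.algHom_ext fun j => ?_
  simp [symAct, conj_neg_left]

theorem rho_mul {k : ℕ} (g h : SL(2, ℝ)) (v : Harm k) : rho k (g * h) v = rho k g (rho k h v) :=
  harmVal_injective k (by simp only [harmVal_rho, symAct_mul])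

theorem rho_neg {k : ℕ} (g : SL(2, ℝ)) (v : Harm k) : rho k (-g) v = rho k g v :=
  harmVal_injective k (by simp only [harmVal_rho, symAct_neg])

/-- `r²` is the dual form, so it is `SL₂(ℝ)`-invariant. -/
theorem symAct_rSq (g : SL(2, ℝ)) : symAct g rSq = rSq := by
  -- the matrix of `g` preserves the form on columns, hence also on rows
  have hA : ∀ i l, ∑ j, sgn j * adMat g i j * adMat g l j = if i = l then sgn i else 0 := by
    let A : Matrix (Fin 3) (Fin 3) ℝ := Matrix.of fun i j => adMat g i j
    let J : Matrix (Fin 3) (Fin 3) ℝ := Matrix.diagonal sgn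
    have hJJ : J * J = 1 := by
      ext i j
      fin_cases i <;> fin_cases j <;> simp [J, sgn]
    have h1 : A.transpose * J * A = J := by
      ext j l
      have := sum_adMat g j l
      rw [Matrix.mul_assoc, Matrix.mul_apply]
      simp only [J, A, Matrix.diagonal_mul, Matrix.transpose_apply, Matrix.of_apply,
        Matrix.diagonal_apply, ← this]
      exact Finset.sum_congr rfl fun i _ => by ring
    have h2 : (J * A.transpose * J) * A = 1 := by
      rw [Matrix.mul_assoc, Matrix.mul_assoc, ← Matrix.mul_assoc A.transpose, h1, hJJ]
    have h3 := mul_eq_one_comm.1 h2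
    have h4 : A * J * A.transpose = J := by
      calc A * J * A.transpose = A * (J * A.transpose * J) * J := by
            simp only [Matrix.mul_assoc, hJJ, Matrix.mul_one]
        _ = J := by rw [h3, Matrix.one_mul]
    intro i l
    have := congrFun (congrFun h4 i) l
    rw [Matrix.mul_assoc, Matrix.mul_apply] at this
    simp only [J, A, Matrix.diagonal_mul, Matrix.transpose_apply, Matrix.of_apply,
        Matrix.diagonal_apply] at this
    rw [← this]
    exact Finset.sum_congr rfl fun i _ => by ring
  have hC : ∀ i l, ∑ j, (MvPolynomial.C (sgn j : ℂ) : SymV) * MvPolynomial.C (adMat g i j : ℂ) *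
      MvPolynomial.C (adMat g l j : ℂ) = MvPolynomial.C ((if i = l then sgn i else 0 : ℝ) : ℂ) := by
    intro i l
    rw [← hA i l]
    push_cast
    simp only [map_sum, map_mul]
  have h : symAct g rSq = ∑ i, ∑ l, (∑ j, (MvPolynomial.C (sgn j : ℂ) : SymV) *
      MvPolynomial.C (adMat g i j : ℂ) * MvPolynomial.C (adMat g l j : ℂ)) *
        (MvPolynomial.X i * MvPolynomial.X l) := by
    rw [rSq, map_sum]
    simp only [map_mul, map_pow, symAct_X, Fin.sum_univ_three,
      show ∀ a, symAct g (MvPolynomial.C a) = MvPolynomial.C a from fun a => by simp [symAct]]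
    ring
  rw [h]
  simp only [hC, rSq, Fin.sum_univ_three]
  simp
  ring

theorem homogeneousComponent_mul {a : SymV} {d : ℕ} (ha : a.IsHomogeneous d) (q : SymV) (n : ℕ) :
    MvPolynomial.homogeneousComponent n (a * q) =
      if d ≤ n then a * MvPolynomial.homogeneousComponent (n - d) q else 0 := by
  conv_lhs => rw [← MvPolynomial.sum_homogeneousComponent q, Finset.mul_sum, map_sum]
  have h : ∀ i, MvPolynomial.homogeneousComponent n (a * MvPolynomial.homogeneousComponent i q) =
      if d + i = n then a * MvPolynomial.homogeneousComponent i q else 0 := fun i => by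
    rw [MvPolynomial.homogeneousComponent_of_mem
      (ha.mul (MvPolynomial.homogeneousComponent_isHomogeneous i q))]
    simp only [eq_comm]
  simp only [h]
  split_ifs with hd
  · rw [Finset.sum_eq_single (n - d)]
    · rw [if_pos (by omega)]
    · intro i _ hi
      rw [if_neg (by omega)]
    · intro hi
      have hlt : q.totalDegree < n - d := by
        rw [Finset.mem_range, not_lt] at hi
        omega
      rw [if_pos (by omega), MvPolynomial.homogeneousComponent_eq_zero _ _ hlt, mul_zero]
  · exact Finset.sum_eq_zero fun i _ => if_neg (by omega)

theorem rSq_ne_zero : rSq ≠ 0 := by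
  intro h
  have := congrArg (MvPolynomial.eval (fun _ => (1 : ℂ))) h
  simp [rSq, Fin.sum_univ_three, sgn] at this

/-- A harmonic polynomial divisible by `r²` vanishes: applying the Laplacian to `r^{2m} q` shows
that `r²` divides `q`, so that all powers of `r²` divide the polynomial. -/
theorem eq_zero_of_mem_harmSub_of_rSq_dvd {k : ℕ} {p : SymV} (hp : p ∈ harmSub k)
    (h : rSq ∣ p) : p = 0 := by
  obtain ⟨hk, hl⟩ := mem_harmSub.1 hp
  have hfac : ∀ m q, p = rSq ^ m * q → p = 0 ∨ (2 * m ≤ k ∧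
      p = rSq ^ m * MvPolynomial.homogeneousComponent (k - 2 * m) q) := by
    intro m q hq
    have h1 := homogeneousComponent_mul (rSq_isHomogeneous.pow m) q k
    rw [← hq, MvPolynomial.homogeneousComponent_eq_self hk] at h1
    split_ifs at h1 with hm
    · exact Or.inr ⟨hm, h1⟩
    · exact Or.inl h1
  -- `lap (r^{2m+2} q') = r^{2m} (c q' + r² lap q')` with `c ≠ 0`, so `r²` divides `q'`
  have key : ∀ m : ℕ, rSq ^ (m + 1) ∣ p := by
    intro m
    induction m with
    | zero => simpa using h
    | succ m ih =>
      obtain ⟨q, hq⟩ := ih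
      rcases hfac _ _ hq with h0 | ⟨hm, hq'⟩
      · rw [h0]; exact dvd_zero _
      · set q' := MvPolynomial.homogeneousComponent (k - 2 * (m + 1)) q
        have hq'h : q'.IsHomogeneous (k - 2 * (m + 1)) :=
          MvPolynomial.homogeneousComponent_isHomogeneous _ _
        have h1 := lap_rSq_pow_mul hq'h m
        rw [← hq', hl] at h1
        set c : ℂ := 2 * (m + 1) * (2 * (m + 1) + 2 * (k - 2 * (m + 1) : ℕ) + 1)
        have hc : c ≠ 0 := by
          simp only [c]
          exact_mod_cast (by positivity :
            2 * (m + 1) * (2 * (m + 1) + 2 * (k - 2 * (m + 1)) + 1) ≠ 0)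
        have h2 : rSq ^ m * (MvPolynomial.C c * q' + rSq * lap q') = 0 := by
          rw [h1]; ring
        have h3 := (mul_eq_zero.1 h2).resolve_left (pow_ne_zero _ rSq_ne_zero)
        have h4 : q' = rSq * (-(MvPolynomial.C c⁻¹ * lap q')) := by
          have h5 : (MvPolynomial.C c⁻¹ : SymV) * MvPolynomial.C c = 1 := by
            rw [← map_mul, inv_mul_cancel₀ hc, map_one]
          linear_combination (MvPolynomial.C c⁻¹) * h3 - q' * h5
        rw [hq', h4, pow_succ rSq (m + 1)]
        exact mul_dvd_mul_left _ (dvd_mul_right _ _)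
  obtain ⟨q, hq⟩ := key k
  rcases hfac _ _ hq with h0 | ⟨hm, -⟩
  · exact h0
  · omega

/-- `π_k` as a linear map. -/
def harmProjL (k : ℕ) : SymV →ₗ[ℂ] Harm k where
  toFun := harmProj k
  map_add' f g := harmVal_injective k <| by
    change harmPoly k _ = harmPoly k _ + harmPoly k _
    have : ∀ j, lap^[j] = ⇑(lap ^ j) := fun j => (Module.End.coe_pow lap j).symm
    simp only [harmPoly, this, map_add, mul_add, Finset.sum_add_distrib]
  map_smul' c f := harmVal_injective k <| by
    change harmPoly k _ = c • harmPoly k _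
    have : ∀ j, lap^[j] = ⇑(lap ^ j) := fun j => (Module.End.coe_pow lap j).symm
    simp only [harmPoly, this, map_smul, mul_smul_comm, Finset.smul_sum]

theorem harmProjL_apply (k : ℕ) (f : SymV) : harmProjL k f = harmProj k f := rfl

theorem rSq_dvd_sub_harmVal_harmProj {k : ℕ} {f : SymV} (hf : f.IsHomogeneous k) :
    rSq ∣ f - harmVal k (harmProj k f) := by
  have : harmVal k (harmProj k f) = harmPoly k f := by
    change harmPoly k _ = _
    rw [MvPolynomial.homogeneousComponent_eq_self hf]
  rw [this]
  exact rSq_dvd_sub_harmPoly k f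

/-- A harmonic `v ∈ ℋ_k` with `v ≡ f` modulo `r²` is the projection of `f`. -/
theorem harmProj_eq_of_dvd {k : ℕ} {f : SymV} (hf : f.IsHomogeneous k) (v : Harm k)
    (h : rSq ∣ f - harmVal k v) : harmProj k f = v := by
  have h1 := dvd_sub h (rSq_dvd_sub_harmVal_harmProj hf)
  rw [sub_sub_sub_cancel_left, ← map_sub] at h1
  exact sub_eq_zero.1 (harmVal_injective k ((eq_zero_of_mem_harmSub_of_rSq_dvd
    (Subtype.property (p := (· ∈ harmSub k)) _) h1).trans (map_zero _).symm))

theorem harmProj_congr {k : ℕ} {f g : SymV} (hf : f.IsHomogeneous k) (hg : g.IsHomogeneous k)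
    (h : rSq ∣ f - g) : harmProj k f = harmProj k g := by
  refine harmProj_eq_of_dvd hf _ ?_
  have := dvd_add h (rSq_dvd_sub_harmVal_harmProj hg)
  rwa [sub_add_sub_cancel] at this

theorem symAct_isHomogeneous (g : SL(2, ℝ)) {p : SymV} {k : ℕ} (hp : p.IsHomogeneous k) :
    (symAct g p).IsHomogeneous k := by
  have := hp.aeval (fun j => toSym (conj g (e j))) (n := 1) fun j => vecSym_isHomogeneous _
  rwa [one_mul] at this

theorem harmProj_symAct {k : ℕ} (g : SL(2, ℝ)) {f : SymV} (hf : f.IsHomogeneous k) :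
    harmProj k (symAct g f) = rho k g (harmProj k f) := by
  refine harmProj_eq_of_dvd (symAct_isHomogeneous g hf) _ ?_
  rw [harmVal_rho, ← map_sub]
  nth_rewrite 1 [← symAct_rSq g]
  exact map_dvd (symAct g) (rSq_dvd_sub_harmVal_harmProj hf)

/-! ### The raising operator and the vector `v_{-2}` -/

theorem raise_toSym_uVec' : raise (toSym (uVec' ℝ)) = MvPolynomial.C (-√2 : ℂ) * MvPolynomial.X 1 := by
  obtain ⟨r0, r1, r2⟩ := raise_X
  have h2 : (√2 : ℂ) * √2 = 2 := by exact_mod_cast Real.mul_self_sqrt (show (0 : ℝ) ≤ 2 by norm_num)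
  have h0 : (√2 : ℂ) ≠ 0 := fun h => by rw [h] at h2; norm_num at h2
  have h1 : (-1 / √2 - 1 / √2 : ℂ) = -√2 := by field_simp; rw [pow_two, h2]; norm_num
  simp only [toSym, Fin.sum_univ_three, map_add, Derivation.leibniz, MvPolynomial.derivation_C,
    r0, r1, r2, coord, uVec', smul_eq_mul]
  rw [← h1]
  simp
  ring

theorem toSym_uVec_mul : toSym (uVec' ℝ) * toSym (uVec ℝ) =
    MvPolynomial.C (1 / 2 : ℂ) * (MvPolynomial.X 1 ^ 2 - rSq) := by
  have h2 : (√2 : ℂ) * √2 = 2 := by exact_mod_cast Real.mul_self_sqrt (show (0 : ℝ) ≤ 2 by norm_num)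
  have h0 : (√2 : ℂ) ≠ 0 := fun h => by rw [h] at h2; norm_num at h2
  have h1 : (MvPolynomial.C (1 / √2 : ℂ) : SymV) * MvPolynomial.C (1 / √2 : ℂ) =
      MvPolynomial.C (1 / 2 : ℂ) := by
    rw [← map_mul]; congr 1; field_simp; rw [pow_two, h2]
  have hu' : toSym (uVec' ℝ) = MvPolynomial.C (1 / √2 : ℂ) * (MvPolynomial.X 2 - MvPolynomial.X 0) := by
    simp [toSym, Fin.sum_univ_three, coord, uVec', neg_div]; ring
  have hu : toSym (uVec ℝ) = MvPolynomial.C (1 / √2 : ℂ) * (MvPolynomial.X 2 + MvPolynomial.X 0) := by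
    simp [toSym, Fin.sum_univ_three, coord, uVec]; ring
  have hr : rSq = MvPolynomial.X 0 ^ 2 + MvPolynomial.X 1 ^ 2 - MvPolynomial.X 2 ^ 2 := by
    simp [rSq, Fin.sum_univ_three, sgn]; ring
  rw [hu, hu', hr]
  linear_combination (MvPolynomial.X 2 ^ 2 - MvPolynomial.X 0 ^ 2) * h1

theorem raise_X_one : raise (MvPolynomial.X 1) = MvPolynomial.C (-√2 : ℂ) * toSym (uVec ℝ) := by
  have h2 : (√2 : ℂ) * √2 = 2 := by exact_mod_cast Real.mul_self_sqrt (show (0 : ℝ) ≤ 2 by norm_num)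
  have h0 : (√2 : ℂ) ≠ 0 := fun h => by rw [h] at h2; norm_num at h2
  have h1 : (MvPolynomial.C (-√2 : ℂ) : SymV) * MvPolynomial.C (1 / √2 : ℂ) = -1 := by
    rw [← map_mul, show (-√2 * (1 / √2) : ℂ) = -1 by field_simp, map_neg, map_one]
  have hu : toSym (uVec ℝ) = MvPolynomial.C (1 / √2 : ℂ) * (MvPolynomial.X 2 + MvPolynomial.X 0) := by
    simp [toSym, Fin.sum_univ_three, coord, uVec]; ring
  rw [hu, raise_X.2.1]
  linear_combination (-(MvPolynomial.X 2 + MvPolynomial.X 0)) * h1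

theorem raise_rSq : raise rSq = 0 := by
  obtain ⟨r0, r1, r2⟩ := raise_X
  have hr : rSq = MvPolynomial.X 0 ^ 2 + MvPolynomial.X 1 ^ 2 - MvPolynomial.X 2 ^ 2 := by
    simp [rSq, Fin.sum_univ_three, sgn]; ring
  rw [hr]
  simp only [map_add, map_sub, Derivation.leibniz_pow, r0, r1, r2, smul_eq_mul, nsmul_eq_mul]
  push_cast
  ring

theorem rSq_dvd_raise {p : SymV} (h : rSq ∣ p) : rSq ∣ raise p := by
  obtain ⟨q, rfl⟩ := h
  rw [Derivation.leibniz, raise_rSq, smul_zero, add_zero, smul_eq_mul]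
  exact dvd_mul_right _ _

/-- Modulo `r²` one has `u u' = e₂² / 2`, whence
`R^j u'^k ≡ (-1)^j (2k)! / (2k-j)! 2^{-j/2} e₂^j u'^{k-j}`. -/
theorem rSq_dvd_raise_iterate (k j : ℕ) (hj : j ≤ k) : rSq ∣ raise^[j] (toSym (uVec' ℝ) ^ k) -
    MvPolynomial.C ((-1) ^ j * ((2 * k).descFactorial j : ℂ) * (1 / √2) ^ j) *
      (MvPolynomial.X 1 ^ j * toSym (uVec' ℝ) ^ (k - j)) := by
  have h2 : (√2 : ℂ) * √2 = 2 := by exact_mod_cast Real.mul_self_sqrt (show (0 : ℝ) ≤ 2 by norm_num)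
  have h0 : (√2 : ℂ) ≠ 0 := fun h => by rw [h] at h2; norm_num at h2
  induction j with
  | zero => simp
  | succ j ih =>
    have h1 := rSq_dvd_raise (ih (by omega))
    rw [map_sub, ← Function.iterate_succ_apply' raise] at h1
    obtain ⟨m, rfl⟩ : ∃ m, k = j + (m + 1) := ⟨k - j - 1, by omega⟩
    rw [show j + (m + 1) - j = m + 1 by omega] at h1
    rw [show j + (m + 1) - (j + 1) = m by omega]
    have h3 : rSq ∣ raise (MvPolynomial.C ((-1) ^ j * ((2 * (j + (m + 1))).descFactorial j : ℂ) *
        (1 / √2) ^ j) * (MvPolynomial.X 1 ^ j * toSym (uVec' ℝ) ^ (m + 1))) -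
        MvPolynomial.C ((-1) ^ (j + 1) * ((2 * (j + (m + 1))).descFactorial (j + 1) : ℂ) *
          (1 / √2) ^ (j + 1)) * (MvPolynomial.X 1 ^ (j + 1) * toSym (uVec' ℝ) ^ m) := by
      have hd : ((2 * (j + (m + 1))).descFactorial (j + 1) : ℂ) =
          (j + 2 * (m + 1)) * ((2 * (j + (m + 1))).descFactorial j : ℂ) := by
        rw [Nat.descFactorial_succ, show 2 * (j + (m + 1)) - j = j + 2 * (m + 1) by omega]
        push_cast
        ring
      rw [hd, pow_succ (-1 : ℂ), pow_succ (1 / (√2 : ℂ)),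
        show ∀ a b d : ℂ, a * -1 * ((j + 2 * (m + 1)) * b) * (d * (1 / √2)) =
          (a * b * d) * (-((j + 2 * (m + 1)) * (1 / √2))) from fun a b d => by ring,
        map_mul MvPolynomial.C (_ * _ * _), mul_assoc (MvPolynomial.C (_ * _ * _) : SymV)
          (MvPolynomial.C _), Derivation.leibniz,
        MvPolynomial.derivation_C, smul_zero, add_zero, smul_eq_mul, ← mul_sub]
      refine Dvd.dvd.mul_left ?_ _
      have hs : (MvPolynomial.C (-√2 : ℂ) : SymV) = 2 * MvPolynomial.C (-(1 / √2) : ℂ) := by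
        rw [show (2 : SymV) = MvPolynomial.C 2 from (map_ofNat _ 2).symm, ← map_mul]
        congr 1
        field_simp
        rw [pow_two, h2]
      have hh : (2 : SymV) * MvPolynomial.C (1 / 2 : ℂ) = 1 := by
        rw [show (2 : SymV) = MvPolynomial.C 2 from (map_ofNat _ 2).symm, ← map_mul]
        norm_num
      have hc : (MvPolynomial.C (-(((j : ℂ) + 2 * (m + 1)) * (1 / √2))) : SymV) =
          ((j : SymV) + 2 * ((m : SymV) + 1)) * MvPolynomial.C (-(1 / √2) : ℂ) := by
        rw [← mul_neg, map_mul, map_add, map_mul, map_add, map_natCast, map_natCast, map_ofNat,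
          map_one]
      rw [Derivation.leibniz, Derivation.leibniz_pow, Derivation.leibniz_pow, raise_toSym_uVec',
        raise_X_one, hc, hs, Nat.add_sub_cancel]
      simp only [smul_eq_mul, nsmul_eq_mul]
      -- `R (e₂^j u'^{m+1})` contains `e₂^{j-1} u u' u'^m`, which is congruent to `e₂^{j+1} u'^m / 2`
      rcases j with - | i
      · simp only [Nat.cast_zero, zero_mul, mul_zero, add_zero, pow_zero, zero_add, one_mul]
        push_cast
        refine ⟨0, ?_⟩
        ring
      · rw [Nat.add_sub_cancel]
        refine ⟨-(((i : SymV) + 1) * MvPolynomial.X 1 ^ i * toSym (uVec' ℝ) ^ m *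
          MvPolynomial.C (-(1 / √2) : ℂ)), ?_⟩
        push_cast
        have hu := toSym_uVec_mul
        linear_combination (2 * ((i : SymV) + 1) * MvPolynomial.X 1 ^ i * toSym (uVec' ℝ) ^ m *
          MvPolynomial.C (-(1 / √2) : ℂ)) * hu + ((i : SymV) + 1) * MvPolynomial.X 1 ^ i * toSym (uVec' ℝ) ^ m *
          MvPolynomial.C (-(1 / √2) : ℂ) * (MvPolynomial.X 1 ^ 2 - rSq) * hh
    have h4 := dvd_add h1 h3
    rwa [sub_add_sub_cancel] at h4

/-- The normalization `R v_{-2} = k 2^{k/2} π_k(e₂^k)`. -/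
theorem raise_vMinusTwo {k : ℕ} (hk : 0 < k) :
    raise (harmVal k (vMinusTwo k)) =
      harmVal k (((k : ℂ) * (√2 : ℂ) ^ k) • harmProj k (MvPolynomial.X 1 ^ k)) := by
  have h2 : (√2 : ℂ) * √2 = 2 := by exact_mod_cast Real.mul_self_sqrt (show (0 : ℝ) ≤ 2 by norm_num)
  have h0 : (√2 : ℂ) ≠ 0 := fun h => by rw [h] at h2; norm_num at h2
  obtain ⟨k, rfl⟩ : ∃ m, k = m + 1 := ⟨k - 1, by omega⟩
  set w : Harm (k + 1) := (⟨raise^[k + 1] (toSym (uVec' ℝ) ^ (k + 1)), raise_iterate_mem k (k + 1)⟩ :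
    harmSub (k + 1))
  have hX : (MvPolynomial.X (R := ℂ) (1 : Fin 3) ^ (k + 1)).IsHomogeneous (k + 1) := by
    simpa using (MvPolynomial.isHomogeneous_X ℂ (1 : Fin 3)).pow (k + 1)
  set c : ℂ := (-1) ^ (k + 1) * ((2 * (k + 1)).descFactorial (k + 1) : ℂ) * (1 / √2) ^ (k + 1)
  have hw : w = c • harmProj (k + 1) (MvPolynomial.X 1 ^ (k + 1)) := by
    have h := rSq_dvd_raise_iterate (k + 1) (k + 1) le_rfl
    rw [Nat.sub_self, pow_zero, mul_one, ← MvPolynomial.smul_eq_C_mul] at h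
    have hcX : (c • MvPolynomial.X (R := ℂ) (1 : Fin 3) ^ (k + 1)).IsHomogeneous (k + 1) := by
      rw [MvPolynomial.smul_eq_C_mul]
      simpa using (MvPolynomial.isHomogeneous_C (Fin 3) c).mul hX
    rw [← harmProjL_apply, ← map_smul, harmProjL_apply]
    refine (harmProj_eq_of_dvd hcX w ?_).symm
    rw [← dvd_neg, neg_sub]
    exact h
  have hv : raise (harmVal (k + 1) (vMinusTwo (k + 1))) =
      harmVal (k + 1) (((-2) ^ (k + 1) * ((k + 1).factorial : ℂ) ^ 2 /
      ((2 * (k + 1)).factorial * k.factorial) : ℂ) • w) := by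
    generalize hC : ((-2) ^ (k + 1) * ((k + 1).factorial : ℂ) ^ 2 /
      ((2 * (k + 1)).factorial * k.factorial) : ℂ) = C
    have h1 : harmVal (k + 1) (vMinusTwo (k + 1)) = C • raise^[k] (toSym (uVec' ℝ) ^ (k + 1)) := by
      rw [← hC]; rfl
    have h3 : harmVal (k + 1) w = raise^[k + 1] (toSym (uVec' ℝ) ^ (k + 1)) := rfl
    rw [h1, (harmVal (k + 1)).map_smul, raise.map_smul, h3, Function.iterate_succ_apply']
  rw [hv, hw, smul_smul]
  congr 2
  have hf : ((2 * (k + 1)).factorial : ℂ) =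
      (k + 1).factorial * ((2 * (k + 1)).descFactorial (k + 1) : ℂ) := by
    have := Nat.factorial_mul_descFactorial (show k + 1 ≤ 2 * (k + 1) by omega)
    rw [show 2 * (k + 1) - (k + 1) = k + 1 by omega] at this
    exact_mod_cast this.symm
  have hd : ((2 * (k + 1)).descFactorial (k + 1) : ℂ) ≠ 0 := by
    exact_mod_cast (Nat.descFactorial_eq_zero_iff_lt.not.2 (by omega))
  have hk1 : ((k + 1).factorial : ℂ) = (k + 1) * k.factorial := by
    rw [Nat.factorial_succ]; push_cast; ring
  have hk0 : (k.factorial : ℂ) ≠ 0 := by exact_mod_cast k.factorial_ne_zero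
  have hk2 : ((k : ℂ) + 1) ≠ 0 := by exact_mod_cast k.succ_ne_zero
  have hp : (-2 : ℂ) ^ (k + 1) * ((-1) ^ (k + 1) * (1 / √2) ^ (k + 1)) = √2 ^ (k + 1) := by
    rw [← mul_pow, ← mul_pow]
    congr 1
    field_simp
    rw [pow_two, h2]
  simp only [c]
  rw [hf, hk1]
  push_cast
  generalize ((2 * (k + 1)).descFactorial (k + 1) : ℂ) = D at *
  rw [← hp]
  field_simp

/-! ### Weak derivatives of functions with values in the symmetric algebra -/

section WeakDerivative

variable {E : Type*} [NormedAddCommGroup E] [NormedSpace ℝ E]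

/-- A function with values in the symmetric algebra (which carries no topology) has the derivative
`f'` at `x` if all linear functionals of it do. -/
def HasWeakFDerivAt (f : E → SymV) (f' : E → SymV) (x : E) : Prop :=
  ∀ μ : SymV →ₗ[ℂ] ℂ, ∃ D : E →L[ℝ] ℂ, (∀ ξ, D ξ = μ (f' ξ)) ∧
    HasFDerivAt (fun y => μ (f y)) D x

theorem HasWeakFDerivAt.congr {f f' g' : E → SymV} {x : E} (h : HasWeakFDerivAt f f' x)
    (h' : ∀ ξ, g' ξ = f' ξ) : HasWeakFDerivAt f g' x := by
  rwa [show g' = f' from funext h']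

theorem hasWeakFDerivAt_const (p : SymV) (x : E) :
    HasWeakFDerivAt (fun _ => p) (fun _ => 0) x := fun μ =>
  ⟨0, fun ξ => by simp, hasFDerivAt_const _ _⟩

theorem HasWeakFDerivAt.add {f f' g g' : E → SymV} {x : E} (hf : HasWeakFDerivAt f f' x)
    (hg : HasWeakFDerivAt g g' x) :
    HasWeakFDerivAt (fun y => f y + g y) (fun ξ => f' ξ + g' ξ) x := fun μ => by
  obtain ⟨D, hD, h⟩ := hf μ
  obtain ⟨D', hD', h'⟩ := hg μ
  refine ⟨D + D', fun ξ => by simp [hD, hD'], ?_⟩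
  simp only [map_add]
  exact h.add h'

theorem HasWeakFDerivAt.sum {J : Type*} (s : Finset J) {f f' : J → E → SymV} {x : E}
    (hf : ∀ j ∈ s, HasWeakFDerivAt (f j) (f' j) x) :
    HasWeakFDerivAt (fun y => ∑ j ∈ s, f j y) (fun ξ => ∑ j ∈ s, f' j ξ) x := by
  classical
  induction s using Finset.induction_on with
  | empty => simpa using hasWeakFDerivAt_const (E := E) 0 x
  | insert a s ha ih =>
    simp only [Finset.sum_insert ha]
    exact (hf a (by simp)).add (ih fun j hj => hf j (by simp [hj]))

theorem HasWeakFDerivAt.const_mul {f f' : E → SymV} {x : E} (hf : HasWeakFDerivAt f f' x)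
    (p : SymV) : HasWeakFDerivAt (fun y => p * f y) (fun ξ => p * f' ξ) x := fun μ =>
  hf (μ ∘ₗ LinearMap.mulLeft ℂ p)

theorem HasWeakFDerivAt.smul {c : E → ℂ} {c' : E →L[ℝ] ℂ} {f f' : E → SymV} {x : E}
    (hc : HasFDerivAt c c' x) (hf : HasWeakFDerivAt f f' x) :
    HasWeakFDerivAt (fun y => c y • f y) (fun ξ => c x • f' ξ + c' ξ • f x) x := fun μ => by
  obtain ⟨D, hD, h⟩ := hf μ
  refine ⟨c x • D + μ (f x) • c', fun ξ => ?_, ?_⟩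
  · simp [hD]; ring
  · simp only [map_smul, smul_eq_mul]
    exact hc.mul h

theorem HasWeakFDerivAt.mul_vecSym {f f' : E → SymV} {y : E → Fin 3 → ℂ} {y' : E → Fin 3 → ℂ} {x : E}
    (hf : HasWeakFDerivAt f f' x)
    (hy : ∀ i, ∃ D : E →L[ℝ] ℂ, (∀ ξ, D ξ = y' ξ i) ∧ HasFDerivAt (fun z => y z i) D x) :
    HasWeakFDerivAt (fun z => f z * vecSym (y z))
      (fun ξ => f' ξ * vecSym (y x) + f x * vecSym (y' ξ)) x := by
  choose D hD h using hy
  have := HasWeakFDerivAt.sum Finset.univ fun i _ =>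
    HasWeakFDerivAt.smul (h i) (hf.const_mul (MvPolynomial.X i))
  have h1 : (fun z => f z * vecSym (y z)) = fun z => ∑ i, y z i • (MvPolynomial.X i * f z) := by
    funext z
    simp only [vecSym, Finset.mul_sum, MvPolynomial.smul_eq_C_mul]
    exact Finset.sum_congr rfl fun i _ => by ring
  rw [h1]
  refine this.congr fun ξ => ?_
  simp only [vecSym, Finset.mul_sum, MvPolynomial.smul_eq_C_mul, ← Finset.sum_add_distrib, hD]
  exact Finset.sum_congr rfl fun i _ => by ring

theorem hasWeakFDerivAt_vecSym_pow {y : E → Fin 3 → ℂ} {y' : E → Fin 3 → ℂ} {x : E}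
    (hy : ∀ i, ∃ D : E →L[ℝ] ℂ, (∀ ξ, D ξ = y' ξ i) ∧ HasFDerivAt (fun z => y z i) D x) (n : ℕ) :
    HasWeakFDerivAt (fun z => vecSym (y z) ^ n)
      (fun ξ => n * vecSym (y x) ^ (n - 1) * vecSym (y' ξ)) x := by
  induction n with
  | zero => simpa using hasWeakFDerivAt_const (E := E) 1 x
  | succ n ih =>
    simp only [pow_succ]
    refine (ih.mul_vecSym hy).congr fun ξ => ?_
    rw [Nat.add_sub_cancel]
    rcases n with - | n
    · simp
    · rw [Nat.add_sub_cancel]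
      push_cast
      ring

/-- A function with values in `ℋ_k` is differentiable if it is weakly differentiable. -/
theorem hasFDerivAt_of_functionals {k : ℕ} {F : E → Harm k} {D : E →L[ℝ] Harm k} {x : E}
    (h : ∀ μ : Harm k →ₗ[ℂ] ℂ, ∃ D' : E →L[ℝ] ℂ, (∀ ξ, D' ξ = μ (D ξ)) ∧
      HasFDerivAt (fun y => μ (F y)) D' x) : HasFDerivAt F D x := by
  let b := Module.finBasis ℂ (Harm k)
  let φ : Harm k ≃L[ℝ] (Fin (Module.finrank ℂ (Harm k)) → ℂ) :=
    (b.equivFun.restrictScalars ℝ).toContinuousLinearEquiv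
  rw [← φ.comp_hasFDerivAt_iff, hasFDerivAt_pi']
  intro i
  obtain ⟨D', hD', h'⟩ := h (b.coord i)
  refine h'.congr_fderiv ?_
  ext ξ
  exact hD' ξ

theorem HasWeakFDerivAt.hasFDerivAt {k : ℕ} {f f' : E → SymV} {x : E}
    (h : HasWeakFDerivAt f f' x) {F : E → Harm k} {D : E →L[ℝ] Harm k}
    (T : SymV →ₗ[ℂ] Harm k) (hF : ∀ y, F y = T (f y)) (hD : ∀ ξ, D ξ = T (f' ξ)) :
    HasFDerivAt F D x := by
  refine hasFDerivAt_of_functionals fun μ => ?_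
  obtain ⟨D', hD', h'⟩ := h (μ ∘ₗ T)
  exact ⟨D', fun ξ => by rw [hD', hD]; rfl, by simpa only [hF, LinearMap.comp_apply] using h'⟩

/-- The coefficients of `ρ(g) v` are polynomials in the matrix entries of `g`. -/
theorem exists_poly_symAct (A : Fin 3 → Fin 3 → Poly6) (f : SymV) (μ : SymV →ₗ[ℂ] ℂ) :
    ∃ r : Poly6, ∀ (y : Fin 6 → ℂ) (g : SL(2, ℝ)),
      (∀ i j, (adMat g i j : ℂ) = MvPolynomial.eval y (A i j)) →
        μ (symAct g f) = MvPolynomial.eval y r := by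
  induction f using MvPolynomial.induction_on generalizing μ with
  | C a => exact ⟨MvPolynomial.C (μ (MvPolynomial.C a)), fun y g _ => by simp [symAct]⟩
  | add p q hp hq =>
    obtain ⟨r, hr⟩ := hp μ
    obtain ⟨r', hr'⟩ := hq μ
    exact ⟨r + r', fun y g h => by rw [map_add, map_add, map_add, hr y g h, hr' y g h]⟩
  | mul_X p j hp =>
    choose r hr using fun i : Fin 3 => hp (μ ∘ₗ LinearMap.mulLeft ℂ (MvPolynomial.X i))
    refine ⟨∑ i, A i j * r i, fun y g h => ?_⟩
    rw [map_mul (symAct g), symAct_X, Finset.mul_sum, map_sum, map_sum]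
    refine Finset.sum_congr rfl fun i _ => ?_
    rw [map_mul (MvPolynomial.eval y), ← h i j, ← hr i y g h, LinearMap.comp_apply, LinearMap.mulLeft_apply,
      ← smul_eq_mul (_ : ℂ), ← map_smul, MvPolynomial.smul_eq_C_mul]
    congr 1
    ring

/-- If the matrix of `g` on `V` depends polynomially on parameters, then so do the coordinates of
`ρ(g) v` in a basis of `ℋ_k`. -/
theorem exists_poly_rho {k : ℕ} (A : Fin 3 → Fin 3 → Poly6) (v : Harm k) :
    ∃ r : Fin (Module.finrank ℂ (Harm k)) → Poly6, ∀ (y : Fin 6 → ℂ) (g : SL(2, ℝ)),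
      (∀ i j, (adMat g i j : ℂ) = MvPolynomial.eval y (A i j)) →
        rho k g v = ∑ m, MvPolynomial.eval y (r m) • Module.finBasis ℂ (Harm k) m := by
  have h : ∀ m, ∃ r : Poly6, ∀ (y : Fin 6 → ℂ) (g : SL(2, ℝ)),
      (∀ i j, (adMat g i j : ℂ) = MvPolynomial.eval y (A i j)) →
        (Module.finBasis ℂ (Harm k)).coord m (rho k g v) = MvPolynomial.eval y r := by
    intro m
    obtain ⟨μ, hμ⟩ := LinearMap.exists_extend (p := harmSub k) ((Module.finBasis ℂ (Harm k)).coord m)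
    obtain ⟨r, hr⟩ := exists_poly_symAct A (harmVal k v) μ
    refine ⟨r, fun y g h => ?_⟩
    rw [← hr y g h, ← harmVal_rho]
    exact (LinearMap.congr_fun hμ (rho k g v)).symm
  choose r hr using h
  refine ⟨r, fun y g h => ?_⟩
  conv_lhs => rw [← (Module.finBasis ℂ (Harm k)).sum_repr (rho k g v)]
  exact Finset.sum_congr rfl fun m _ => by rw [← hr m y g h]; rfl

end WeakDerivative

/-! ### Binomial convolutions of Hermite sequences -/

section HermSeq

open Finset.HasAntidiagonal (antidiagonal)

variable {A : Type*} [CommRing A]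

/-- `a_j = h_j(p, q)` for the two-variable Hermite polynomials with
`h_{j+1} = 2 p h_j - j κ q h_{j-1}`. -/
def IsHerm (κ p q : A) (a : ℕ → A) : Prop :=
  a 0 = 1 ∧ ∀ j : ℕ, a (j + 1) = 2 * p * a j - j * (κ * q * a (j - 1))

/-- The binomial convolution of two sequences. -/
def bin (a b : ℕ → A) (k : ℕ) : A :=
  ∑ ij ∈ antidiagonal k, (k.choose ij.1 : A) * (a ij.1 * b ij.2)

theorem bin_comm (a b : ℕ → A) (k : ℕ) : bin a b k = bin b a k := by
  unfold bin
  rw [← Finset.Nat.sum_antidiagonal_swap]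
  refine Finset.sum_congr rfl fun ij hij => ?_
  rw [Finset.HasAntidiagonal.mem_antidiagonal] at hij
  simp only [Prod.fst_swap, Prod.snd_swap]
  rw [Nat.choose_symm_of_eq_add hij.symm, mul_comm (a _)]

theorem sum_choose_mul_pred (f : ℕ → ℕ → A) (k : ℕ) :
    ∑ ij ∈ antidiagonal k, (k.choose ij.1 : A) * (ij.1 * f (ij.1 - 1) ij.2) =
      k * ∑ ij ∈ antidiagonal (k - 1), ((k - 1).choose ij.1 : A) * f ij.1 ij.2 := by
  rcases k with - | k
  · simp
  · rw [Finset.Nat.antidiagonal_succ, Finset.sum_cons, Finset.sum_map, Nat.add_sub_cancel,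
      Finset.mul_sum]
    simp only [Nat.cast_zero, zero_mul, mul_zero, zero_add]
    refine Finset.sum_congr rfl fun ij _ => ?_
    have := Nat.add_one_mul_choose_eq k ij.1
    have h2 : ((k : A) + 1) * (k.choose ij.1 : A) = ((k + 1).choose (ij.1 + 1) : A) * (ij.1 + 1) := by
      exact_mod_cast congrArg (Nat.cast (R := A)) this
    simp only [Function.Embedding.prodMap, Function.Embedding.coeFn_mk, Prod.map,
      Function.Embedding.refl_apply, Nat.succ_eq_add_one, Nat.add_sub_cancel, Nat.cast_add,
      Nat.cast_one]
    linear_combination (- f ij.1 ij.2) * h2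

theorem bin_succ (a b : ℕ → A) (k : ℕ) :
    bin a b (k + 1) = bin (fun i => a (i + 1)) b k + bin a (fun i => b (i + 1)) k := by
  unfold bin
  rw [Finset.sum_antidiagonal_choose_succ_mul (fun i j => a i * b j), add_comm]
  congr 1
  refine Finset.sum_congr rfl fun ij hij => ?_
  rw [Finset.HasAntidiagonal.mem_antidiagonal] at hij
  rw [Nat.choose_symm_of_eq_add hij.symm]

/-- A sequence obtained from `a` by the Hermite recursion keeps this form when convolved with `b`. -/
theorem bin_shift {p q : A} {a a' : ℕ → A} (h : ∀ j : ℕ, a' j = 2 * p * a j - j * (q * a (j - 1)))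
    (b : ℕ → A) (k : ℕ) :
    bin a' b k = 2 * p * bin a b k - k * (q * bin a b (k - 1)) := by
  have h' := sum_choose_mul_pred (fun i j => a i * b j) k
  calc bin a' b k = 2 * p * bin a b k - q * ∑ ij ∈ antidiagonal k,
        (k.choose ij.1 : A) * (ij.1 * (a (ij.1 - 1) * b ij.2)) := by
        simp only [bin, Finset.mul_sum, ← Finset.sum_sub_distrib, h]
        exact Finset.sum_congr rfl fun _ _ => by ring
    _ = _ := by rw [h']; unfold bin; ring

/-- The addition theorem of Hermite polynomials, `h_k(p + p', q + q') = ∑ C(k,i) h_i(p,q) h_{k-i}(p',q')`. -/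
theorem IsHerm.bin {κ p q p' q' : A} {a b : ℕ → A} (ha : IsHerm κ p q a) (hb : IsHerm κ p' q' b) :
    IsHerm κ (p + p') (q + q') (bin a b) := by
  refine ⟨by simp [Spectacle.bin, ha.1, hb.1], fun k => ?_⟩
  rw [bin_succ, bin_shift ha.2, bin_comm a (fun i => b (i + 1)), bin_shift hb.2, bin_comm b a,
    bin_comm b a]
  ring

/-- `h_k(p, q)` modulo `d` depends only on `q` modulo `d`. -/
theorem IsHerm.dvd_sub {κ p q q' d : A} {a b : ℕ → A} (ha : IsHerm κ p q a)
    (hb : IsHerm κ p q' b) (h : d ∣ q - q') (k : ℕ) : d ∣ a k - b k := by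
  induction k using Nat.strong_induction_on with
  | _ k ih =>
    rcases k with - | k
    · simp [ha.1, hb.1]
    · obtain ⟨r, hr⟩ := ih k (by omega)
      obtain ⟨s, hs⟩ := ih (k - 1) (by omega)
      obtain ⟨u, hu⟩ := h
      refine ⟨2 * p * r - k * (κ * q * s) - k * (κ * u * b (k - 1)), ?_⟩
      rw [ha.2, hb.2]
      linear_combination 2 * p * hr - k * (κ * q) * hs - k * (κ * b (k - 1)) * hu

theorem isHerm_pow (κ y : A) : IsHerm κ y 0 (fun j => (2 * y) ^ j) :=
  ⟨by simp, fun j => by ring⟩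

end HermSeq

/-- `H̃_j(x) z^j = h_j(x z, z²)`. -/
theorem isHerm_herm (x : ℝ) (z : SymV) : IsHerm (MvPolynomial.C (1 / Real.pi : ℂ))
    (MvPolynomial.C (x : ℂ) * z) (z ^ 2)
    (fun j => MvPolynomial.C (((herm j).eval x : ℝ) : ℂ) * z ^ j) := by
  refine ⟨by simp [herm], fun j => ?_⟩
  have h2 : (MvPolynomial.C (2 : ℂ) : SymV) = 2 := map_ofNat _ 2
  beta_reduce
  rcases j with - | j
  · simp [herm, h2]; ring
  · rw [herm_add_two]
    have hj : (MvPolynomial.C ((j + 1 : ℂ) / Real.pi) : SymV) =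
        ((j : SymV) + 1) * MvPolynomial.C (1 / Real.pi : ℂ) := by
      rw [div_eq_mul_one_div, map_mul, map_add, map_natCast, map_one]
    simp only [Polynomial.eval_sub, Polynomial.eval_mul, Polynomial.eval_C, Polynomial.eval_X]
    push_cast
    rw [map_sub, map_mul, map_mul, map_mul, hj, h2]
    ring

open Finset.HasAntidiagonal (antidiagonal) in
/-- A sum over words in two letters, as a sum over the numbers of the letters. -/
theorem sum_words_eq_sum_antidiagonal (k : ℕ) (f : ℕ → ℕ → SymV) :
    ∑ β : Fin k → Fin 2, f ((List.ofFn β).count 0) ((List.ofFn β).count 1) *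
        ∏ i, MvPolynomial.X (β i).castSucc =
      ∑ ij ∈ antidiagonal k, (k.choose ij.1 : SymV) *
        (f ij.1 ij.2 * (MvPolynomial.X 0 ^ ij.1 * MvPolynomial.X 1 ^ ij.2)) := by
  induction k generalizing f with
  | zero => simp
  | succ k ih =>
    rw [Finset.sum_antidiagonal_choose_succ_mul
      (fun i j => f i j * (MvPolynomial.X 0 ^ i * MvPolynomial.X 1 ^ j)),
      ← (Fin.consEquiv fun _ => Fin 2).sum_comp, Fintype.sum_prod_type, Fin.sum_univ_two, add_comm]
    congr 1
    · have h := congrArg (fun p => MvPolynomial.X 1 * p) (ih fun i j => f i (j + 1))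
      simp only [Finset.mul_sum] at h
      calc _ = _ := Finset.sum_congr rfl fun β _ => ?_
        _ = _ := h
        _ = _ := Finset.sum_congr rfl fun ij _ => by ring
      simp [Fin.consEquiv, List.ofFn_succ, Fin.prod_univ_succ]
      ring
    · have h := congrArg (fun p => MvPolynomial.X 0 * p) (ih fun i j => f (i + 1) j)
      simp only [Finset.mul_sum] at h
      calc _ = _ := Finset.sum_congr rfl fun β _ => ?_
        _ = _ := h
        _ = _ := Finset.sum_congr rfl fun ij hij => ?_
      · simp [Fin.consEquiv, List.ofFn_succ, Fin.prod_univ_succ]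
        ring
      · rw [Finset.HasAntidiagonal.mem_antidiagonal] at hij
        rw [Nat.choose_symm_of_eq_add hij.symm]
        ring

/-- The antiderivatives of the Hermite functions, `psiInt j` having the derivative `psi j`. -/
def psiInt : ℕ → ℝ → ℝ
  | 0, x => ∫ r in (0 : ℝ)..x, psi 0 r
  | j + 1, x => -(1 / (2 * Real.pi)) * psi j x

theorem hasDerivAt_psiInt (j : ℕ) (x : ℝ) : HasDerivAt (psiInt j) (psi j x) x := by
  have hc : Continuous (psi 0) :=
    continuous_iff_continuousAt.2 fun y => (hasDerivAt_psi 0 y).continuousAt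
  rcases j with - | j
  · exact intervalIntegral.integral_hasDerivAt_right (hc.intervalIntegrable _ _)
      (hc.stronglyMeasurableAtFilter _ _) hc.continuousAt
  · refine ((hasDerivAt_psi j x).const_mul (-(1 / (2 * Real.pi)))).congr_deriv ?_
    have := Real.pi_ne_zero
    field_simp

theorem bin_herm_shift (x : ℝ) (z : SymV) (b : ℕ → SymV) (k : ℕ) :
    bin (fun i => MvPolynomial.C (((herm (i + 1)).eval x : ℝ) : ℂ) * z ^ i) b k =
      2 * MvPolynomial.C (x : ℂ) *
        bin (fun j => MvPolynomial.C (((herm j).eval x : ℝ) : ℂ) * z ^ j) b k -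
      (k : SymV) * (MvPolynomial.C (1 / Real.pi : ℂ) * z *
        bin (fun j => MvPolynomial.C (((herm j).eval x : ℝ) : ℂ) * z ^ j) b (k - 1)) := by
  have hs : ∀ i : ℕ, (MvPolynomial.C (((herm (i + 1)).eval x : ℝ) : ℂ) : SymV) * z ^ i =
      2 * MvPolynomial.C (x : ℂ) * (MvPolynomial.C (((herm i).eval x : ℝ) : ℂ) * z ^ i) -
        (i : SymV) * (MvPolynomial.C (1 / Real.pi : ℂ) * z *
          (MvPolynomial.C (((herm (i - 1)).eval x : ℝ) : ℂ) * z ^ (i - 1))) := by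
    intro i
    have h := (isHerm_herm x 1).2 i
    simp only [one_pow, mul_one] at h
    rcases i with - | i
    · rw [zero_add, h, pow_zero]
      push_cast
      ring
    · rw [h, Nat.add_sub_cancel]
      push_cast
      ring
  exact bin_shift hs b k

/-- The Howe operators with values in the frame `e₁, e₂`, paired with a cotangent vector
`(o₁, o₂)`. -/
def howeSum (k : ℕ) (x : Fin 3 → ℝ) (o : Fin 2 → ℝ) : SymV :=
  ∑ α : Fin 2, ∑ β : Fin k → Fin 2, MvPolynomial.C ((howeGauss α β x * o α : ℝ) : ℂ) *
    ∏ i, MvPolynomial.X (β i).castSucc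

open Finset.HasAntidiagonal (antidiagonal) in
/-- A multiple of the differential of `∑ C(k,i) psiInt_i(x₃) (2 Y)^j (-e₃)^i` in the variables
`(x₃, e₃)`, for `Y = x₁ e₁ + x₂ e₂ + x₃ e₃`, when `e₃` moves in the direction `o₁ e₁ + o₂ e₂`. -/
def howeDiff (k : ℕ) (x : Fin 3 → ℝ) (o : Fin 2 → ℝ) : SymV :=
  MvPolynomial.C ((-2 * Real.exp (-Real.pi * (x 0 ^ 2 + x 1 ^ 2 - x 2 ^ 2)) : ℝ) : ℂ) *
    ∑ ij ∈ antidiagonal k, (k.choose ij.1 : SymV) *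
      (MvPolynomial.C (psiInt ij.1 (x 2) : ℂ) *
        ((2 * vecSym fun i => (x i : ℂ)) ^ ij.2 * ((ij.1 : SymV) *
          (-MvPolynomial.X 2) ^ (ij.1 - 1) * -(MvPolynomial.C (o 0 : ℂ) * MvPolynomial.X 0 +
            MvPolynomial.C (o 1 : ℂ) * MvPolynomial.X 1))) +
      MvPolynomial.C ((psi ij.1 (x 2) * -(x 0 * o 0 + x 1 * o 1) : ℝ) : ℂ) *
        ((2 * vecSym fun i => (x i : ℂ)) ^ ij.2 * (-MvPolynomial.X 2) ^ ij.1))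

open Finset.HasAntidiagonal (antidiagonal) in
/-- The key congruence modulo `r²`. It holds since `x₁ e₁ + x₂ e₂ = Y - x₃ e₃` and
`e₁² + e₂² ≡ e₃²`, so that both sides are built from the same two-variable Hermite polynomials. -/
theorem rSq_dvd_howe_sub (k : ℕ) (x : Fin 3 → ℝ) (o : Fin 2 → ℝ) :
    rSq ∣ howeSum k x o - howeDiff k x o := by
  unfold howeSum howeDiff
  set κ : SymV := MvPolynomial.C (1 / Real.pi : ℂ) with hκ
  set a : ℕ → SymV := fun j => MvPolynomial.C (((herm j).eval (x 0) : ℝ) : ℂ) * MvPolynomial.X 0 ^ j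
    with ha
  set b : ℕ → SymV := fun j => MvPolynomial.C (((herm j).eval (x 1) : ℝ) : ℂ) * MvPolynomial.X 1 ^ j
    with hb
  set c : ℕ → SymV := fun j => MvPolynomial.C (((herm j).eval (x 2) : ℝ) : ℂ) *
    (-MvPolynomial.X 2) ^ j with hc
  set Y : SymV := vecSym fun i => (x i : ℂ) with hY
  set d : ℕ → SymV := fun j => (2 * Y) ^ j with hd
  set O : SymV := MvPolynomial.C (o 0 : ℂ) * MvPolynomial.X 0 +
    MvPolynomial.C (o 1 : ℂ) * MvPolynomial.X 1 with hO
  have hN := (isHerm_herm (x 0) (MvPolynomial.X 0)).bin (isHerm_herm (x 1) (MvPolynomial.X 1))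
  have hM := (isHerm_herm (x 2) (-MvPolynomial.X 2)).bin (isHerm_pow κ Y)
  rw [← hκ, ← ha, ← hb] at hN
  rw [← hκ, ← hc, ← hd] at hM
  have hp : MvPolynomial.C (x 2 : ℂ) * -MvPolynomial.X 2 + Y =
      MvPolynomial.C (x 0 : ℂ) * MvPolynomial.X 0 + MvPolynomial.C (x 1 : ℂ) * MvPolynomial.X 1 := by
    rw [hY, vecSym, Fin.sum_univ_three]; ring
  rw [hp] at hM
  have hdvd : ∀ k, rSq ∣ bin a b k - bin c d k := hN.dvd_sub hM ⟨1, by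
    simp [rSq, Fin.sum_univ_three, sgn]; ring⟩
  -- the left side in terms of `h_k(x₁ e₁ + x₂ e₂, e₁² + e₂²)`; the
  -- additional letter raises the degree of one Hermite polynomial, which the recursion undoes
  have hL : ∀ α : Fin 2, ∑ β : Fin k → Fin 2, MvPolynomial.C ((howeGauss α β x * o α : ℝ) : ℂ) *
      ∏ i, MvPolynomial.X (β i).castSucc = MvPolynomial.C ((gauss x * o α : ℝ) : ℂ) *
        (2 * MvPolynomial.C (x α.castSucc : ℂ) * bin a b k -
          (k : SymV) * (κ * MvPolynomial.X α.castSucc * bin a b (k - 1))) := by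
    intro α
    have hw := sum_words_eq_sum_antidiagonal k fun i j =>
      MvPolynomial.C (((herm (i + if α = 0 then 1 else 0)).eval (x 0) : ℝ) : ℂ) *
        MvPolynomial.C (((herm (j + if α = 1 then 1 else 0)).eval (x 1) : ℝ) : ℂ)
    calc _ = MvPolynomial.C ((gauss x * o α : ℝ) : ℂ) * ∑ β : Fin k → Fin 2,
          (MvPolynomial.C (((herm ((List.ofFn β).count 0 + if α = 0 then 1 else 0)).eval (x 0) : ℝ)
            : ℂ) * MvPolynomial.C (((herm ((List.ofFn β).count 1 + if α = 1 then 1 else 0)).eval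
              (x 1) : ℝ) : ℂ)) * ∏ i, MvPolynomial.X (β i).castSucc := by
          rw [Finset.mul_sum]
          exact Finset.sum_congr rfl fun β _ => by
            rw [howeGauss_eq]
            have e0 : (α :: List.ofFn β).count 0 = (List.ofFn β).count 0 + if α = 0 then 1 else 0 := by
              rw [List.count_cons]; simp
            have e1 : (α :: List.ofFn β).count 1 = (List.ofFn β).count 1 + if α = 1 then 1 else 0 := by
              rw [List.count_cons]; simp
            rw [e0, e1, ← mul_assoc]
            congr 1
            push_cast
            simp only [map_mul]
            ring
      _ = _ := by
          rw [hw]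
          congr 1
          fin_cases α
          · refine Eq.trans ?_ (bin_herm_shift (x 0) (MvPolynomial.X 0) b k)
            exact Finset.sum_congr rfl fun ij _ => by simp [hb]; left; ring
          · rw [bin_comm a b, bin_comm a b]
            refine Eq.trans ?_ (bin_herm_shift (x 1) (MvPolynomial.X 1) a k)
            rw [bin_comm]
            exact Finset.sum_congr rfl fun ij _ => by simp [ha]; left; ring
  -- the right side in terms of `h_k(Y - x₃ e₃, e₃²)`; for `i > 0` the factor `psiInt_i` is a multiple of
  -- the Hermite function of degree `i - 1`, and for `i = 0` the term with `psiInt_0` has the factor `i`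
  have hR : ∑ ij ∈ antidiagonal k, (k.choose ij.1 : SymV) *
      (MvPolynomial.C (psiInt ij.1 (x 2) : ℂ) *
        ((2 * Y) ^ ij.2 * ((ij.1 : SymV) * (-MvPolynomial.X 2) ^ (ij.1 - 1) * -O)) +
      MvPolynomial.C ((psi ij.1 (x 2) * -(x 0 * o 0 + x 1 * o 1) : ℝ) : ℂ) *
        ((2 * Y) ^ ij.2 * (-MvPolynomial.X 2) ^ ij.1)) =
      MvPolynomial.C ((Real.exp (-2 * Real.pi * x 2 ^ 2) : ℝ) : ℂ) *
        (MvPolynomial.C ((-(x 0 * o 0 + x 1 * o 1) : ℝ) : ℂ) * bin c d k +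
          MvPolynomial.C (1 / 2 : ℂ) * κ * O * ((k : SymV) * bin c d (k - 1))) := by
    have h := sum_choose_mul_pred (fun i j => c i * d j) k
    have hψ : ∀ i : ℕ, (MvPolynomial.C (psiInt i (x 2) : ℂ) : SymV) *
        ((i : SymV) * (-MvPolynomial.X 2) ^ (i - 1)) =
        -(MvPolynomial.C ((Real.exp (-2 * Real.pi * x 2 ^ 2) : ℝ) : ℂ) *
          MvPolynomial.C (1 / 2 : ℂ) * κ) * ((i : SymV) * c (i - 1)) := by
      intro i
      rcases i with - | i
      · simp
      · have : (psiInt (i + 1) (x 2) : ℂ) = -((Real.exp (-2 * Real.pi * x 2 ^ 2) : ℝ) *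
            (1 / 2) * (1 / Real.pi)) * ((herm i).eval (x 2) : ℝ) := by
          simp only [psiInt, psi]
          push_cast
          ring
        rw [this, Nat.add_sub_cancel, hc, hκ]
        simp only [map_mul, map_neg]
        ring
    unfold bin at h ⊢
    rw [← h, mul_add, Finset.mul_sum, Finset.mul_sum, Finset.mul_sum, Finset.mul_sum,
      ← Finset.sum_add_distrib]
    refine Finset.sum_congr rfl fun ij _ => ?_
    have hpsi : (MvPolynomial.C ((psi ij.1 (x 2) * -(x 0 * o 0 + x 1 * o 1) : ℝ) : ℂ) : SymV) *
        (-MvPolynomial.X 2) ^ ij.1 =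
        MvPolynomial.C ((Real.exp (-2 * Real.pi * x 2 ^ 2) : ℝ) : ℂ) *
        MvPolynomial.C ((-(x 0 * o 0 + x 1 * o 1) : ℝ) : ℂ) * c ij.1 := by
      rw [psi, hc]
      push_cast
      simp only [map_mul]
      ring
    simp only [hd]
    linear_combination (-(k.choose ij.1 : SymV) * (2 * Y) ^ ij.2 * O) * hψ ij.1 +
      ((k.choose ij.1 : SymV) * (2 * Y) ^ ij.2) * hpsi
  rw [hR, Fin.sum_univ_two, hL, hL]
  obtain ⟨r, hr⟩ := hdvd k
  obtain ⟨s, hs⟩ := hdvd (k - 1)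
  have hg : gauss x = Real.exp (-Real.pi * (x 0 ^ 2 + x 1 ^ 2 - x 2 ^ 2)) *
      Real.exp (-2 * Real.pi * x 2 ^ 2) := by
    rw [gauss, ← Real.exp_add, Fin.sum_univ_three]
    congr 1
    ring
  rw [hg]
  set G : SymV := MvPolynomial.C ((Real.exp (-Real.pi * (x 0 ^ 2 + x 1 ^ 2 - x 2 ^ 2)) : ℝ) : ℂ)
    with hG
  set G' : SymV := MvPolynomial.C ((Real.exp (-2 * Real.pi * x 2 ^ 2) : ℝ) : ℂ) with hG'
  have h2 : (MvPolynomial.C (2 : ℂ) : SymV) = 2 := map_ofNat _ 2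
  have h12 : (MvPolynomial.C (1 / 2 : ℂ) : SymV) * 2 = 1 := by
    rw [← h2, ← map_mul]; norm_num
  refine ⟨G * G' * (2 * (MvPolynomial.C (x 0 : ℂ) * MvPolynomial.C (o 0 : ℂ) +
    MvPolynomial.C (x 1 : ℂ) * MvPolynomial.C (o 1 : ℂ)) * r - (k : SymV) * (κ * O * s)), ?_⟩
  simp only [Complex.ofReal_mul, Complex.ofReal_neg, Complex.ofReal_add, map_mul, map_neg, map_add,
    ← hG, ← hG', Fin.castSucc_zero, Fin.castSucc_one, Complex.ofReal_ofNat, h2, hO] at *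
  linear_combination (2 * G * G' * (MvPolynomial.C (x 0 : ℂ) * MvPolynomial.C (o 0 : ℂ) +
    MvPolynomial.C (x 1 : ℂ) * MvPolynomial.C (o 1 : ℂ))) * hr -
    (G * G' * κ * O * (k : SymV)) * hs + (G * G' * κ * O * (k : SymV) * bin c d (k - 1)) * h12

theorem isHomogeneous_word {k : ℕ} (β : Fin k → Fin 2) :
    (∏ i, MvPolynomial.X (R := ℂ) (β i).castSucc : SymV).IsHomogeneous k := by
  simpa using MvPolynomial.IsHomogeneous.prod Finset.univ
    (fun i => (MvPolynomial.X (β i).castSucc : SymV)) (fun _ => 1)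
    fun i _ => MvPolynomial.isHomogeneous_X _ _

theorem isHomogeneous_C_mul {k : ℕ} {p : SymV} (a : ℂ) (hp : p.IsHomogeneous k) :
    (MvPolynomial.C a * p).IsHomogeneous k := by
  simpa using (MvPolynomial.isHomogeneous_C (Fin 3) a).mul hp

theorem howeSum_isHomogeneous (k : ℕ) (x : Fin 3 → ℝ) (o : Fin 2 → ℝ) :
    (howeSum k x o).IsHomogeneous k :=
  MvPolynomial.IsHomogeneous.sum _ _ _ fun _ _ => MvPolynomial.IsHomogeneous.sum _ _ _ fun β _ =>
    isHomogeneous_C_mul _ (isHomogeneous_word β)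

theorem isHomogeneous_natCast_mul {k : ℕ} {p : SymV} (n : ℕ) (hp : p.IsHomogeneous k) :
    ((n : SymV) * p).IsHomogeneous k := by
  have := isHomogeneous_C_mul (n : ℂ) hp
  rwa [map_natCast] at this

theorem howeDiff_isHomogeneous (k : ℕ) (x : Fin 3 → ℝ) (o : Fin 2 → ℝ) :
    (howeDiff k x o).IsHomogeneous k := by
  have h2 : (2 * vecSym fun i => (x i : ℂ)).IsHomogeneous 1 := by
    have := isHomogeneous_natCast_mul 2 (vecSym_isHomogeneous fun i => (x i : ℂ))
    exact_mod_cast this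
  have hX : ∀ i, (MvPolynomial.X i : SymV).IsHomogeneous 1 := fun i =>
    MvPolynomial.isHomogeneous_X ℂ i
  refine isHomogeneous_C_mul _ (MvPolynomial.IsHomogeneous.sum _ _ _ fun ij hij => ?_)
  rw [Finset.HasAntidiagonal.mem_antidiagonal] at hij
  refine isHomogeneous_natCast_mul _ ((isHomogeneous_C_mul _ ?_).add (isHomogeneous_C_mul _ ?_))
  · rcases hi : ij.1 with - | i
    · simpa using MvPolynomial.isHomogeneous_zero (Fin 3) ℂ k
    · rw [mul_assoc]
      have h := (h2.pow ij.2).mul (isHomogeneous_natCast_mul (i + 1)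
        (((hX 2).neg.pow i).mul ((isHomogeneous_C_mul (o 0) (hX 0)).add
          (isHomogeneous_C_mul (o 1) (hX 1))).neg))
      rwa [show 1 * ij.2 + (1 * i + 1) = k by omega] at h
  · have h := (h2.pow ij.2).mul ((hX 2).neg.pow ij.1)
    rwa [show 1 * ij.2 + 1 * ij.1 = k by omega] at h

/-! ### The negative vector attached to a point of the upper half plane -/

/-- The traceless matrix `(b a; c -b)`. -/
def trless {R : Type*} [CommRing R] (b a c : R) : Matrix (Fin 2) (Fin 2) R := !![b, a; c, -b]

theorem trace_trless {R : Type*} [CommRing R] (b a c : R) : (trless b a c).trace = 0 := by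
  simp [trless, Matrix.trace_fin_two]

theorem eq_trless {R : Type*} [CommRing R] {X : Matrix (Fin 2) (Fin 2) R} (hX : X.trace = 0) :
    X = trless (X 0 0) (X 0 1) (X 1 0) := by
  rw [Matrix.trace_fin_two] at hX
  ext i j
  fin_cases i <;> fin_cases j <;> simp [trless]
  linear_combination hX

theorem conj_eq {R : Type*} [CommRing R] (g : SL(2, R)) (X : Matrix (Fin 2) (Fin 2) R) :
    conj g X = !![g 0 0, g 0 1; g 1 0, g 1 1] * X * !![g 1 1, -g 0 1; -g 1 0, g 0 0] := by
  rw [conj, Matrix.SpecialLinearGroup.coe_inv, Matrix.adjugate_fin_two]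
  congr 2
  exact Matrix.eta_fin_two _

theorem gMat_coe (z : ℍ) : (gMat z : Matrix (Fin 2) (Fin 2) ℝ) =
    !![√z.im, z.re * (√z.im)⁻¹; 0, (√z.im)⁻¹] := by
  have h : 0 < √z.im := Real.sqrt_pos.2 z.im_pos
  have ha : (aMat √z.im : Matrix (Fin 2) (Fin 2) ℝ) = !![√z.im, 0; 0, (√z.im)⁻¹] := by
    have : aMat √z.im = ⟨!![√z.im, 0; 0, (√z.im)⁻¹], by simp [h.ne']⟩ := dif_pos h
    rw [this]
  rw [gMat, Matrix.SpecialLinearGroup.coe_mul, ha]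
  ext i j
  fin_cases i <;> fin_cases j <;> simp [nMat, Matrix.mul_apply, Fin.sum_univ_two]

theorem conj_gMat (z : ℍ) (b a c : ℝ) : conj (gMat z) (trless b a c) =
    trless (b + z.re * c * z.im⁻¹) (z.im * a - 2 * z.re * b - z.re ^ 2 * c * z.im⁻¹)
      (c * z.im⁻¹) := by
  have h : √z.im ≠ 0 := (Real.sqrt_pos.2 z.im_pos).ne'
  have hs : √z.im ^ 2 = z.im := Real.sq_sqrt z.im_pos.le
  have hi : z.im⁻¹ = (√z.im)⁻¹ ^ 2 := by rw [inv_pow, hs]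
  have h0 : √z.im * (√z.im)⁻¹ = 1 := mul_inv_cancel₀ h
  rw [conj_eq]
  simp only [gMat_coe, hi]
  ext i j
  fin_cases i <;> fin_cases j <;> simp [trless, Matrix.mul_apply, Fin.sum_univ_two]
  · field_simp
  · rw [← hs]; simp only [Real.sqrt_sq_eq_abs, abs_of_nonneg (Real.sqrt_nonneg _)]; field_simp; ring
  · field_simp
  · field_simp

theorem conj_gMat_inv (z : ℍ) (b a c : ℝ) : conj (gMat z)⁻¹ (trless b a c) =
    trless (b - z.re * c) ((a + 2 * z.re * b - z.re ^ 2 * c) * z.im⁻¹) (z.im * c) := by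
  have h : z.im ≠ 0 := z.im_pos.ne'
  rw [← conj_inv_conj (gMat z) (trless (b - z.re * c) _ _), conj_gMat]
  congr 2 <;> field_simp <;> ring

/-- The vector `g_w e₃`, spanning the negative line attached to `w`, of norm `-1`. -/
def negVec (w : ℂ) : Matrix (Fin 2) (Fin 2) ℝ :=
  (1 / √2) • trless (-(w.re * w.im⁻¹)) (w.re ^ 2 * w.im⁻¹ + w.im) (-w.im⁻¹)

theorem trace_negVec (w : ℂ) : (negVec w).trace = 0 := by
  rw [negVec, Matrix.trace_smul, trace_trless, smul_zero]

theorem e_two : e 2 = (1 / √2) • trless (0 : ℝ) 1 (-1) := by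
  ext i j; fin_cases i <;> fin_cases j <;> simp [e, trless]

theorem e_zero : e 0 = (1 / √2) • trless (0 : ℝ) 1 1 := by
  ext i j; fin_cases i <;> fin_cases j <;> simp [e, trless]

theorem e_one : e 1 = (1 / √2) • trless (1 : ℝ) 0 0 := by
  ext i j; fin_cases i <;> fin_cases j <;> simp [e, trless]

theorem conj_gMat_e_two (z : ℍ) : conj (gMat z) (e 2) = negVec z := by
  rw [e_two, conj_smul, conj_gMat, negVec]
  congr 2 <;> simp <;> ring

theorem det_eq_one' (g : SL(2, ℝ)) : g 0 0 * g 1 1 - g 0 1 * g 1 0 = 1 := by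
  rw [← Matrix.det_fin_two (g : Matrix (Fin 2) (Fin 2) ℝ)]; exact g.2

theorem conj_trless (g : SL(2, ℝ)) (b a c : ℝ) : conj g (trless b a c) =
    trless ((g 0 0 * b + g 0 1 * c) * g 1 1 - (g 0 0 * a - g 0 1 * b) * g 1 0)
      ((g 0 0 * a - g 0 1 * b) * g 0 0 - (g 0 0 * b + g 0 1 * c) * g 0 1)
      ((g 1 0 * b + g 1 1 * c) * g 1 1 - (g 1 0 * a - g 1 1 * b) * g 1 0) := by
  rw [conj_eq]
  ext i j
  fin_cases i <;> fin_cases j <;> simp [trless, Matrix.mul_apply, Fin.sum_univ_two] <;> ring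

/-- `negVec` is equivariant. -/
theorem negVec_moebius (g : SL(2, ℝ)) {z z' : ℂ} (hz : 0 < z.im)
    (h : z' * (g 1 0 * z + g 1 1) = g 0 0 * z + g 0 1) : negVec z' = conj g (negVec z) := by
  have hd := det_eq_one' g
  have hc := conj_trless g (-(z.re * z.im⁻¹)) (z.re ^ 2 * z.im⁻¹ + z.im) (-z.im⁻¹)
  have h1 := congrArg Complex.re h
  have h2 := congrArg Complex.im h
  simp at h1 h2
  set α := g 0 0
  set β := g 0 1
  set γ := g 1 0
  set δ := g 1 1
  have hy : z.im ≠ 0 := hz.ne'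
  set x := z.re
  set y := z.im
  set D := (γ * x + δ) ^ 2 + (γ * y) ^ 2 with hD
  have hyD : z'.im * D = y := by
    rw [hD]
    linear_combination (γ * x + δ) * h2 - γ * y * h1 + y * hd
  have hxD : z'.re * D = (α * x + β) * (γ * x + δ) + α * γ * y ^ 2 := by
    rw [hD]
    linear_combination (γ * x + δ) * h1 + γ * y * h2
  have hy' : z'.im ≠ 0 := fun h0 => hy (by rw [← hyD, h0, zero_mul])
  have hDne : D ≠ 0 := fun h0 => hy (by rw [← hyD, h0, mul_zero])
  have i1 : z'.im⁻¹ = D * y⁻¹ := by rw [← hyD]; field_simp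
  have i2 : z'.re * z'.im⁻¹ = ((α * x + β) * (γ * x + δ) + α * γ * y ^ 2) * y⁻¹ := by
    rw [i1, ← hxD]; ring
  have hN : (z'.re ^ 2 + z'.im ^ 2) * D = (α * x + β) ^ 2 + (α * y) ^ 2 := by
    rw [hD]
    linear_combination (z'.re * (γ * x + δ) - z'.im * γ * y + (α * x + β)) * h1 +
      (z'.re * γ * y + z'.im * (γ * x + δ) + α * y) * h2
  have i3 : z'.re ^ 2 * z'.im⁻¹ + z'.im = ((α * x + β) ^ 2 + (α * y) ^ 2) * y⁻¹ := by
    rw [← hN, mul_assoc, ← i1]; field_simp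
  have hiy : y * y⁻¹ = 1 := mul_inv_cancel₀ hy
  rw [negVec, negVec, conj_smul, hc, i2, i3, i1]
  congr 2
  · linear_combination (-α * γ * y) * hiy
  · linear_combination (α ^ 2 * y) * hiy
  · linear_combination (-γ ^ 2 * y) * hiy

theorem trless_eq_sum (b a c : ℝ) :
    trless b a c = b • trless 1 0 0 + a • trless 0 1 0 + c • trless 0 0 1 := by
  ext i j; fin_cases i <;> fin_cases j <;> simp [trless]

/-- The differential of `negVec`. -/
def negTan (z : ℍ) (ξ : ℂ) : Matrix (Fin 2) (Fin 2) ℝ :=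
  omega z 0 ξ • conj (gMat z) (e 0) + omega z 1 ξ • conj (gMat z) (e 1)

theorem negTan_eq (z : ℍ) (ξ : ℂ) : negTan z ξ = (1 / √2) • trless
    (z.im⁻¹ * ξ.im * (z.re * z.im⁻¹) - z.im⁻¹ * ξ.re)
    (z.im⁻¹ * ξ.im * (z.im - z.re ^ 2 * z.im⁻¹) + z.im⁻¹ * ξ.re * (2 * z.re))
    (z.im⁻¹ * ξ.im * z.im⁻¹) := by
  rw [negTan, e_zero, e_one, conj_smul, conj_smul, conj_gMat, conj_gMat]
  ext i j; fin_cases i <;> fin_cases j <;> simp [trless, omega] <;> ring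

/-- `negVec` is differentiable, tested on linear functionals. -/
theorem hasFDerivAt_negVec (z : ℍ) (μ : Matrix (Fin 2) (Fin 2) ℝ →ₗ[ℝ] ℝ) :
    ∃ D : ℂ →L[ℝ] ℝ, (∀ ξ, D ξ = μ (negTan z ξ)) ∧ HasFDerivAt (fun w => μ (negVec w)) D z := by
  have hr : HasFDerivAt (fun w : ℂ => w.re) Complex.reCLM (z : ℂ) := Complex.reCLM.hasFDerivAt
  have hi : HasFDerivAt (fun w : ℂ => w.im) Complex.imCLM (z : ℂ) := Complex.imCLM.hasFDerivAt
  have hv := (hasDerivAt_inv z.im_pos.ne').comp_hasFDerivAt (z : ℂ) hi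
  obtain ⟨m, n, p, hμ⟩ : ∃ m n p : ℝ, ∀ b a c, μ (trless b a c) = b * m + a * n + c * p :=
    ⟨μ (trless 1 0 0), μ (trless 0 1 0), μ (trless 0 0 1), fun b a c => by
      rw [trless_eq_sum]; simp⟩
  have h := ((((hr.mul hv).neg.mul_const m).add
    ((((hr.pow 2).mul hv).add hi).mul_const n)).add (hv.neg.mul_const p)).const_mul (1 / √2)
  refine ⟨_, fun ξ => ?_, h.congr_of_eventuallyEq (Filter.Eventually.of_forall fun w => ?_)⟩
  · rw [negTan_eq, map_smul, hμ]
    have hz := z.im_pos.ne'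
    simp
    field_simp
    ring
  · beta_reduce
    rw [negVec, map_smul, hμ]
    simp

/-- The coordinates of `g_z⁻¹ X` are, up to the signs of the form, the pairings of `X` with the frame
`g_z e_i`. -/
theorem coord_conj_gMat_inv (z : ℍ) {X : Matrix (Fin 2) (Fin 2) ℝ} (hX : X.trace = 0) (i : Fin 3) :
    sgn i * coord (conj (gMat z)⁻¹ X) i = (X * conj (gMat z) (e i)).trace := by
  rw [← conj_conj_inv (gMat z) X, conj_mul_conj, trace_conj,
    ← sum_sgn_coord _ _ (by rw [trace_conj, hX]) (trace_e i), conj_conj_inv]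
  have h2 : (√2 : ℝ) ≠ 0 := by positivity
  have h22 : (√2 : ℝ) * √2 = 2 := Real.mul_self_sqrt (by norm_num)
  have h : ∀ j, coord (e i) j = if j = i then 1 else 0 := by
    intro j
    fin_cases i <;> fin_cases j <;> simp [e, coord] <;> field_simp <;> norm_num [pow_two, h22]
  simp [h]

/-! ### The primitive of the Schwartz form -/

/-- The function `w ↦ - (X, negVec w)`. At points of the upper half plane it is the `e₃`-coordinate of
`g_w⁻¹ X`; unlike `g_w` it is given by a formula on all of `ℂ`. -/
def sFun (X : Matrix (Fin 2) (Fin 2) ℝ) (w : ℂ) : ℝ := -(X * negVec w).trace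

theorem sFun_coe (z : ℍ) {X : Matrix (Fin 2) (Fin 2) ℝ} (hX : X.trace = 0) :
    sFun X z = coord (conj (gMat z)⁻¹ X) 2 := by
  rw [sFun, ← conj_gMat_e_two, ← coord_conj_gMat_inv z hX]
  simp [sgn]

open Finset.HasAntidiagonal (antidiagonal) in
/-- The primitive of `φ^V_{1,[k]}(X, ·)` before projection to `ℋ_k`. -/
def primPoly (k : ℕ) (X : Matrix (Fin 2) (Fin 2) ℝ) (w : ℂ) : SymV :=
  ∑ ij ∈ antidiagonal k, (k.choose ij.1 : SymV) * ((2 * toSym X) ^ ij.2 *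
    ((psiInt ij.1 (sFun X w) : ℂ) • toSym (-negVec w) ^ ij.1))

/-- A primitive of `φ^V_{1,[k]}(X, ·)`. -/
def prim (k : ℕ) (X : Matrix (Fin 2) (Fin 2) ℝ) (w : ℂ) : Harm k :=
  harmProj k (MvPolynomial.C ((1 / (2 : ℝ) ^ ((k : ℝ) + 1 / 2) *
    (-2 * Real.exp (-Real.pi * (X * X).trace)) : ℝ) : ℂ) * primPoly k X w)

theorem toSym_neg (X : Matrix (Fin 2) (Fin 2) ℝ) : toSym (-X) = -toSym X := by
  rw [← neg_one_smul ℝ X, toSym_smul]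
  simp

theorem exists_linearMap_coord (i : Fin 3) : ∃ μ : Matrix (Fin 2) (Fin 2) ℝ →ₗ[ℝ] ℝ, ∀ X, μ X = coord X i :=
  ⟨{ toFun := fun X => coord X i, map_add' := fun X Y => coord_add X Y i,
     map_smul' := fun a X => coord_smul a X i }, fun _ => rfl⟩

open Finset.HasAntidiagonal (antidiagonal) in
theorem hasWeakFDerivAt_primPoly (k : ℕ) (X : Matrix (Fin 2) (Fin 2) ℝ) (z : ℍ) :
    HasWeakFDerivAt (primPoly k X) (fun ξ => ∑ ij ∈ antidiagonal k, (k.choose ij.1 : SymV) *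
      ((2 * toSym X) ^ ij.2 * ((psiInt ij.1 (sFun X z) : ℂ) •
        ((ij.1 : SymV) * toSym (-negVec z) ^ (ij.1 - 1) * toSym (-negTan z ξ)) +
        ((psi ij.1 (sFun X z) * -(X * negTan z ξ).trace : ℝ) : ℂ) •
          toSym (-negVec z) ^ ij.1))) (z : ℂ) := by
  refine HasWeakFDerivAt.sum _ fun ij _ => HasWeakFDerivAt.const_mul
    (HasWeakFDerivAt.const_mul ?_ _) _
  have hy : ∀ i, ∃ D : ℂ →L[ℝ] ℂ, (∀ ξ, D ξ = (coord (-negTan z ξ) i : ℂ)) ∧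
      HasFDerivAt (fun w : ℂ => (coord (-negVec w) i : ℂ)) D z := by
    intro i
    obtain ⟨μ, hμ⟩ := exists_linearMap_coord i
    obtain ⟨D, hD, h⟩ := hasFDerivAt_negVec z (-μ)
    refine ⟨Complex.ofRealCLM ∘L D, fun ξ => ?_, ?_⟩
    · simp [hD, ← hμ]
    · have := Complex.ofRealCLM.hasFDerivAt.comp (z : ℂ) h
      refine this.congr_of_eventuallyEq (Filter.Eventually.of_forall fun w => ?_)
      simp [← hμ]
  have hp := hasWeakFDerivAt_vecSym_pow (y' := fun ξ i => (coord (-negTan z ξ) i : ℂ)) hy ij.1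
  obtain ⟨D, hD, h⟩ := hasFDerivAt_negVec z
    (-(Matrix.traceLinearMap (Fin 2) ℝ ℝ ∘ₗ LinearMap.mulLeft ℝ X))
  have hs : HasFDerivAt (fun w => (psiInt ij.1 (sFun X w) : ℂ))
      (Complex.ofRealCLM ∘L (psi ij.1 (sFun X z) • D)) (z : ℂ) := by
    have h1 : HasFDerivAt (sFun X) D (z : ℂ) :=
      h.congr_of_eventuallyEq (Filter.Eventually.of_forall fun w => by simp [sFun])
    exact Complex.ofRealCLM.hasFDerivAt.comp (z : ℂ)
      ((hasDerivAt_psiInt ij.1 (sFun X z)).comp_hasFDerivAt (z : ℂ) h1)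
  refine (HasWeakFDerivAt.smul hs hp).congr fun ξ => ?_
  simp [hD, toSym_eq_vecSym]

theorem symAct_toSym_coord (g : SL(2, ℝ)) {X : Matrix (Fin 2) (Fin 2) ℝ} (hX : X.trace = 0) :
    symAct g (vecSym fun i => (coord (conj g⁻¹ X) i : ℂ)) = toSym X := by
  rw [← toSym_eq_vecSym, symAct_toSym _ (by rw [trace_conj, hX]), conj_conj_inv]

theorem trace_mul_self_eq (g : SL(2, ℝ)) {X : Matrix (Fin 2) (Fin 2) ℝ} (hX : X.trace = 0) :
    (X * X).trace = coord (conj g⁻¹ X) 0 ^ 2 + coord (conj g⁻¹ X) 1 ^ 2 -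
      coord (conj g⁻¹ X) 2 ^ 2 := by
  have hX' : (conj g⁻¹ X).trace = 0 := by rw [trace_conj, hX]
  rw [← trace_conj g⁻¹, ← conj_mul_conj, ← sum_sgn_coord _ _ hX' hX', Fin.sum_univ_three]
  simp [sgn]
  ring

theorem trace_mul_negTan (z : ℍ) (ξ : ℂ) {X : Matrix (Fin 2) (Fin 2) ℝ} (hX : X.trace = 0) :
    (X * negTan z ξ).trace = coord (conj (gMat z)⁻¹ X) 0 * omega z 0 ξ +
      coord (conj (gMat z)⁻¹ X) 1 * omega z 1 ξ := by
  have h0 := coord_conj_gMat_inv z hX 0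
  have h1 := coord_conj_gMat_inv z hX 1
  have s0 : sgn 0 = 1 := rfl
  have s1 : sgn 1 = 1 := rfl
  rw [s0, one_mul] at h0
  rw [s1, one_mul] at h1
  rw [negTan, mul_add, Matrix.trace_add, mul_smul_comm, mul_smul_comm, Matrix.trace_smul,
    Matrix.trace_smul, ← h0, ← h1, smul_eq_mul, smul_eq_mul]
  ring

open Finset.HasAntidiagonal (antidiagonal) in
theorem symAct_howeDiff (k : ℕ) {X : Matrix (Fin 2) (Fin 2) ℝ} (hX : X.trace = 0) (z : ℍ) (ξ : ℂ) :
    symAct (gMat z) (howeDiff k (coord (conj (gMat z)⁻¹ X)) fun α => omega z α ξ) =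
      MvPolynomial.C ((-2 * Real.exp (-Real.pi * (X * X).trace) : ℝ) : ℂ) *
        ∑ ij ∈ antidiagonal k, (k.choose ij.1 : SymV) *
          ((2 * toSym X) ^ ij.2 * ((psiInt ij.1 (sFun X z) : ℂ) •
            ((ij.1 : SymV) * toSym (-negVec z) ^ (ij.1 - 1) * toSym (-negTan z ξ)) +
            ((psi ij.1 (sFun X z) * -(X * negTan z ξ).trace : ℝ) : ℂ) •
              toSym (-negVec z) ^ ij.1)) := by
  have hC : ∀ a : ℂ, symAct (gMat z) (MvPolynomial.C a) = MvPolynomial.C a := fun a => by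
    simp [symAct]
  have hE : ∀ i, symAct (gMat z) (MvPolynomial.X i) = toSym (conj (gMat z) (e i)) := fun i => by
    simp [symAct]
  have hT : toSym (-negTan z ξ) = -(MvPolynomial.C (omega z 0 ξ : ℂ) * toSym (conj (gMat z) (e 0)) +
      MvPolynomial.C (omega z 1 ξ : ℂ) * toSym (conj (gMat z) (e 1))) := by
    rw [toSym_neg, negTan, toSym_add, toSym_smul, toSym_smul]
  unfold howeDiff
  rw [map_mul, hC, ← trace_mul_self_eq _ hX, map_sum]
  congr 1
  refine Finset.sum_congr rfl fun ij _ => ?_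
  rw [trace_mul_negTan z ξ hX, sFun_coe z hX, hT, toSym_neg, ← conj_gMat_e_two]
  simp only [map_mul, map_add, map_neg, map_pow, map_natCast, map_ofNat, hC, hE,
    symAct_toSym_coord _ hX, MvPolynomial.smul_eq_C_mul]
  ring

theorem phiV_apply (k : ℕ) (X : Matrix (Fin 2) (Fin 2) ℝ) (z : ℍ) (ξ : Fin 1 → ℂ) :
    phiV k X z ξ = (1 / (2 : ℝ) ^ ((k : ℝ) + 1 / 2)) • ∑ α : Fin 2, ∑ β : Fin k → Fin 2,
      (howeGauss α β (coord (conj (gMat z)⁻¹ X)) * omega z α (ξ 0)) •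
        rho k (gMat z) (harmProj k (∏ i, MvPolynomial.X (β i).castSucc)) := by
  simp only [phiV, oneForm, ContinuousAlternatingMap.smul_apply, ContinuousAlternatingMap.sum_apply,
    mul_smul]
  rfl

/-- `prim k X` is a primitive of the Schwartz form `φ^V_{1,[k]}(X, ·)` on the upper half plane. -/
theorem hasFDerivAt_prim (k : ℕ) {X : Matrix (Fin 2) (Fin 2) ℝ} (hX : X.trace = 0) (z : ℍ) :
    HasFDerivAt (prim k X) ((ContinuousAlternatingMap.ofSubsingleton ℝ ℂ (Harm k) 0).symm
      (phiV k X z)) (z : ℂ) := by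
  refine ((hasWeakFDerivAt_primPoly k X z).const_mul _).hasFDerivAt (harmProjL k)
    (fun w => rfl) fun ξ => ?_
  have h := symAct_howeDiff k hX z ξ
  rw [Complex.ofReal_mul, MvPolynomial.C_mul, mul_assoc]
  rw [← h, ← MvPolynomial.smul_eq_C_mul, map_smul, harmProjL_apply,
    harmProj_symAct _ (howeDiff_isHomogeneous _ _ _), ← harmProj_congr (howeSum_isHomogeneous _ _ _)
      (howeDiff_isHomogeneous _ _ _) (rSq_dvd_howe_sub _ _ _), howeSum, ← harmProjL_apply, map_sum,
      map_sum]
  simp only [map_sum, ← MvPolynomial.smul_eq_C_mul, map_smul]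
  simp only [harmProjL_apply, Complex.coe_smul]
  exact phiV_apply k X z fun _ => ξ

/-- Equivariance of the primitives. -/
theorem prim_moebius (k : ℕ) (g : SL(2, ℝ)) {X : Matrix (Fin 2) (Fin 2) ℝ} (hX : X.trace = 0)
    {z z' : ℂ} (hz : 0 < z.im) (h : z' * (g 1 0 * z + g 1 1) = g 0 0 * z + g 0 1) :
    prim k X z' = rho k g (prim k (conj g⁻¹ X) z) := by
  have hX' : (conj g⁻¹ X).trace = 0 := by rw [trace_conj, hX]
  have hN := negVec_moebius g hz h
  have hs : sFun X z' = sFun (conj g⁻¹ X) z := by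
    rw [sFun, sFun, hN, ← trace_conj g⁻¹, ← conj_mul_conj, conj_inv_conj]
  have ht : (X * X).trace = (conj g⁻¹ X * conj g⁻¹ X).trace := by
    rw [conj_mul_conj, trace_conj]
  have hXs : symAct g (toSym (conj g⁻¹ X)) = toSym X := by rw [symAct_toSym _ hX', conj_conj_inv]
  have hNs : symAct g (toSym (-negVec z)) = toSym (-negVec z') := by
    rw [toSym_neg, map_neg, symAct_toSym _ (trace_negVec z), hN, toSym_neg]
  have hC : ∀ a : ℂ, symAct g (MvPolynomial.C a) = MvPolynomial.C a := fun a => by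
    simp [symAct]
  have h2 : (2 * toSym (conj g⁻¹ X)).IsHomogeneous 1 := by
    have := isHomogeneous_natCast_mul 2 (vecSym_isHomogeneous fun i => (coord (conj g⁻¹ X) i : ℂ))
    exact_mod_cast this
  have hN1 : (toSym (-negVec z)).IsHomogeneous 1 := vecSym_isHomogeneous _
  rw [prim, prim, ← harmProj_symAct]
  · congr 1
    rw [map_mul, hC, ht, primPoly, primPoly, map_sum]
    congr 1
    refine Finset.sum_congr rfl fun ij _ => ?_
    rw [map_mul, map_mul, map_smul, map_pow, map_pow, map_mul, hXs, hNs, hs, map_natCast,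
      map_ofNat]
  · refine isHomogeneous_C_mul _ (MvPolynomial.IsHomogeneous.sum _ _ _ fun ij hij => ?_)
    rw [Finset.HasAntidiagonal.mem_antidiagonal] at hij
    rw [MvPolynomial.smul_eq_C_mul]
    have h' := (h2.pow ij.2).mul (isHomogeneous_C_mul (psiInt ij.1 (sFun (conj g⁻¹ X) z) : ℂ)
      (hN1.pow ij.1))
    rw [show 1 * ij.2 + 1 * ij.1 = k by omega] at h'
    exact isHomogeneous_natCast_mul _ h'

/-! ### Pullback to the charts -/

theorem chartPt_one (q : ℝ × ℝ) : chartPt 1 q = q.1 + Complex.I / q.2 := by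
  simp [chartPt]

theorem chartPt_one_re (q : ℝ × ℝ) : (chartPt 1 q).re = q.1 := by
  rw [chartPt_one, Complex.add_re, Complex.div_ofReal_re]
  simp

theorem chartPt_one_im (q : ℝ × ℝ) : (chartPt 1 q).im = q.2⁻¹ := by
  rw [chartPt_one, Complex.add_im, Complex.div_ofReal_im]
  simp

theorem chartPt_eq (σ : SL(2, ℤ)) (q : ℝ × ℝ) : chartPt σ q =
    ((σ 0 0 : ℂ) * chartPt 1 q + σ 0 1) / ((σ 1 0 : ℂ) * chartPt 1 q + σ 1 1) := by
  rw [chartPt_one, chartPt]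

theorem hasFDerivAt_chartPt_one {q : ℝ × ℝ} (hq : 0 < q.2) :
    ∃ D : ℝ × ℝ →L[ℝ] ℂ, (∀ ξ, D ξ = ξ.1 - Complex.I * ((q.2⁻¹ ^ 2 * ξ.2 : ℝ) : ℂ)) ∧
      HasFDerivAt (chartPt 1) D q := by
  have h1 : HasFDerivAt (fun q : ℝ × ℝ => (q.1 : ℂ))
      (Complex.ofRealCLM ∘L ContinuousLinearMap.fst ℝ ℝ ℝ) q :=
    Complex.ofRealCLM.hasFDerivAt.comp q hasFDerivAt_fst
  have h2 := Complex.ofRealCLM.hasFDerivAt.comp q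
    ((hasDerivAt_inv hq.ne').comp_hasFDerivAt q (hasFDerivAt_snd (𝕜 := ℝ) (E := ℝ) (F := ℝ)))
  refine ⟨_, fun ξ => ?_, (h1.add (h2.const_mul Complex.I)).congr_of_eventuallyEq
    (Filter.Eventually.of_forall fun q => ?_)⟩
  · simp
    ring
  · rw [chartPt_one]
    simp [div_eq_mul_inv]

theorem denom_ne_zero' (σ : SL(2, ℤ)) {z : ℂ} (hz : 0 < z.im) : (σ 1 0 : ℂ) * z + σ 1 1 ≠ 0 := by
  have := denom_ne_zero (σ : GL (Fin 2) ℝ) ⟨z, hz⟩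
  simpa [denom] using this

theorem chartPt_mul_denom (σ : SL(2, ℤ)) {q : ℝ × ℝ} (hq : 0 < q.2) :
    chartPt σ q * (((σ : SL(2, ℝ)) 1 0 : ℝ) * chartPt 1 q + ((σ : SL(2, ℝ)) 1 1 : ℝ)) =
      ((σ : SL(2, ℝ)) 0 0 : ℝ) * chartPt 1 q + ((σ : SL(2, ℝ)) 0 1 : ℝ) := by
  have := denom_ne_zero' σ (z := chartPt 1 q) (by rw [chartPt_one_im]; positivity)
  rw [chartPt_eq σ]
  exact div_mul_cancel₀ _ this

theorem chartPt_im_pos (σ : SL(2, ℤ)) {q : ℝ × ℝ} (hq : 0 < q.2) : 0 < (chartPt σ q).im := by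
  have hz : 0 < (chartPt 1 q).im := by rw [chartPt_one_im]; positivity
  have h := coe_specialLinearGroup_apply σ ⟨chartPt 1 q, hz⟩
  have h2 : chartPt σ q = ↑(σ • (⟨chartPt 1 q, hz⟩ : ℍ)) := by
    rw [h, chartPt_eq σ]; simp
  rw [h2]
  exact (σ • (⟨chartPt 1 q, hz⟩ : ℍ)).im_pos

theorem differentiableAt_chartPt (σ : SL(2, ℤ)) {q : ℝ × ℝ} (hq : 0 < q.2) :
    DifferentiableAt ℝ (chartPt σ) q := by
  obtain ⟨D, -, hD⟩ := hasFDerivAt_chartPt_one hq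
  have h1 := hD.differentiableAt
  have : chartPt σ = fun q => ((σ 0 0 : ℂ) * chartPt 1 q + σ 0 1) *
      ((σ 1 0 : ℂ) * chartPt 1 q + σ 1 1)⁻¹ := funext (chartPt_eq σ)
  rw [this]
  exact ((h1.const_mul _).add_const _).mul (((h1.const_mul _).add_const _).inv
    (denom_ne_zero' σ (by rw [chartPt_one_im]; positivity)))

/-- The pullback of `φ^V_{1,[k]}(X, ·)` to the chart `σ`. -/
def chartForm (k : ℕ) (σ : SL(2, ℤ)) (X : Matrix (Fin 2) (Fin 2) ℝ) (q : ℝ × ℝ) :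
    (ℝ × ℝ) [⋀^Fin 1]→L[ℝ] Harm k :=
  (phiV k X (ofComplex (chartPt σ q))).compContinuousLinearMap (fderiv ℝ (chartPt σ) q)

theorem hasFDerivAt_prim_chartPt (k : ℕ) (σ : SL(2, ℤ)) {X : Matrix (Fin 2) (Fin 2) ℝ}
    (hX : X.trace = 0) {q : ℝ × ℝ} (hq : 0 < q.2) :
    HasFDerivAt (fun q => prim k X (chartPt σ q))
      ((ContinuousAlternatingMap.ofSubsingleton ℝ (ℝ × ℝ) (Harm k) 0).symm (chartForm k σ X q)) q := by
  have h := hasFDerivAt_prim k hX (ofComplex (chartPt σ q))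
  rw [ofComplex_apply_of_im_pos (chartPt_im_pos σ hq)] at h
  have h' := HasFDerivAt.comp q h (differentiableAt_chartPt σ hq).hasFDerivAt
  refine h'.congr_fderiv ?_
  rw [chartForm, ofComplex_apply_of_im_pos (chartPt_im_pos σ hq)]
  rfl

/-- The pullbacks to the chart `σ` and to the standard chart. -/
theorem chartForm_eq (k : ℕ) (σ : SL(2, ℤ)) {X : Matrix (Fin 2) (Fin 2) ℝ}
    (hX : X.trace = 0) {q : ℝ × ℝ} (hq : 0 < q.2) (ξ : Fin 1 → ℝ × ℝ) :
    chartForm k σ X q ξ = rho k (σ : SL(2, ℝ)) (chartForm k 1 (conj (σ : SL(2, ℝ))⁻¹ X) q ξ) := by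
  have h1 := hasFDerivAt_prim_chartPt k σ hX hq
  have hX' : (conj (σ : SL(2, ℝ))⁻¹ X).trace = 0 := by rw [trace_conj, hX]
  have h2 := hasFDerivAt_prim_chartPt k 1 hX' hq
  let R : Harm k →L[ℝ] Harm k := (rho k (σ : SL(2, ℝ))).restrictScalars ℝ |>.toContinuousLinearMap
  have h3 := R.hasFDerivAt.comp q h2
  have h4 : (fun q => prim k X (chartPt σ q)) =ᶠ[𝓝 q]
      R ∘ fun q => prim k (conj (σ : SL(2, ℝ))⁻¹ X) (chartPt 1 q) := by
    filter_upwards [(isOpen_lt continuous_const continuous_snd).mem_nhds hq] with q' hq'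
    exact prim_moebius k _ hX (by rw [chartPt_one_im]; exact inv_pos.2 hq') (chartPt_mul_denom σ hq')
  have h5 := (h3.congr_of_eventuallyEq h4).unique h1
  have h6 := DFunLike.congr_fun h5 (ξ 0)
  have hξ : ξ = fun _ => ξ 0 := funext fun i => by rw [Subsingleton.elim i 0]
  rw [hξ]
  exact h6.symm

/-! ### The Schwartz form in the standard chart -/

theorem coord_trless (b a c : ℝ) :
    coord (trless b a c) = ![(a + c) / √2, √2 * b, (a - c) / √2] := by
  have h2 : (√2 : ℝ) ≠ 0 := by positivity
  have h22 : (√2 : ℝ) ^ 2 = 2 := Real.sq_sqrt (by norm_num)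
  ext i
  fin_cases i <;> simp [coord, trless]
  field_simp
  rw [h22]; ring

/-- The coefficients of the matrix of `g_z`, `z = x + i / t`, are polynomials in `x, t, t⁻¹`. -/
theorem exists_poly_adMat_gMat : ∃ A : Fin 3 → Fin 3 → Poly6, ∀ (par : Fin 3 → ℝ) (q : ℝ × ℝ) (z : ℍ),
    0 < q.2 → z.re = q.1 → z.im = q.2⁻¹ →
    ∀ i j, (adMat (gMat z) i j : ℂ) = MvPolynomial.eval (evalPt par q) (A i j) := by
  have h2 : (√2 : ℝ) ≠ 0 := by positivity
  have h22 : (√2 : ℝ) ^ 2 = 2 := Real.sq_sqrt (by norm_num)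
  have key : ∀ j : Fin 3, ∃ pb pa pc : Poly6, ∀ (par : Fin 3 → ℝ) (q : ℝ × ℝ) (z : ℍ),
      0 < q.2 → z.re = q.1 → z.im = q.2⁻¹ → ∃ b a c : ℝ,
        conj (gMat z) (e j) = (1 / √2) • trless b a c ∧
        (b : ℂ) = MvPolynomial.eval (evalPt par q) pb ∧
        (a : ℂ) = MvPolynomial.eval (evalPt par q) pa ∧
        (c : ℂ) = MvPolynomial.eval (evalPt par q) pc := by
    intro j
    fin_cases j
    · refine ⟨MvPolynomial.X 0 * MvPolynomial.X 1,
        MvPolynomial.X 2 - MvPolynomial.X 0 ^ 2 * MvPolynomial.X 1, MvPolynomial.X 1,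
        fun par q z hq hr hi => ⟨q.1 * q.2, q.2⁻¹ - q.1 ^ 2 * q.2, q.2, ?_, ?_⟩⟩
      · change conj (gMat z) (e 0) = _
        rw [e_zero, conj_smul, conj_gMat, hr, hi, inv_inv]
        congr 2 <;> ring
      · simp [evalPt]
    · refine ⟨1, -2 * MvPolynomial.X 0, 0, fun par q z hq hr hi => ⟨1, -2 * q.1, 0, ?_, ?_⟩⟩
      · change conj (gMat z) (e 1) = _
        rw [e_one, conj_smul, conj_gMat, hr, hi, inv_inv]
        congr 2 <;> ring
      · simp [evalPt]
    · refine ⟨-(MvPolynomial.X 0 * MvPolynomial.X 1),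
        MvPolynomial.X 2 + MvPolynomial.X 0 ^ 2 * MvPolynomial.X 1, -MvPolynomial.X 1,
        fun par q z hq hr hi => ⟨-(q.1 * q.2), q.2⁻¹ + q.1 ^ 2 * q.2, -q.2, ?_, ?_⟩⟩
      · change conj (gMat z) (e 2) = _
        rw [e_two, conj_smul, conj_gMat, hr, hi, inv_inv]
        congr 2 <;> ring
      · simp [evalPt]
  choose pb pa pc h using key
  refine ⟨fun i j => ![MvPolynomial.C (1 / 2) * (pa j + pc j), pb j,
    MvPolynomial.C (1 / 2) * (pa j - pc j)] i, fun par q z hq hr hi i j => ?_⟩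
  obtain ⟨b, a, c, h1, hb, ha, hc⟩ := h j par q z hq hr hi
  have hh : (1 / √2) * (1 / √2) = 1 / 2 := by field_simp; rw [h22]
  rw [adMat, h1, coord_smul, coord_trless]
  fin_cases i
  · have : 1 / √2 * ((a + c) / √2) = 1 / 2 * (a + c) := by rw [← hh]; ring
    simp [-one_div, this, ← ha, ← hc]
  · have : 1 / √2 * (√2 * b) = b := by field_simp
    simp [-one_div, this, ← hb]
  · have : 1 / √2 * ((a - c) / √2) = 1 / 2 * (a - c) := by rw [← hh]; ring
    simp [-one_div, this, ← ha, ← hc]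

theorem exists_poly_rho_gMat {k : ℕ} (v : Harm k) :
    ∃ r : Fin (Module.finrank ℂ (Harm k)) → Poly6, ∀ (par : Fin 3 → ℝ) (q : ℝ × ℝ) (z : ℍ),
      0 < q.2 → z.re = q.1 → z.im = q.2⁻¹ → rho k (gMat z) v =
        ∑ m, MvPolynomial.eval (evalPt par q) (r m) • Module.finBasis ℂ (Harm k) m := by
  obtain ⟨A, hA⟩ := exists_poly_adMat_gMat
  obtain ⟨r, hr⟩ := exists_poly_rho A v
  exact ⟨r, fun par q z hq h1 h2 => hr _ _ (hA par q z hq h1 h2)⟩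

theorem exists_nMat_eq_gMat (x : ℝ) : ∃ z : ℍ, z.re = x ∧ z.im = 1 ∧ nMat x = gMat z := by
  have h : aMat √1 = 1 := by
    have h1 : aMat √1 = ⟨!![√1, 0; 0, (√1)⁻¹], by simp⟩ := dif_pos (by simp)
    rw [h1]
    ext i j; fin_cases i <;> fin_cases j <;> simp
  obtain ⟨z, hr, hi⟩ : ∃ z : ℍ, z.re = x ∧ z.im = 1 :=
    ⟨⟨⟨x, 1⟩, one_pos⟩, rfl, rfl⟩
  exact ⟨z, hr, hi, by rw [gMat, hi, hr, h, mul_one]⟩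

/-- The torus part of `g_z` fixes `e₂`, so `g_z π_k(e₂^k)` is independent of `y`. -/
theorem rho_gMat_pow (k : ℕ) (z : ℍ) : rho k (gMat z) (harmProj k (MvPolynomial.X 1 ^ k)) =
    rho k (nMat z.re) (harmProj k (MvPolynomial.X 1 ^ k)) := by
  have hX : (MvPolynomial.X 1 ^ k : SymV).IsHomogeneous k := by
    simpa using (MvPolynomial.isHomogeneous_X ℂ (1 : Fin 3)).pow k
  rw [← harmProj_symAct _ hX, ← harmProj_symAct _ hX]
  obtain ⟨z', hr, -, h'⟩ := exists_nMat_eq_gMat z.re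
  have h : ∀ z : ℍ, symAct (gMat z) (MvPolynomial.X 1) =
      toSym ((1 / √2) • trless 1 (-2 * z.re) 0) := fun z => by
    have : symAct (gMat z) (MvPolynomial.X 1) = toSym (conj (gMat z) (e 1)) := by simp [symAct]
    rw [this, e_one, conj_smul, conj_gMat]
    congr 3 <;> ring
  rw [map_pow, map_pow, h', h, h, hr]

theorem contDiff_rho_nMat {k : ℕ} (v : Harm k) : ContDiff ℝ ∞ fun x => rho k (nMat x) v := by
  obtain ⟨r, hr⟩ := exists_poly_rho_gMat v
  have h : (fun x => rho k (nMat x) v) = fun x : ℝ =>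
      ∑ m, MvPolynomial.eval (evalPt 0 (x, 1)) (r m) • Module.finBasis ℂ (Harm k) m := by
    funext x
    obtain ⟨z, h1, h2, h3⟩ := exists_nMat_eq_gMat x
    rw [h3, hr 0 (x, 1) z (by simp) h1 (by simpa using h2)]
  rw [h]
  refine ContDiff.sum fun m _ => ContDiff.fun_smul ?_ contDiff_const
  induction r m using MvPolynomial.induction_on with
  | C a => simpa using contDiff_const
  | add p q hp hq => simpa using hp.add hq
  | mul_X p i hp =>
    simp only [map_mul, MvPolynomial.eval_X]
    refine hp.mul ?_
    fin_cases i <;> simp [evalPt] <;> first | exact contDiff_const | exact Complex.ofRealCLM.contDiff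

/-- The Schwartz form in the standard chart, and the sum of the contributions to it that do not
involve the variable `x₁` (these are the ones with all operators in the direction of `e₂`). -/
theorem exists_chartForm_expansion (k : ℕ) : ∃ (d : ℕ) (n₀ n₁ : Fin d → ℕ) (P : Fin d → Poly6)
    (F : Fin d → (ℝ × ℝ) [⋀^Fin 1]→L[ℝ] Harm k),
    (∀ (par : Fin 3 → ℝ) (q : ℝ × ℝ) (j : Fin d),
      MvPolynomial.eval (evalPt par q) (P j) = MvPolynomial.eval (evalPt 0 q) (P j)) ∧
    (∀ (par : Fin 3 → ℝ) (q : ℝ × ℝ), 0 < q.2 → ∀ b a c : ℝ,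
      chartForm k 1 (trless b a c) q = ∑ j, (MvPolynomial.eval (evalPt par q) (P j) *
        (((herm (n₀ j)).eval
            ((q.2 * (a + 2 * q.1 * b - q.1 ^ 2 * c) + q.2⁻¹ * c) / √2) *
          (herm (n₁ j)).eval (√2 * (b - q.1 * c)) *
          Real.exp (-Real.pi * ((q.2 * (a + 2 * q.1 * b - q.1 ^ 2 * c)) ^ 2 + (q.2⁻¹ * c) ^ 2 +
            2 * (b - q.1 * c) ^ 2)) : ℝ) : ℂ)) • F j) ∧
    (∀ (par : Fin 3 → ℝ) (q : ℝ × ℝ), 0 < q.2 → ∀ y : ℝ,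
      ∑ j, (if n₀ j = 0 then MvPolynomial.eval (evalPt par q) (P j) * (q.2⁻¹ : ℝ) *
        ((herm (n₁ j)).eval y : ℝ) else 0) • F j =
      (-(1 / (2 : ℝ) ^ ((k : ℝ) + 1 / 2)) * (herm (k + 1)).eval y) •
        oneForm (ContinuousLinearMap.fst ℝ ℝ ℝ)
          (rho k (nMat q.1) (harmProj k (MvPolynomial.X 1 ^ k)))) := by
  choose r hr using fun β : Fin k → Fin 2 =>
    exists_poly_rho_gMat (harmProj k (∏ i, MvPolynomial.X (R := ℂ) (β i).castSucc))
  let J := Fin 2 × (Fin k → Fin 2) × Fin (Module.finrank ℂ (Harm k))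
  let cst : ℂ := ((1 / (2 : ℝ) ^ ((k : ℝ) + 1 / 2) : ℝ) : ℂ)
  let n₀ : J → ℕ := fun j => (j.1 :: List.ofFn j.2.1).count 0
  let n₁ : J → ℕ := fun j => (j.1 :: List.ofFn j.2.1).count 1
  let P : J → Poly6 := fun j => MvPolynomial.C cst *
    (if j.1 = 0 then -MvPolynomial.X 2 else -MvPolynomial.X 1) * r j.2.1 j.2.2
  let F : J → (ℝ × ℝ) [⋀^Fin 1]→L[ℝ] Harm k := fun j =>
    oneForm (if j.1 = 0 then ContinuousLinearMap.snd ℝ ℝ ℝ else ContinuousLinearMap.fst ℝ ℝ ℝ)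
      (Module.finBasis ℂ (Harm k) j.2.2)
  suffices h : (∀ (par : Fin 3 → ℝ) (q : ℝ × ℝ), 0 < q.2 → ∀ b a c : ℝ,
      chartForm k 1 (trless b a c) q = ∑ j, (MvPolynomial.eval (evalPt par q) (P j) *
        (((herm (n₀ j)).eval
            ((q.2 * (a + 2 * q.1 * b - q.1 ^ 2 * c) + q.2⁻¹ * c) / √2) *
          (herm (n₁ j)).eval (√2 * (b - q.1 * c)) *
          Real.exp (-Real.pi * ((q.2 * (a + 2 * q.1 * b - q.1 ^ 2 * c)) ^ 2 + (q.2⁻¹ * c) ^ 2 +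
            2 * (b - q.1 * c) ^ 2)) : ℝ) : ℂ)) • F j) ∧
    (∀ (par : Fin 3 → ℝ) (q : ℝ × ℝ), 0 < q.2 → ∀ y : ℝ,
      ∑ j, (if n₀ j = 0 then MvPolynomial.eval (evalPt par q) (P j) * (q.2⁻¹ : ℝ) *
        ((herm (n₁ j)).eval y : ℝ) else 0) • F j =
      (-(1 / (2 : ℝ) ^ ((k : ℝ) + 1 / 2)) * (herm (k + 1)).eval y) •
        oneForm (ContinuousLinearMap.fst ℝ ℝ ℝ)
          (rho k (nMat q.1) (harmProj k (MvPolynomial.X 1 ^ k)))) by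
    let e := (Fintype.equivFin J).symm
    -- on the given points the coefficients do not involve the lattice variables; setting these to
    -- zero makes them independent of them as polynomials
    let kill : Poly6 →ₐ[ℂ] Poly6 := MvPolynomial.bind₁
      ![MvPolynomial.X 0, MvPolynomial.X 1, MvPolynomial.X 2, 0, 0, 0]
    have hk : ∀ (par : Fin 3 → ℝ) (q : ℝ × ℝ) (p : Poly6),
        MvPolynomial.eval (evalPt par q) (kill p) = MvPolynomial.eval (evalPt 0 q) p := by
      intro par q p
      simp only [kill, MvPolynomial.eval, MvPolynomial.eval₂Hom_bind₁]
      congr 2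
      funext i
      fin_cases i <;> simp [evalPt]
    refine ⟨Fintype.card J, n₀ ∘ e, n₁ ∘ e, fun j => kill (P (e j)), F ∘ e, fun par q j => ?_,
      fun par q hq b a c => ?_, fun par q hq y => ?_⟩
    · rw [hk, hk]
    · simp only [hk]
      rw [h.1 0 q hq b a c, ← e.sum_comp]
      rfl
    · simp only [hk]
      rw [← h.2 0 q hq y, ← e.sum_comp]
      rfl
  have hz : ∀ q : ℝ × ℝ, 0 < q.2 → (ofComplex (chartPt 1 q)).re = q.1 ∧
      (ofComplex (chartPt 1 q)).im = q.2⁻¹ := fun q hq => by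
    rw [ofComplex_apply_of_im_pos (chartPt_im_pos 1 hq)]
    exact ⟨chartPt_one_re q, chartPt_one_im q⟩
  refine ⟨fun par q hq b a c => ?_, fun par q hq y => ?_⟩
  · obtain ⟨h1, h2⟩ := hz q hq
    obtain ⟨D, hD, hD'⟩ := hasFDerivAt_chartPt_one hq
    ext1 ξ
    rw [chartForm, hD'.fderiv, ContinuousAlternatingMap.compContinuousLinearMap_apply, phiV_apply,
      Function.comp]
    generalize ofComplex (chartPt 1 q) = z at *
    have ho : ∀ α : Fin 2, omega z α (D (ξ 0)) =
        (if α = 0 then -q.2⁻¹ * (ξ 0).2 else -q.2 * (ξ 0).1) := by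
      intro α
      have hre : (D (ξ 0)).re = (ξ 0).1 := by
        rw [hD, Complex.sub_re, Complex.I_mul_re, Complex.ofReal_re, Complex.ofReal_im]; simp
      have him : (D (ξ 0)).im = -(q.2⁻¹ ^ 2 * (ξ 0).2) := by
        rw [hD, Complex.sub_im, Complex.I_mul_im, Complex.ofReal_re, Complex.ofReal_im]; simp
      fin_cases α
      · simp [omega, him, h2]
        field_simp
      · simp [omega, hre, h2]
    have hF : ∀ j, F j ξ = ((if j.1 = 0 then (ξ 0).2 else (ξ 0).1 : ℝ) : ℂ) •
        Module.finBasis ℂ (Harm k) j.2.2 := by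
      rintro ⟨α, β, m⟩
      rw [Complex.coe_smul]
      fin_cases α <;> rfl
    have hg : gauss ![((a + 2 * z.re * b - z.re ^ 2 * c) * z.im⁻¹ + z.im * c) / √2,
        √2 * (b - z.re * c), ((a + 2 * z.re * b - z.re ^ 2 * c) * z.im⁻¹ - z.im * c) / √2] =
        Real.exp (-Real.pi * ((q.2 * (a + 2 * q.1 * b - q.1 ^ 2 * c)) ^ 2 + (q.2⁻¹ * c) ^ 2 +
            2 * (b - q.1 * c) ^ 2)) := by
      rw [gauss, h1, h2, inv_inv, Fin.sum_univ_three]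
      have h22 : (√2 : ℝ) ^ 2 = 2 := Real.sq_sqrt (by norm_num)
      simp only [Matrix.cons_val_zero, Matrix.cons_val_one, Matrix.cons_val, div_pow, mul_pow, h22]
      congr 1
      ring
    simp only [conj_gMat_inv, coord_trless, howeGauss_eq, hr _ par q z hq h1 h2, Finset.smul_sum,
      ContinuousAlternatingMap.sum_apply, ContinuousAlternatingMap.smul_apply,
      Fintype.sum_prod_type, J, hF, hg, ho]
    refine Finset.sum_congr rfl fun α _ => Finset.sum_congr rfl fun β _ =>
      Finset.sum_congr rfl fun m _ => ?_
    simp only [← Complex.coe_smul, smul_smul]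
    congr 1
    have hx : (a + 2 * q.1 * b - q.1 ^ 2 * c) * q.2 + q.2⁻¹ * c =
        q.2 * (a + 2 * q.1 * b - q.1 ^ 2 * c) + q.2⁻¹ * c := by ring
    simp only [Matrix.cons_val_zero, Matrix.cons_val_one, h1, h2, inv_inv, hx, P, n₀, n₁, cst]
    fin_cases α
    · simp [evalPt]
      ring
    · simp [evalPt]
      ring
  · obtain ⟨h1, h2⟩ := hz q hq
    generalize ofComplex (chartPt 1 q) = z at *
    -- the only word without the letter `e₁` is `e₂^{k+1}`
    have hcount : ∀ (α : Fin 2) (β : Fin k → Fin 2), (α :: List.ofFn β).count 0 = 0 →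
        α = 1 ∧ β = fun _ => 1 := by
      intro α β h
      rw [List.count_eq_zero] at h
      have h01 : ∀ x : Fin 2, 0 ≠ x → x = 1 := by decide
      refine ⟨h01 _ fun h0 => h (by simp [h0]), funext fun i => h01 _ fun h0 => h ?_⟩
      rw [h0]
      exact List.mem_cons_of_mem _ (List.mem_ofFn.2 ⟨i, rfl⟩)
    have hc0 : ((1 : Fin 2) :: List.ofFn fun _ : Fin k => (1 : Fin 2)).count 0 = 0 := by
      rw [List.count_eq_zero]
      simp
    have hc1 : ((1 : Fin 2) :: List.ofFn fun _ : Fin k => (1 : Fin 2)).count 1 = k + 1 := by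
      have := count_add_count ((1 : Fin 2) :: List.ofFn fun _ : Fin k => (1 : Fin 2))
      rw [hc0, zero_add] at this
      rw [this]
      simp
    ext1 ξ
    have hF : ∀ β m, F (1, β, m) ξ = (((ξ 0).1 : ℝ) : ℂ) • Module.finBasis ℂ (Harm k) m := by
      intro β m
      rw [Complex.coe_smul]
      rfl
    have hR : oneForm (ContinuousLinearMap.fst ℝ ℝ ℝ)
        (rho k (nMat q.1) (harmProj k (MvPolynomial.X 1 ^ k))) ξ = (((ξ 0).1 : ℝ) : ℂ) •
        ∑ m, MvPolynomial.eval (evalPt par q) (r (fun _ => 1) m) • Module.finBasis ℂ (Harm k) m := by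
      rw [← hr _ par q z hq h1 h2, Finset.prod_const, Finset.card_univ, Fintype.card_fin,
        Fin.castSucc_one, rho_gMat_pow, h1, Complex.coe_smul]
      rfl
    rw [ContinuousAlternatingMap.sum_apply, Fintype.sum_prod_type, Fin.sum_univ_two,
      Fintype.sum_prod_type, Fintype.sum_prod_type,
      Finset.sum_eq_zero (s := Finset.univ) (f := fun β : Fin k → Fin 2 => _), zero_add,
      Finset.sum_eq_single (fun _ => 1)]
    · rw [ContinuousAlternatingMap.smul_apply, hR, ← Complex.coe_smul, smul_smul, Finset.smul_sum]
      refine Finset.sum_congr rfl fun m _ => ?_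
      have hq' : (q.2 : ℂ) ≠ 0 := by exact_mod_cast hq.ne'
      rw [ContinuousAlternatingMap.smul_apply, if_pos hc0, hF, smul_smul, smul_smul]
      congr 1
      simp only [n₁, hc1, P, cst, map_mul, MvPolynomial.eval_C]
      simp [evalPt]
      field_simp
    · intro β _ hβ
      refine Finset.sum_eq_zero fun m _ => ?_
      rw [if_neg fun h => hβ (hcount _ _ h).2, zero_smul]
      rfl
    · simp
    · intro β _
      refine Finset.sum_eq_zero fun m _ => ?_
      rw [if_neg fun h => absurd (hcount _ _ h).1 zero_ne_one, zero_smul]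
      rfl

/-! ### The series of a cusp -/

open MvPolynomial (X C) in
/-- The polynomial `t (a + 2 b x - c x²)`. -/
def topEntry : Poly6 := X 1 * (X 3 + 2 * X 0 * X 4 - X 0 ^ 2 * X 5)

open MvPolynomial (X C) in
/-- The exponent of the Gaussian at `√v g_z⁻¹ (b a; c -b)`. -/
def latExp (v : ℝ) : Poly6 :=
  C (-(Real.pi * v) : ℂ) * (topEntry ^ 2 + (X 2 * X 5) ^ 2 + 2 * (X 4 - X 0 * X 5) ^ 2)

open MvPolynomial (X C) in
/-- The polynomial factor of the term of degrees `m, n` at `√v g_z⁻¹ (b a; c -b)`. -/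
def latPoly (v : ℝ) (m n : ℕ) (P : Poly6) : Poly6 :=
  P * Polynomial.aeval (C ((√v / √2 : ℝ) : ℂ) * (topEntry + X 2 * X 5)) (herm m) *
    Polynomial.aeval (C ((√2 * √v : ℝ) : ℂ) * (X 4 - X 0 * X 5)) (herm n)

open MvPolynomial (X C) in
/-- The exponent of the Poisson transform at `(n, b)`. -/
def cuspExp (v M : ℝ) : Poly6 :=
  C (-(Real.pi / (v * M ^ 2) : ℝ) : ℂ) * (X 3 * X 2) ^ 2 + C (-(2 * Real.pi * v : ℝ) : ℂ) * X 4 ^ 2 +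
    C ((4 * Real.pi / M : ℝ) * Complex.I : ℂ) * (X 3 * X 4 * X 0)

open MvPolynomial (X C) in
/-- The polynomial factor of the Poisson transform at `(n, b)`. -/
def cuspPoly (v M : ℝ) (m n : ℕ) (P : Poly6) : Poly6 :=
  P * (C ((1 / (√v * M) : ℝ) : ℂ) * X 2) * (C (-Complex.I * (√2 / (√v * M) : ℝ)) * X 3 * X 2) ^ m *
    Polynomial.aeval (C ((√2 * √v : ℝ) : ℂ) * X 4) (herm n)

theorem expPoly_lat {v : ℝ} (hv : 0 < v) (m n : ℕ) (P : Poly6) (b a c : ℝ) {q : ℝ × ℝ} (hq : 0 < q.2) :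
    expPoly (latExp v) (latPoly v m n P) ![a, b, c] q =
      MvPolynomial.eval (evalPt ![a, b, c] q) P *
        (((herm m).eval ((q.2 * (√v * a + 2 * q.1 * (√v * b) - q.1 ^ 2 * (√v * c)) +
            q.2⁻¹ * (√v * c)) / √2) *
          (herm n).eval (√2 * (√v * b - q.1 * (√v * c))) *
          Real.exp (-Real.pi * ((q.2 * (√v * a + 2 * q.1 * (√v * b) - q.1 ^ 2 * (√v * c))) ^ 2 +
            (q.2⁻¹ * (√v * c)) ^ 2 + 2 * (√v * b - q.1 * (√v * c)) ^ 2)) : ℝ) : ℂ) := by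
  have hs : √v ^ 2 = v := Real.sq_sqrt hv.le
  rw [expPoly, if_pos hq, latPoly, map_mul, map_mul, eval_aeval_poly, eval_aeval_poly]
  have h1 : MvPolynomial.eval (evalPt ![a, b, c] q)
      (MvPolynomial.C ((√v / √2 : ℝ) : ℂ) * (topEntry + MvPolynomial.X 2 * MvPolynomial.X 5)) =
      (((q.2 * (√v * a + 2 * q.1 * (√v * b) - q.1 ^ 2 * (√v * c)) +
            q.2⁻¹ * (√v * c)) / √2 : ℝ) : ℂ) := by
    simp [topEntry, evalPt]
    ring
  have h2 : MvPolynomial.eval (evalPt ![a, b, c] q)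
      (MvPolynomial.C ((√2 * √v : ℝ) : ℂ) *
        (MvPolynomial.X 4 - MvPolynomial.X 0 * MvPolynomial.X 5)) =
      ((√2 * (√v * b - q.1 * (√v * c)) : ℝ) : ℂ) := by
    simp [evalPt]
    ring
  have h3 : MvPolynomial.eval (evalPt ![a, b, c] q) (latExp v) =
      ((-Real.pi * ((q.2 * (√v * a + 2 * q.1 * (√v * b) - q.1 ^ 2 * (√v * c))) ^ 2 +
            (q.2⁻¹ * (√v * c)) ^ 2 + 2 * (√v * b - q.1 * (√v * c)) ^ 2) : ℝ) : ℂ) := by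
    have : -Real.pi * ((q.2 * (√v * a + 2 * q.1 * (√v * b) - q.1 ^ 2 * (√v * c))) ^ 2 +
            (q.2⁻¹ * (√v * c)) ^ 2 + 2 * (√v * b - q.1 * (√v * c)) ^ 2) =
      -(Real.pi * v) * ((q.2 * (a + 2 * q.1 * b - q.1 ^ 2 * c)) ^ 2 + (q.2⁻¹ * c) ^ 2 +
        2 * (b - q.1 * c) ^ 2) := by
      conv_rhs => rw [← hs]
      ring
    rw [this]
    simp [latExp, topEntry, evalPt]
  rw [h1, h2, h3, aeval_ofReal, aeval_ofReal]
  push_cast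
  ring

theorem eval_cuspExp (v M n b : ℝ) (q : ℝ × ℝ) :
    MvPolynomial.eval (evalPt ![n, b, 0] q) (cuspExp v M) =
      ((-(Real.pi / (v * M ^ 2)) * (n * q.2⁻¹) ^ 2 - 2 * Real.pi * v * b ^ 2 : ℝ) : ℂ) +
        (4 * Real.pi / M * (n * b * q.1) : ℝ) * Complex.I := by
  simp [cuspExp, evalPt]
  ring

theorem eval_latExp_re (v a b c : ℝ) (q : ℝ × ℝ) :
    (MvPolynomial.eval (evalPt ![a, b, c] q) (latExp v)).re =
      -(Real.pi * v) * ((q.2 * (a + 2 * q.1 * b - q.1 ^ 2 * c)) ^ 2 + (q.2⁻¹ * c) ^ 2 +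
        2 * (b - q.1 * c) ^ 2) := by
  rw [← Complex.ofReal_re (-(Real.pi * v) * _)]
  congr 1
  simp [latExp, topEntry, evalPt]

/-- Poisson summation over the line of the cusp. -/
theorem tsum_expPoly_lat_eq_cusp {v M : ℝ} (hv : 0 < v) (hM : 0 < M) (m n : ℕ) {P : Poly6}
    (hP : ∀ par q, MvPolynomial.eval (evalPt par q) P = MvPolynomial.eval (evalPt 0 q) P)
    (a b : ℝ) {q : ℝ × ℝ} (hq : 0 < q.2) :
    ∑' i : ℤ, expPoly (latExp v) (latPoly v m n P) ![a + i * M, b, 0] q =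
      ∑' i : ℤ, Complex.exp ((2 * Real.pi * i * a / M : ℝ) * Complex.I) *
        expPoly (cuspExp v M) (cuspPoly v M m n P) ![i, b, 0] q := by
  set θ := (a + 2 * b * q.1) / M with hθ
  set κ := √v * q.2 * M / √2 with hκ
  have hs : √v ^ 2 = v := Real.sq_sqrt hv.le
  have hsv : 0 < √v := Real.sqrt_pos.2 hv
  have h22 : (√2 : ℝ) ^ 2 = 2 := Real.sq_sqrt (by norm_num)
  have h2 : 0 < √2 := by positivity
  have hκ0 : 0 < κ := by positivity
  -- with `κ` and `θ` the argument of the Hermite function in `x₁` at `a + i M` is `κ (i + θ)`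
  have h := tsum_expPoly_gauss_eq_dual m (q := (θ, κ)) hκ0
  set B : ℂ := MvPolynomial.eval (evalPt 0 q) P * ((herm n).eval (√2 * (√v * b)) : ℝ) *
    Real.exp (-(2 * Real.pi * v * b ^ 2)) with hB
  have hκi : κ⁻¹ = √2 / (√v * M) * q.2⁻¹ := by rw [hκ]; field_simp
  have hL : ∀ i : ℤ, expPoly (latExp v) (latPoly v m n P) ![a + i * M, b, 0] q =
      B * expPoly gaussExp (gaussPoly m) (intPar i) (θ, κ) := by
    intro i
    have hx : (q.2 * (√v * (a + i * M) + 2 * q.1 * (√v * b) - q.1 ^ 2 * (√v * 0)) +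
        q.2⁻¹ * (√v * 0)) / √2 = κ * (i + θ) := by
      rw [hκ, hθ]; field_simp; ring
    have he : MvPolynomial.eval (evalPt (intPar i) (θ, κ))
        (MvPolynomial.X 1 * (MvPolynomial.X 3 + MvPolynomial.X 0)) = ((κ * (i + θ) : ℝ) : ℂ) := by
      simp [evalPt, intPar]
    have hexp : -Real.pi * ((q.2 * (√v * (a + i * M) + 2 * q.1 * (√v * b) -
          q.1 ^ 2 * (√v * 0))) ^ 2 + (q.2⁻¹ * (√v * 0)) ^ 2 + 2 * (√v * b - q.1 * (√v * 0)) ^ 2) =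
        -2 * Real.pi * (κ * (i + θ)) ^ 2 + -(2 * Real.pi * v * b ^ 2) := by
      have h5 : q.2 * (√v * (a + i * M) + 2 * q.1 * (√v * b) - q.1 ^ 2 * (√v * 0)) =
          √2 * (κ * (i + θ)) := by
        rw [← hx]; field_simp; ring
      rw [h5, mul_pow, h22]
      linear_combination (-2 * Real.pi * b ^ 2) * hs
    rw [expPoly_lat hv _ _ _ _ _ _ hq, hP, expPoly, if_pos (show 0 < (θ, κ).2 from hκ0),
      eval_gaussExp, gaussPoly, eval_aeval_poly, he, aeval_ofReal, hx, hexp, Real.exp_add, hB]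
    simp only [mul_zero, sub_zero]
    push_cast
    ring
  have hR : ∀ i : ℤ, Complex.exp ((2 * Real.pi * i * a / M : ℝ) * Complex.I) *
        expPoly (cuspExp v M) (cuspPoly v M m n P) ![i, b, 0] q =
      B * expPoly dualExp (dualPoly m) (intPar i) (θ, κ) := by
    intro i
    have hMc : (M : ℂ) ≠ 0 := by exact_mod_cast hM.ne'
    have hexp : ((2 * Real.pi * i * a / M : ℝ) * Complex.I) +
        MvPolynomial.eval (evalPt ![i, b, 0] q) (cuspExp v M) =
        ((-(2 * Real.pi * v * b ^ 2) : ℝ) : ℂ) +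
          MvPolynomial.eval (evalPt (intPar i) (θ, κ)) dualExp := by
      have h5 : Real.pi / (v * M ^ 2) * (i * q.2⁻¹) ^ 2 = Real.pi / 2 * (i * κ⁻¹) ^ 2 := by
        rw [hκi]
        have : √2 ^ 2 / (√v ^ 2 * M ^ 2) = 2 / (v * M ^ 2) := by rw [h22, hs]
        calc _ = Real.pi / 2 * (2 / (v * M ^ 2)) * (i * q.2⁻¹) ^ 2 := by ring
          _ = _ := by rw [← this]; ring
      have h6 : 4 * Real.pi / M * (i * b * q.1) + 2 * Real.pi * i * a / M = 2 * Real.pi * i * θ := by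
        rw [hθ]; ring
      rw [eval_cuspExp, eval_dualExp, ← h6, neg_mul, neg_mul, h5]
      push_cast
      ring
    have hd : MvPolynomial.eval (evalPt (intPar i) (θ, κ)) (dualPoly m) =
        ((1 / (√v * M) * q.2⁻¹ : ℝ) : ℂ) *
          (-Complex.I * (√2 / (√v * M) : ℝ) * i * (q.2⁻¹ : ℝ)) ^ m := by
      have h7 : (1 / √2) * κ⁻¹ = 1 / (√v * M) * q.2⁻¹ := by rw [hκi]; field_simp
      have h8 : ((κ⁻¹ : ℝ) : ℂ) = ((√2 / (√v * M) : ℝ) : ℂ) * (q.2⁻¹ : ℝ) := by rw [hκi]; push_cast; ring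
      rw [← h7]
      simp only [dualPoly, evalPt, intPar, map_mul, map_pow, MvPolynomial.eval_C,
        MvPolynomial.eval_X]
      have e2 : (![(θ : ℂ), (κ : ℂ), (κ : ℂ)⁻¹, ((![(i : ℝ), 0, 0] 0 : ℝ) : ℂ),
        ((![(i : ℝ), 0, 0] 1 : ℝ) : ℂ), ((![(i : ℝ), 0, 0] 2 : ℝ) : ℂ)] 2) = ((κ⁻¹ : ℝ) : ℂ) := by simp
      have e3 : (![(θ : ℂ), (κ : ℂ), (κ : ℂ)⁻¹, ((![(i : ℝ), 0, 0] 0 : ℝ) : ℂ),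
        ((![(i : ℝ), 0, 0] 1 : ℝ) : ℂ), ((![(i : ℝ), 0, 0] 2 : ℝ) : ℂ)] 3) = (i : ℂ) := by simp
      rw [e2, e3, Complex.ofReal_mul, h8]
      push_cast
      ring
    have hc : MvPolynomial.eval (evalPt ![(i : ℝ), b, 0] q) (cuspPoly v M m n P) =
        MvPolynomial.eval (evalPt 0 q) P * ((1 / (√v * M) * q.2⁻¹ : ℝ) : ℂ) *
          (-Complex.I * (√2 / (√v * M) : ℝ) * i * (q.2⁻¹ : ℝ)) ^ m *
          ((herm n).eval (√2 * (√v * b)) : ℝ) := by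
      have he : MvPolynomial.eval (evalPt ![(i : ℝ), b, 0] q)
          (MvPolynomial.C ((√2 * √v : ℝ) : ℂ) * MvPolynomial.X 4) =
          ((√2 * (√v * b) : ℝ) : ℂ) := by
        simp [evalPt]; ring
      rw [cuspPoly, map_mul, map_mul, map_mul, map_mul, map_pow, map_mul, map_mul, eval_aeval_poly,
        he, aeval_ofReal, hP, MvPolynomial.eval_C, MvPolynomial.eval_C, MvPolynomial.eval_X,
        MvPolynomial.eval_X, show evalPt ![(i : ℝ), b, 0] q 2 = ((q.2⁻¹ : ℝ) : ℂ) by simp [evalPt],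
        show evalPt ![(i : ℝ), b, 0] q 3 = (i : ℂ) by simp [evalPt]]
      push_cast
      ring
    rw [expPoly, if_pos hq, expPoly, if_pos (show 0 < (θ, κ).2 from hκ0), hc, hd, mul_left_comm,
      ← Complex.exp_add, hexp, Complex.exp_add, hB]
    push_cast
    ring
  simp only [hL, hR, tsum_mul_left, h]

/-- The quadratic form in the exponent, `A` and `B` being the matrix entries after translation by `x`,
dominates all parameters and `t⁻²` as soon as it dominates `c` and `t⁻²` through its part `(c / t)²`:
`a` and `b` are recovered from `A` and `B`, and `|A| = |t A| t⁻¹ ≤ (t A)² + t⁻²`. -/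
theorem abs_par_le_quad {x t a b c K R : ℝ} (ht : 0 < t) (hx : |x| ≤ R) (hK0 : 0 ≤ K)
    (hc : |c| ≤ K * ((t⁻¹ * c) ^ 2 + 1)) (hs : t⁻¹ ^ 2 ≤ K * ((t⁻¹ * c) ^ 2 + 1)) :
    |a| + |b| + |c| + t⁻¹ ^ 2 ≤
      ((1 + K + 2 * R * (1 + R * K) + R ^ 2 * K) + (1 + R * K) + K + K) *
        ((t * (a + 2 * x * b - x ^ 2 * c)) ^ 2 + (t⁻¹ * c) ^ 2 + 2 * (b - x * c) ^ 2 + 1) := by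
  have hR0 : 0 ≤ R := (abs_nonneg x).trans hx
  obtain ⟨A, hA⟩ : ∃ A, A = a + 2 * x * b - x ^ 2 * c := ⟨_, rfl⟩
  obtain ⟨B, hB⟩ : ∃ B, B = b - x * c := ⟨_, rfl⟩
  obtain ⟨E, hE⟩ : ∃ E, E = (t * A) ^ 2 + (t⁻¹ * c) ^ 2 + 2 * B ^ 2 + 1 := ⟨_, rfl⟩
  rw [← hA, ← hB, ← hE]
  have e1 := sq_nonneg (t * A)
  have e2 := sq_nonneg (t⁻¹ * c)
  have e3 := sq_nonneg B
  have hE1 : (t⁻¹ * c) ^ 2 + 1 ≤ E := by linarith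
  have hc' : |c| ≤ K * E := hc.trans (mul_le_mul_of_nonneg_left hE1 hK0)
  have hs' : t⁻¹ ^ 2 ≤ K * E := hs.trans (mul_le_mul_of_nonneg_left hE1 hK0)
  have hB' : |B| ≤ E := by nlinarith [sq_abs B, sq_nonneg (|B| - 1)]
  have hA' : |A| ≤ (1 + K) * E := by
    have h1 : |A| = |t * A| * t⁻¹ := by
      rw [abs_mul, abs_of_pos ht]; field_simp
    have h2 : |t * A| * t⁻¹ ≤ (t * A) ^ 2 + t⁻¹ ^ 2 := by
      nlinarith [sq_abs (t * A), sq_nonneg (|t * A| - t⁻¹), sq_nonneg t⁻¹]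
    have h3 : (t * A) ^ 2 ≤ E := by linarith
    rw [h1, add_mul, one_mul]
    linarith
  have hb : |b| ≤ (1 + R * K) * E := by
    have h1 : b = B + x * c := by rw [hB]; ring
    have h2 : |x * c| ≤ R * (K * E) := by
      rw [abs_mul]; exact mul_le_mul hx hc' (abs_nonneg _) hR0
    have := abs_add_le B (x * c)
    rw [← h1] at this
    linarith
  have ha : |a| ≤ (1 + K + 2 * R * (1 + R * K) + R ^ 2 * K) * E := by
    have h1 : a = A + -(2 * x * b) + x ^ 2 * c := by rw [hA]; ring
    have h2 : |-(2 * x * b)| ≤ 2 * R * ((1 + R * K) * E) := by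
      rw [abs_neg, abs_mul, abs_mul, abs_two]
      exact mul_le_mul (by linarith) hb (abs_nonneg _) (by linarith)
    have h3 : |x ^ 2 * c| ≤ R ^ 2 * (K * E) := by
      rw [abs_mul, abs_pow]
      exact mul_le_mul (pow_le_pow_left₀ (abs_nonneg x) hx 2) hc' (abs_nonneg _) (sq_nonneg R)
    have h4 := abs_add_three A (-(2 * x * b)) (x ^ 2 * c)
    rw [← h1] at h4
    linarith
  linarith

/-- The Gaussian decays where `(c / t)² + 1` dominates `c` and `t⁻²`. -/
theorem decays_latExp {ι : Type*} {v : ℝ} (hv : 0 < v) {a b c : ι → ℝ} {S : Set (ℝ × ℝ)} {K R : ℝ}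
    (hR : ∀ q ∈ S, |q.1| ≤ R) (hR0 : 0 ≤ R) (hK0 : 0 ≤ K)
    (hK : ∀ i, ∀ q ∈ S, 0 < q.2 → |c i| ≤ K * ((q.2⁻¹ * c i) ^ 2 + 1) ∧
      (q.2⁻¹) ^ 2 ≤ K * ((q.2⁻¹ * c i) ^ 2 + 1)) :
    Decays (latExp v) (fun i => ![a i, b i, c i]) S := by
  obtain ⟨L, hL⟩ : ∃ L, L = (1 + K + 2 * R * (1 + R * K) + R ^ 2 * K) + (1 + R * K) + K + K :=
    ⟨_, rfl⟩
  have hL0 : 0 < L := by rw [hL]; positivity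
  have hpv : 0 < Real.pi * v := mul_pos Real.pi_pos hv
  refine ⟨Real.pi * v / L, div_pos hpv hL0, Real.pi * v, fun i q hq hq2 => ?_⟩
  obtain ⟨hc, hs⟩ := hK i q hq hq2
  have htot := abs_par_le_quad (a := a i) (b := b i) hq2 (hR q hq) hK0 hc hs
  rw [← hL, mul_comm L, ← div_le_iff₀ hL0] at htot
  have hpar : parNorm ![a i, b i, c i] = |a i| + |b i| + |c i| := rfl
  rw [eval_latExp_re, hpar]
  have h5 := mul_le_mul_of_nonneg_left htot hpv.le
  rw [← mul_div_assoc, ← div_mul_eq_mul_div] at h5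
  linarith

/-- The Poisson transform decays where `(n / t)² + 1` dominates `n` and `t⁻²`. -/
theorem decays_cuspExp {ι : Type*} {v M : ℝ} (hv : 0 < v) (hM : 0 < M) {n b : ι → ℝ}
    {S : Set (ℝ × ℝ)} {K : ℝ} (hK0 : 0 ≤ K)
    (hK : ∀ i, ∀ q ∈ S, 0 < q.2 → |n i| ≤ K * ((n i * q.2⁻¹) ^ 2 + 1) ∧
      (q.2⁻¹) ^ 2 ≤ K * ((n i * q.2⁻¹) ^ 2 + 1)) :
    Decays (cuspExp v M) (fun i => ![n i, b i, 0]) S := by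
  have hpi := Real.pi_pos
  set α := Real.pi / (v * M ^ 2) with hα
  have hα0 : 0 < α := by positivity
  set β := 2 * Real.pi * v with hβ
  have hβ0 : 0 < β := by positivity
  set δ := min (α / (2 * K + 1)) β with hδ
  have hδ0 : 0 < δ := lt_min (by positivity) hβ0
  have hδ1 : δ * (2 * K + 1) ≤ α := by
    rw [← le_div_iff₀ (by positivity)]; exact min_le_left _ _
  have hδ2 : δ ≤ β := min_le_right _ _
  refine ⟨δ, hδ0, α + β, fun i q hq hq2 => ?_⟩
  obtain ⟨hn, hs⟩ := hK i q hq hq2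
  rw [eval_cuspExp, Complex.add_re, Complex.ofReal_re, Complex.re_ofReal_mul, Complex.I_re,
    mul_zero, add_zero, ← hα, ← hβ]
  have hpar : parNorm ![n i, b i, 0] = |n i| + |b i| := by simp [parNorm]
  rw [hpar]
  set E := (n i * q.2⁻¹) ^ 2 + 1 with hE
  have hE0 : 0 ≤ E := by positivity
  have hb : |b i| ≤ 1 + b i ^ 2 := by
    nlinarith [sq_abs (b i), sq_nonneg (|b i| - 1), abs_nonneg (b i)]
  have h1 : δ * (|n i| + |b i| + q.2⁻¹ ^ 2) ≤ δ * (2 * K * E + 1 + b i ^ 2) := by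
    refine mul_le_mul_of_nonneg_left ?_ hδ0.le
    linarith
  have h2 : δ * (2 * K + 1) * E ≤ α * E := by gcongr
  have h3 : δ * b i ^ 2 ≤ β * b i ^ 2 := by gcongr
  have h4 : (n i * q.2⁻¹) ^ 2 = E - 1 := by rw [hE]; ring
  rw [h4]
  nlinarith [mul_nonneg hδ0.le hE0]

/-- The derivatives of the Schwartz form are symmetric: the form is closed. -/
theorem fderiv_chartForm_symm (k : ℕ) (σ : SL(2, ℤ)) {X : Matrix (Fin 2) (Fin 2) ℝ}
    (hX : X.trace = 0) {q : ℝ × ℝ} (hq : 0 < q.2)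
    {D : ℝ × ℝ →L[ℝ] (ℝ × ℝ) [⋀^Fin 1]→L[ℝ] Harm k} (hD : HasFDerivAt (chartForm k σ X) D q)
    (ξ η : ℝ × ℝ) : D ξ (fun _ => η) = D η (fun _ => ξ) := by
  let T := (ContinuousAlternatingMap.ofSubsingletonLIE (𝕜 := ℝ) (E := ℝ × ℝ) (F := Harm k)
    (0 : Fin 1)).symm
  have h2 : HasFDerivAt (fun q => T (chartForm k σ X q))
      ((T : ((ℝ × ℝ) [⋀^Fin 1]→L[ℝ] Harm k) →L[ℝ] (ℝ × ℝ →L[ℝ] Harm k)).comp D) q :=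
    (T : ((ℝ × ℝ) [⋀^Fin 1]→L[ℝ] Harm k) →L[ℝ] (ℝ × ℝ →L[ℝ] Harm k)).hasFDerivAt.comp q hD
  refine second_derivative_symmetric_of_eventually_of_real
    (f := fun q => prim k X (chartPt σ q)) ?_ h2 ξ η
  filter_upwards [(isOpen_lt continuous_const continuous_snd).mem_nhds hq] with q' hq'
  exact hasFDerivAt_prim_chartPt k σ hX hq'

/-! ### The theta series near a cusp -/

/-- A set `A` of triples `(b, a, c)`, standing for the matrices `(b a; c -b)` of a coset of a
lattice: it has bounded denominators, and its fibres over `(b, 0)` are cosets of `ℤ M`. -/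
structure IsCuspSet (A : Set (ℚ × ℚ × ℚ)) (N : ℕ) (M : ℚ) : Prop where
  pos : 0 < N
  int : ∀ x ∈ A, ∃ m : ℤ × ℤ × ℤ, N * x.1 = m.1 ∧ N * x.2.1 = m.2.1 ∧ N * x.2.2 = m.2.2
  pos' : 0 < M
  fibre : ∀ b a, (b, a, 0) ∈ A → ∀ a', (b, a', 0) ∈ A ↔ ∃ n : ℤ, a' = a + n * M

/-- The `b` such that `A` meets the fibre over `(b, 0)`. -/
def cuspBase (A : Set (ℚ × ℚ × ℚ)) : Set ℚ := {b | ∃ a, (b, a, 0) ∈ A}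

/-- The parameters `(a, b, c)` of `(b, a, c)`. -/
def latPar (x : ℚ × ℚ × ℚ) : Fin 3 → ℝ := ![(x.2.1 : ℝ), (x.1 : ℝ), (x.2.2 : ℝ)]

theorem abs_le_one_add_sq (y : ℝ) : |y| ≤ 1 + y ^ 2 := by
  nlinarith [sq_abs y, sq_nonneg (|y| - 1), abs_nonneg y]

theorem sq_le_mul_inv_mul_sq {t T : ℝ} (ht : 0 < t) (hT : t ≤ T) (y : ℝ) :
    y ^ 2 ≤ T ^ 2 * (t⁻¹ * y) ^ 2 := by
  have h : 1 ≤ (T * t⁻¹) ^ 2 := by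
    refine one_le_pow₀ ?_
    rw [← div_eq_mul_inv, one_le_div ht]
    exact hT
  nlinarith [sq_nonneg y]

/-- The bound behind the decay of the series whose parameter `y` does not vanish. -/
theorem le_of_one_le_abs {t T N y : ℝ} (ht : 0 < t) (hT : t ≤ T) (hy : 1 ≤ N * |y|) :
    |y| ≤ (N ^ 2 + 1 + T ^ 2) * ((t⁻¹ * y) ^ 2 + 1) ∧
      t⁻¹ ^ 2 ≤ (N ^ 2 + 1 + T ^ 2) * ((t⁻¹ * y) ^ 2 + 1) := by
  have h1 := abs_le_one_add_sq y
  have h2 := sq_le_mul_inv_mul_sq ht hT y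
  have h3 : (1 : ℝ) ≤ (N * |y|) ^ 2 := one_le_pow₀ hy
  have h4 := mul_le_mul_of_nonneg_left h3 (sq_nonneg t⁻¹)
  have h5 : t⁻¹ ^ 2 * (N * |y|) ^ 2 = N ^ 2 * (t⁻¹ * y) ^ 2 := by
    rw [mul_pow, sq_abs]; ring
  have h6 := sq_nonneg (t⁻¹ * y)
  constructor <;> nlinarith [sq_nonneg N, sq_nonneg T, mul_nonneg (sq_nonneg N) h6,
    mul_nonneg (sq_nonneg T) h6]

/-- The bound behind the decay of the series away from the boundary. -/
theorem le_of_lt_of_lt {t T₁ T₂ : ℝ} (hT₁ : 0 < T₁) (ht : T₁ ≤ t) (hT : t ≤ T₂) (y : ℝ) :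
    |y| ≤ ((T₁⁻¹) ^ 2 + 1 + T₂ ^ 2) * ((t⁻¹ * y) ^ 2 + 1) ∧
      t⁻¹ ^ 2 ≤ ((T₁⁻¹) ^ 2 + 1 + T₂ ^ 2) * ((t⁻¹ * y) ^ 2 + 1) := by
  have h0 : 0 < t := hT₁.trans_le ht
  have h1 := abs_le_one_add_sq y
  have h2 := sq_le_mul_inv_mul_sq h0 hT y
  have h3 : t⁻¹ ^ 2 ≤ T₁⁻¹ ^ 2 := by gcongr
  have h6 := sq_nonneg (t⁻¹ * y)
  constructor <;> nlinarith [sq_nonneg T₁⁻¹, sq_nonneg T₂, mul_nonneg (sq_nonneg T₁⁻¹) h6,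
    mul_nonneg (sq_nonneg T₂) h6]

section CuspSet

variable {A : Set (ℚ × ℚ × ℚ)} {N : ℕ} {M : ℚ}

theorem IsCuspSet.summable_lat (hA : IsCuspSet A N M) :
    ∀ δ > 0, Summable fun x : A => Real.exp (-δ * parNorm (latPar x)) := by
  choose f hf using hA.int
  have hN : (0 : ℝ) < N := by exact_mod_cast hA.pos
  have hNq : (N : ℚ) ≠ 0 := by exact_mod_cast hA.pos.ne'
  refine summable_exp_parNorm (fun x : A => f x.1 x.2) (fun x y hxy => ?_)
    (inv_pos.2 hN) (fun x => ?_)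
  · obtain ⟨h1, h2, h3⟩ := hf x.1 x.2
    obtain ⟨h1', h2', h3'⟩ := hf y.1 y.2
    simp only at hxy
    rw [← hxy] at h1' h2' h3'
    refine Subtype.ext (Prod.ext ?_ (Prod.ext ?_ ?_))
    · exact mul_left_cancel₀ hNq (h1.trans h1'.symm)
    · exact mul_left_cancel₀ hNq (h2.trans h2'.symm)
    · exact mul_left_cancel₀ hNq (h3.trans h3'.symm)
  · obtain ⟨h1, h2, h3⟩ := hf x.1 x.2
    have h1' : (((f x.1 x.2).1 : ℤ) : ℝ) = N * (x.1.1 : ℝ) := by exact_mod_cast h1.symm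
    have h2' : (((f x.1 x.2).2.1 : ℤ) : ℝ) = N * (x.1.2.1 : ℝ) := by exact_mod_cast h2.symm
    have h3' : (((f x.1 x.2).2.2 : ℤ) : ℝ) = N * (x.1.2.2 : ℝ) := by exact_mod_cast h3.symm
    rw [h1', h2', h3', abs_mul, abs_mul, abs_mul, abs_of_pos hN]
    refine le_of_eq ?_
    simp only [parNorm, latPar, Matrix.cons_val]
    field_simp
    ring

theorem IsCuspSet.summable_base (hA : IsCuspSet A N M) :
    ∀ δ > 0, Summable fun p : cuspBase A × ℤ =>
      Real.exp (-δ * parNorm ![(p.2 : ℝ), (p.1.1 : ℝ), 0]) := by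
  have hb : ∀ b : cuspBase A, ∃ m : ℤ, N * b.1 = m := fun b => by
    obtain ⟨a, ha⟩ := b.2
    obtain ⟨m, hm, -⟩ := hA.int _ ha
    exact ⟨m.1, hm⟩
  choose f hf using hb
  have hN : (1 : ℝ) ≤ N := by exact_mod_cast hA.pos
  have hN0 : (0 : ℝ) < N := by linarith
  have hNq : (N : ℚ) ≠ 0 := by exact_mod_cast hA.pos.ne'
  refine summable_exp_parNorm (fun p : cuspBase A × ℤ => (p.2, f p.1, 0)) (fun x y hxy => ?_)
    (inv_pos.2 hN0) (fun x => ?_)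
  · simp only [Prod.mk.injEq] at hxy
    refine Prod.ext (Subtype.ext (mul_left_cancel₀ hNq ?_)) hxy.1
    rw [hf, hf, hxy.2.1]
  · have h1 : ((f x.1 : ℤ) : ℝ) = N * (x.1.1 : ℝ) := by exact_mod_cast (hf x.1).symm
    simp only [h1, abs_mul, abs_of_pos hN0, parNorm, Matrix.cons_val, Int.cast_zero, abs_zero]
    have h2 : (N : ℝ)⁻¹ * |(x.2 : ℝ)| ≤ |(x.2 : ℝ)| :=
      mul_le_of_le_one_left (abs_nonneg _) (inv_le_one_of_one_le₀ hN)
    have h3 : (N : ℝ)⁻¹ * (N * |(x.1.1 : ℝ)|) = |(x.1.1 : ℝ)| := by field_simp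
    rw [mul_add, mul_add, h3]
    linarith

variable {v : ℝ} {ε : ℚ × ℚ × ℚ → ℂ}

theorem decays_lat_box (hv : 0 < v) (A : Set (ℚ × ℚ × ℚ)) (R : ℝ) {T₁ : ℝ} (hT₁ : 0 < T₁) (T₂ : ℝ) :
    Decays (latExp v) (fun x : A => latPar x) (box R T₁ T₂) := by
  refine decays_latExp hv (K := (T₁⁻¹) ^ 2 + 1 + T₂ ^ 2) (R := |R|) (fun q hq => ?_) (abs_nonneg R)
    (by positivity) fun i q hq hq2 => le_of_lt_of_lt hT₁ hq.2.1.le hq.2.2.le _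
  exact (abs_lt.2 hq.1).le.trans (le_abs_self R)

/-- The terms with `c ≠ 0` decay towards the boundary, as `|c| ≥ 1 / N`. -/
theorem IsCuspSet.decays_lat (hA : IsCuspSet A N M) (hv : 0 < v) (R T : ℝ) :
    Decays (latExp v) (fun x : {x : A // x.1.2.2 ≠ 0} => latPar x.1) (box R (-T) T) := by
  refine decays_latExp hv (K := (N : ℝ) ^ 2 + 1 + T ^ 2) (R := |R|) (fun q hq => ?_) (abs_nonneg R)
    (by positivity) fun x q hq hq2 => le_of_one_le_abs hq2 hq.2.2.le ?_
  · exact (abs_lt.2 hq.1).le.trans (le_abs_self R)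
  · obtain ⟨m, -, -, hm⟩ := hA.int x.1.1 x.1.2
    have hN : (0 : ℝ) < N := by exact_mod_cast hA.pos
    have h1 : (N : ℝ) * (x.1.1.2.2 : ℝ) = (m.2.2 : ℤ) := by exact_mod_cast hm
    have h2 : m.2.2 ≠ 0 := by
      intro h
      rw [h, Int.cast_zero] at hm
      have hNq : (N : ℚ) ≠ 0 := by exact_mod_cast hA.pos.ne'
      exact x.2 ((mul_eq_zero.1 hm).resolve_left hNq)
    rw [← abs_of_pos hN, ← abs_mul, h1]
    exact_mod_cast Int.one_le_abs h2

theorem decays_cusp_box (hv : 0 < v) (hM : 0 < M) (B : Set ℚ) (R : ℝ) {T₁ : ℝ} (hT₁ : 0 < T₁)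
    (T₂ : ℝ) : Decays (cuspExp v M) (fun p : B × ℤ => ![(p.2 : ℝ), (p.1.1 : ℝ), 0])
      (box R T₁ T₂) := by
  refine decays_cuspExp hv (by exact_mod_cast hM) (K := (T₁⁻¹) ^ 2 + 1 + T₂ ^ 2) (by positivity)
    fun i q hq hq2 => ?_
  rw [mul_comm (i.2 : ℝ)]
  exact le_of_lt_of_lt hT₁ hq.2.1.le hq.2.2.le _

/-- The nonzero frequencies decay towards the boundary, as `|n| ≥ 1`. -/
theorem decays_cusp (hv : 0 < v) (hM : 0 < M) (B : Set ℚ) (R T : ℝ) :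
    Decays (cuspExp v M) (fun p : {p : B × ℤ // p.2 ≠ 0} => ![(p.1.2 : ℝ), (p.1.1.1 : ℝ), 0])
      (box R (-T) T) := by
  refine decays_cuspExp hv (by exact_mod_cast hM) (K := (1 : ℝ) ^ 2 + 1 + T ^ 2) (by positivity)
    fun i q hq hq2 => ?_
  rw [mul_comm (i.1.2 : ℝ)]
  refine le_of_one_le_abs hq2 hq.2.2.le ?_
  rw [one_mul]
  exact_mod_cast Int.one_le_abs i.2

theorem exists_mem_box {q : ℝ × ℝ} (hq : 0 < q.2) : ∃ R T₁ T₂ : ℝ, 0 < T₁ ∧ q ∈ box R T₁ T₂ :=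
  ⟨|q.1| + 1, q.2 / 2, q.2 + 1, by linarith, ⟨by linarith [neg_abs_le q.1],
    by linarith [le_abs_self q.1]⟩, half_lt_self hq, lt_add_one _⟩

theorem IsCuspSet.summable_expPoly_lat (hA : IsCuspSet A N M) (hv : 0 < v) (hε : ∀ x, ‖ε x‖ ≤ 1)
    (p : Poly6) {q : ℝ × ℝ} (hq : 0 < q.2) :
    Summable fun x : A => ε x * expPoly (latExp v) p (latPar x) q := by
  obtain ⟨R, T₁, T₂, hT, hb⟩ := exists_mem_box hq
  exact summable_expPoly (isBounded_box _ _ _) (decays_lat_box hv A R hT T₂) hA.summable_lat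
    (fun x => hε x) p hb

theorem tsum_eq_tsum_subtype_add {ι κ : Type*} {f : ι → ℂ} (hf : Summable f) (p : ι → Prop)
    {g : κ → ι} (hg : Function.Injective g) (hr : ∀ x, ¬ p x ↔ x ∈ Set.range g) :
    ∑' x, f x = ∑' x : {x // p x}, f x + ∑' y, f (g y) := by
  obtain ⟨S, hS⟩ : ∃ S : Set ι, S = {x | p x} := ⟨_, rfl⟩
  have h := (hf.subtype S).tsum_add_tsum_compl (hf.subtype _)
  have hc : Sᶜ = Set.range g := by rw [hS]; exact Set.ext hr
  rw [← h, ← tsum_range f hg, ← hc, hS]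
  rfl

/-- The splitting of a sum over `A` into the sum over `c ≠ 0` and the iterated sum over the fibres
of the part with `c = 0`. -/
theorem IsCuspSet.tsum_eq (hA : IsCuspSet A N M) {a : cuspBase A → ℚ}
    (ha : ∀ b : cuspBase A, (b.1, a b, 0) ∈ A) {f : ℚ × ℚ × ℚ → ℂ}
    (hf : Summable fun x : A => f x) :
    ∑' x : A, f x = ∑' x : {x : A // x.1.2.2 ≠ 0}, f x.1 +
      ∑' b : cuspBase A, ∑' i : ℤ, f (b.1, a b + i * M, 0) := by
  have hM := hA.pos'
  let g : cuspBase A × ℤ → A := fun p =>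
    ⟨(p.1.1, a p.1 + p.2 * M, 0), (hA.fibre _ _ (ha p.1) _).2 ⟨p.2, rfl⟩⟩
  have hg : Function.Injective g := by
    rintro ⟨b, i⟩ ⟨b', i'⟩ h
    have h1 : (b.1, a b + i * M, (0 : ℚ)) = (b'.1, a b' + i' * M, 0) := congrArg Subtype.val h
    simp only [Prod.mk.injEq, and_true] at h1
    obtain ⟨h1, h2⟩ := h1
    obtain rfl : b = b' := Subtype.ext h1
    have h3 : (i : ℚ) = i' := mul_right_cancel₀ hM.ne' (add_left_cancel h2)
    rw [Int.cast_injective h3]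
  have hr : ∀ x : A, ¬ x.1.2.2 ≠ 0 ↔ x ∈ Set.range g := by
    rintro ⟨⟨b, a', c⟩, hx⟩
    rw [not_not]
    refine ⟨fun hc => ?_, ?_⟩
    · obtain rfl : c = 0 := hc
      obtain ⟨n, hn⟩ := (hA.fibre _ _ (ha ⟨b, a', hx⟩) a').1 hx
      refine ⟨(⟨b, a', hx⟩, n), Subtype.ext ?_⟩
      simp [g, hn]
    · rintro ⟨p, hp⟩
      rw [← hp]
  rw [tsum_eq_tsum_subtype_add hf _ hg hr]
  have hs : Summable fun p : cuspBase A × ℤ => f (p.1.1, a p.1 + p.2 * M, 0) :=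
    hf.comp_injective hg
  rw [← hs.tsum_prod]

/-- The contribution of the fibre over `(b, 0)` to the zero Fourier coefficient, up to the Hermite
polynomial: the phase, times the Gaussian at `b`, divided by the covolume `√v M` of the fibre. -/
def cuspMain (A : Set (ℚ × ℚ × ℚ)) (M : ℚ) (v : ℝ) (ε : ℚ × ℚ × ℚ → ℂ) (b : cuspBase A) : ℂ :=
  ε (b.1, 0, 0) * ((1 / (√v * M) * Real.exp (-(2 * Real.pi * v * (b.1 : ℝ) ^ 2)) : ℝ) : ℂ)

/-- A sum of exponential polynomials over `A` is the sum of its boundary term, which comes from the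
zero Fourier coefficients along the fibres over `c = 0`, and of a smooth function that
vanishes for `t ≤ 0`. -/
theorem IsCuspSet.exists_contDiff (hA : IsCuspSet A N M) (hv : 0 < v) (hε : ∀ x, ‖ε x‖ ≤ 1)
    (hε0 : ∀ b a, ε (b, a, 0) = ε (b, 0, 0)) (m n : ℕ) {P : Poly6}
    (hP : ∀ par q, MvPolynomial.eval (evalPt par q) P = MvPolynomial.eval (evalPt 0 q) P) :
    ∃ g : ℝ × ℝ → ℂ, ContDiff ℝ ∞ g ∧ (∀ q, q.2 ≤ 0 → g q = 0) ∧ ∀ q, 0 < q.2 →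
      (Summable fun b : cuspBase A => cuspMain A M v ε b * ((herm n).eval (√2 * (√v * b.1)) : ℝ)) ∧
      ∑' x : A, ε x * expPoly (latExp v) (latPoly v m n P) (latPar x) q = g q +
        if m = 0 then MvPolynomial.eval (evalPt 0 q) P * (q.2⁻¹ : ℝ) *
          ∑' b : cuspBase A, cuspMain A M v ε b * ((herm n).eval (√2 * (√v * b.1)) : ℝ)
        else 0 := by
  have hMq := hA.pos'
  have hM : (0 : ℝ) < M := by exact_mod_cast hMq
  choose a ha using fun b : cuspBase A => b.2
  let ε' : cuspBase A × ℤ → ℂ := fun p =>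
    ε (p.1.1, 0, 0) * Complex.exp ((2 * Real.pi * p.2 * a p.1 / M : ℝ) * Complex.I)
  have hε' : ∀ p, ‖ε' p‖ ≤ 1 := fun p => by
    rw [norm_mul, Complex.norm_exp_ofReal_mul_I, mul_one]
    exact hε _
  -- the vectors with `c ≠ 0`, and the nonzero frequencies of those with `c = 0`
  refine ⟨fun q => ∑' x : {x : A // x.1.2.2 ≠ 0}, ε x.1 *
      expPoly (latExp v) (latPoly v m n P) (latPar x.1) q +
    ∑' p : {p : cuspBase A × ℤ // p.2 ≠ 0}, ε' p.1 *
      expPoly (cuspExp v M) (cuspPoly v M m n P) ![(p.1.2 : ℝ), (p.1.1.1 : ℝ), 0] q,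
    ?_, fun q hq => ?_, fun q hq => ?_⟩
  · refine (contDiff_tsum_expPoly (hA.decays_lat hv) (fun δ hδ => ?_) (fun x => hε _) _).add
      (contDiff_tsum_expPoly (decays_cusp hv hMq (cuspBase A)) (fun δ hδ => ?_) (fun p => hε' p.1) _)
    · exact (hA.summable_lat δ hδ).comp_injective Subtype.val_injective
    · exact (hA.summable_base δ hδ).comp_injective Subtype.val_injective
  · simp [expPoly, not_lt.2 hq]
  · obtain ⟨R, T₁, T₂, hT, hb⟩ := exists_mem_box hq
    have s1 := hA.summable_expPoly_lat hv hε (latPoly v m n P) hq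
    have s2 : ∀ p, Summable fun i => ε' i * expPoly (cuspExp v M) p
        ![(i.2 : ℝ), (i.1.1 : ℝ), 0] q := fun p =>
      summable_expPoly (isBounded_box _ _ _) (decays_cusp_box hv hMq (cuspBase A) R hT T₂)
        hA.summable_base hε' p hb
    have hz : Function.Injective fun b : cuspBase A => (b, (0 : ℤ)) := fun b b' h =>
      congrArg Prod.fst h
    have hev : ∀ (n : ℕ) (P : Poly6), (∀ par q, MvPolynomial.eval (evalPt par q) P =
        MvPolynomial.eval (evalPt 0 q) P) → ∀ (m : ℕ) (b : cuspBase A), ε' (b, 0) *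
        expPoly (cuspExp v M) (cuspPoly v M m n P) ![((0 : ℤ) : ℝ), (b.1 : ℝ), 0] q =
        if m = 0 then MvPolynomial.eval (evalPt 0 q) P * (q.2⁻¹ : ℝ) *
          (cuspMain A M v ε b * ((herm n).eval (√2 * (√v * b.1)) : ℝ)) else 0 := by
      intro n P hP m b
      have he : MvPolynomial.eval (evalPt ![((0 : ℤ) : ℝ), (b.1 : ℝ), 0] q)
          (MvPolynomial.C ((√2 * √v : ℝ) : ℂ) * MvPolynomial.X 4) =
          ((√2 * (√v * b.1) : ℝ) : ℂ) := by
        simp [evalPt]; ring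
      rw [expPoly, if_pos hq, eval_cuspExp, cuspPoly, map_mul, map_mul, map_mul, map_mul, map_pow,
        map_mul, map_mul, eval_aeval_poly, he, aeval_ofReal, hP, MvPolynomial.eval_C,
        MvPolynomial.eval_C, MvPolynomial.eval_X, MvPolynomial.eval_X,
        show evalPt ![((0 : ℤ) : ℝ), (b.1 : ℝ), 0] q 2 = ((q.2⁻¹ : ℝ) : ℂ) by simp [evalPt],
        show evalPt ![((0 : ℤ) : ℝ), (b.1 : ℝ), 0] q 3 = 0 by simp [evalPt]]
      have e0 : ε' (b, 0) = ε (b.1, 0, 0) := by simp [ε']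
      rw [e0]
      split_ifs with h
      · rw [h, pow_zero, cuspMain]
        push_cast
        simp
        ring
      · simp [zero_pow h]
    have s3 : Summable fun b : cuspBase A =>
        cuspMain A M v ε b * ((herm n).eval (√2 * (√v * b.1)) : ℝ) := by
      have := (s2 (cuspPoly v M 0 n 1)).comp_injective hz
      refine (this.mul_left (q.2 : ℂ)).congr fun b => ?_
      have hq' : (q.2 : ℂ) ≠ 0 := by exact_mod_cast hq.ne'
      simp only [Function.comp]
      rw [hev n 1 (by simp) 0 b, if_pos rfl, map_one]
      push_cast
      field_simp
    refine ⟨s3, ?_⟩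
    rw [hA.tsum_eq ha (f := fun x => ε x * expPoly (latExp v) (latPoly v m n P) (latPar x) q) s1,
      add_assoc]
    congr 1
    have h1 : ∀ b : cuspBase A, ∑' i : ℤ, ε (b.1, a b + i * M, 0) *
        expPoly (latExp v) (latPoly v m n P) (latPar (b.1, a b + i * M, 0)) q =
        ∑' i : ℤ, ε' (b, i) * expPoly (cuspExp v M) (cuspPoly v M m n P)
          ![(i : ℝ), (b.1 : ℝ), 0] q := by
      intro b
      have := tsum_expPoly_lat_eq_cusp hv hM m n hP (a b) b.1 hq
      simp only [hε0 b.1 (_ + _), latPar, tsum_mul_left, ε', mul_assoc]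
      congr 1
      simp only [mul_assoc] at this
      push_cast at this ⊢
      exact this
    simp only [h1]
    rw [← (s2 (cuspPoly v M m n P)).tsum_prod, tsum_eq_tsum_subtype_add
      (s2 (cuspPoly v M m n P)) (fun p => p.2 ≠ 0) hz fun p => ?_]
    swap
    · rw [not_not]
      refine ⟨fun h => ⟨p.1, Prod.ext rfl h.symm⟩, ?_⟩
      rintro ⟨b, hb⟩
      rw [← hb]
    congr 1
    refine (tsum_congr fun b => hev n P hP m b).trans ?_
    split_ifs with h
    · rw [tsum_mul_left]
    · simp

end CuspSet

theorem smul_trless (r b a c : ℝ) : r • trless b a c = trless (r * b) (r * a) (r * c) := by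
  ext i j
  fin_cases i <;> fin_cases j <;> simp [trless]

/-- The form `w ↦ η ⊗ w` depends linearly on `w`. -/
theorem contDiff_oneForm {k : ℕ} {E E' : Type*} [NormedAddCommGroup E] [NormedSpace ℝ E]
    [NormedAddCommGroup E'] [NormedSpace ℝ E'] (η : E →L[ℝ] ℝ) {f : E' → Harm k}
    (hf : ContDiff ℝ ∞ f) : ContDiff ℝ ∞ fun x => oneForm η (f x) := by
  let T : Harm k →ₗ[ℝ] (E [⋀^Fin 1]→L[ℝ] Harm k) :=
    { toFun := fun w => oneForm η w
      map_add' := fun w w' => by ext; simp [oneForm]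
      map_smul' := fun c w => by
        ext x
        exact smul_comm (η (x 0)) c w }
  exact (LinearMap.toContinuousLinearMap T).contDiff.comp hf

/-- The boundary form at the standard cusp. -/
def bdMain (k : ℕ) (x : ℝ) : (ℝ × ℝ) [⋀^Fin 1]→L[ℝ] Harm k :=
  (-(1 / (2 : ℝ) ^ ((k : ℝ) + 1 / 2))) • oneForm (ContinuousLinearMap.fst ℝ ℝ ℝ)
    (rho k (nMat x) (harmProj k (MvPolynomial.X 1 ^ k)))

theorem contDiff_bdMain (k : ℕ) : ContDiff ℝ ∞ fun q : ℝ × ℝ => bdMain k q.1 :=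
  (contDiff_oneForm _ ((contDiff_rho_nMat _).comp contDiff_fst)).const_smul _

/-- The term of the theta series at `(b a; c -b)`, in the standard chart. -/
def cuspTerm (k : ℕ) (v : ℝ) (ε : ℚ × ℚ × ℚ → ℂ) (x : ℚ × ℚ × ℚ) (q : ℝ × ℝ) :
    (ℝ × ℝ) [⋀^Fin 1]→L[ℝ] Harm k :=
  ε x • chartForm k 1 (√v • trless (x.1 : ℝ) x.2.1 x.2.2) q

/-- The theta series of `A` in the standard chart converges for `t > 0`; it extends to a smooth
form on the plane, whose value at `t = 0` is the boundary form with the factor of a unary theta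
series, and whose exterior derivative vanishes for `t ≥ 0`. -/
theorem IsCuspSet.exists_form {A : Set (ℚ × ℚ × ℚ)} {N : ℕ} {M : ℚ} (hA : IsCuspSet A N M)
    {v : ℝ} {ε : ℚ × ℚ × ℚ → ℂ} (hv : 0 < v) (hε : ∀ x, ‖ε x‖ ≤ 1)
    (hε0 : ∀ b a, ε (b, a, 0) = ε (b, 0, 0)) (k : ℕ) :
    (∀ q, 0 < q.2 → Summable fun x : A => cuspTerm k v ε x q) ∧
    (Summable fun b : cuspBase A =>
      cuspMain A M v ε b * ((herm (k + 1)).eval (√2 * (√v * b.1)) : ℝ)) ∧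
    ∃ G : ℝ × ℝ → (ℝ × ℝ) [⋀^Fin 1]→L[ℝ] Harm k, ContDiff ℝ ∞ G ∧
      (∀ q, 0 < q.2 → G q = ∑' x : A, cuspTerm k v ε x q) ∧
      (∀ x, G (x, 0) = (∑' b : cuspBase A,
        cuspMain A M v ε b * ((herm (k + 1)).eval (√2 * (√v * b.1)) : ℝ)) • bdMain k x) ∧
      ∀ q, 0 ≤ q.2 → ∀ ξ η, fderiv ℝ G q ξ (fun _ => η) = fderiv ℝ G q η (fun _ => ξ) := by
  obtain ⟨d, n₀, n₁, P, F, hP, hexp, hmain⟩ := exists_chartForm_expansion k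
  have hterm : ∀ (x : ℚ × ℚ × ℚ) (q : ℝ × ℝ), 0 < q.2 →
      chartForm k 1 (√v • trless (x.1 : ℝ) x.2.1 x.2.2) q =
      ∑ j, expPoly (latExp v) (latPoly v (n₀ j) (n₁ j) (P j)) (latPar x) q • F j := by
    intro x q hq
    rw [smul_trless, hexp (latPar x) q hq]
    refine Finset.sum_congr rfl fun j _ => ?_
    rw [latPar, expPoly_lat hv _ _ _ _ _ _ hq]
  have hs : ∀ q : ℝ × ℝ, 0 < q.2 → ∀ p : Fin d → Poly6, HasSum
      (fun x : A => ∑ j, (ε x * expPoly (latExp v) (p j) (latPar x) q) • F j)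
      (∑ j, (∑' x : A, ε x * expPoly (latExp v) (p j) (latPar x) q) • F j) := fun q hq p =>
    hasSum_sum fun j _ => (hA.summable_expPoly_lat hv hε (p j) hq).hasSum.smul_const (F j)
  have hs' : ∀ q : ℝ × ℝ, 0 < q.2 → HasSum (fun x : A => cuspTerm k v ε x q)
      (∑ j, (∑' x : A, ε x * expPoly (latExp v) (latPoly v (n₀ j) (n₁ j) (P j)) (latPar x) q) •
        F j) := fun q hq => by
    refine (hs q hq fun j => latPoly v (n₀ j) (n₁ j) (P j)).congr_fun ?_
    intro x
    simp only [cuspTerm]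
    rw [hterm x q hq, Finset.smul_sum]
    exact Finset.sum_congr rfl fun j _ => smul_smul _ _ _
  choose g hgs hg0 hg using fun j => hA.exists_contDiff hv hε hε0 (n₀ j) (n₁ j) (hP · · j)
  -- used only for the convergence of the unary theta series
  obtain ⟨_, -, -, hk1⟩ := hA.exists_contDiff hv hε hε0 0 (k + 1) (P := 1) (by simp)
  have hk : Summable fun b : cuspBase A =>
      cuspMain A M v ε b * ((herm (k + 1)).eval (√2 * (√v * b.1)) : ℝ) :=
    (hk1 (0, 1) one_pos).1
  let C₀ := ∑' b : cuspBase A, cuspMain A M v ε b * ((herm (k + 1)).eval (√2 * (√v * b.1)) : ℝ)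
  let G : ℝ × ℝ → (ℝ × ℝ) [⋀^Fin 1]→L[ℝ] Harm k := fun q =>
    ∑ j, g j q • F j + C₀ • bdMain k q.1
  have hGc : ContDiff ℝ ∞ G :=
    (ContDiff.sum fun j _ => (hgs j).smul contDiff_const).add ((contDiff_bdMain k).const_smul C₀)
  have hG : ∀ q, 0 < q.2 → G q = ∑' x : A, cuspTerm k v ε x q := fun q hq => by
    have h1 : ∀ b : cuspBase A, ∑ j, (if n₀ j = 0 then MvPolynomial.eval (evalPt 0 q) (P j) *
        (q.2⁻¹ : ℝ) * (cuspMain A M v ε b * ((herm (n₁ j)).eval (√2 * (√v * b.1)) : ℝ)) else 0) •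
          F j = (cuspMain A M v ε b * ((herm (k + 1)).eval (√2 * (√v * b.1)) : ℝ)) •
            bdMain k q.1 := fun b => by
      have := congrArg (cuspMain A M v ε b • ·) (hmain 0 q hq (√2 * (√v * b.1)))
      simp only [Finset.smul_sum] at this
      rw [bdMain, ← Complex.coe_smul, smul_smul]
      rw [← Complex.coe_smul, smul_smul] at this
      refine Eq.trans ?_ (this.trans ?_)
      · refine Finset.sum_congr rfl fun j _ => ?_
        rw [smul_smul]
        congr 1
        split_ifs
        · ring
        · ring
      · congr 1
        push_cast
        ring
    have h2 : HasSum (fun b : cuspBase A => ∑ j, (if n₀ j = 0 then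
        MvPolynomial.eval (evalPt 0 q) (P j) * (q.2⁻¹ : ℝ) *
          (cuspMain A M v ε b * ((herm (n₁ j)).eval (√2 * (√v * b.1)) : ℝ)) else 0) • F j)
        (∑ j, (if n₀ j = 0 then MvPolynomial.eval (evalPt 0 q) (P j) * (q.2⁻¹ : ℝ) *
          ∑' b : cuspBase A, cuspMain A M v ε b * ((herm (n₁ j)).eval (√2 * (√v * b.1)) : ℝ)
          else 0) • F j) := by
      refine hasSum_sum fun j _ => HasSum.smul_const ?_ _
      split_ifs
      · exact ((hg j q hq).1.hasSum).mul_left _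
      · exact hasSum_zero
    simp only [h1] at h2
    have h3 := h2.unique (hk.hasSum.smul_const (bdMain k q.1))
    rw [(hs' q hq).tsum_eq]
    simp only [G, C₀]
    rw [← h3, ← Finset.sum_add_distrib]
    refine Finset.sum_congr rfl fun j _ => ?_
    rw [← add_smul, (hg j q hq).2]
  -- for `t > 0` the derivative of `G` is the sum of the derivatives of the terms, which are closed
  have hsymm : ∀ q, 0 < q.2 → ∀ ξ η, fderiv ℝ G q ξ (fun _ => η) = fderiv ℝ G q η (fun _ => ξ) := by
    intro q hq ξ η
    obtain ⟨R, T₁, T₂, hT, hb⟩ := exists_mem_box hq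
    let p : Fin d → Poly6 := fun j => latPoly v (n₀ j) (n₁ j) (P j)
    have hd : HasFDerivAt G (∑ j, (lin2
        (∑' x : A, ε x * expPoly (latExp v) (expDX (latExp v) (p j)) (latPar x) q)
        (∑' x : A, ε x * expPoly (latExp v) (expDT (latExp v) (p j)) (latPar x) q)).smulRight
          (F j)) q := by
      have h1 : HasFDerivAt (fun q => ∑ j, (∑' x : A, ε x * expPoly (latExp v) (p j)
          (latPar x) q) • F j) (∑ j, (lin2
        (∑' x : A, ε x * expPoly (latExp v) (expDX (latExp v) (p j)) (latPar x) q)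
        (∑' x : A, ε x * expPoly (latExp v) (expDT (latExp v) (p j)) (latPar x) q)).smulRight
          (F j)) q := HasFDerivAt.fun_sum fun j _ =>
        (hasFDerivAt_tsum_expPoly (isBounded_box _ _ _) (isOpen_box _ _ _)
          (isPreconnected_box _ _ _) (decays_lat_box hv A R hT T₂) hA.summable_lat
          (fun x => hε x) (p j) hb).smul_const (F j)
      refine h1.congr_of_eventuallyEq ?_
      filter_upwards [(isOpen_lt continuous_const continuous_snd).mem_nhds hq] with q' hq'
      rw [hG q' hq', (hs' q' hq').tsum_eq]
    have ht : ∀ x : A, HasFDerivAt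
        (chartForm k 1 (√v • trless (x.1.1 : ℝ) x.1.2.1 x.1.2.2))
        (∑ j, (lin2 (expPoly (latExp v) (expDX (latExp v) (p j)) (latPar x) q)
          (expPoly (latExp v) (expDT (latExp v) (p j)) (latPar x) q)).smulRight (F j)) q := by
      intro x
      have h1 : HasFDerivAt (fun q => ∑ j, expPoly (latExp v) (p j) (latPar x) q • F j)
          (∑ j, (lin2 (expPoly (latExp v) (expDX (latExp v) (p j)) (latPar x) q)
          (expPoly (latExp v) (expDT (latExp v) (p j)) (latPar x) q)).smulRight (F j)) q :=
        HasFDerivAt.fun_sum fun j _ => (hasFDerivAt_expPoly _ _ _ hq).smul_const (F j)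
      refine h1.congr_of_eventuallyEq ?_
      filter_upwards [(isOpen_lt continuous_const continuous_snd).mem_nhds hq] with q' hq'
      rw [hterm x q' hq']
    have hsum : ∀ ξ η : ℝ × ℝ, HasSum (fun x : A => ε x • (∑ j,
        (lin2 (expPoly (latExp v) (expDX (latExp v) (p j)) (latPar x) q)
          (expPoly (latExp v) (expDT (latExp v) (p j)) (latPar x) q)).smulRight (F j)) ξ
            (fun _ => η)) (fderiv ℝ G q ξ (fun _ => η)) := by
      intro ξ η
      rw [hd.fderiv]
      have s : ∀ r : Poly6, HasSum _ _ := fun r => (hA.summable_expPoly_lat hv hε r hq).hasSum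
      have h1 : HasSum (fun x : A => ∑ j, (ξ.1 • (ε x * expPoly (latExp v)
          (expDX (latExp v) (p j)) (latPar x) q) + ξ.2 • (ε x * expPoly (latExp v)
          (expDT (latExp v) (p j)) (latPar x) q)) • F j (fun _ => η)) _ :=
        hasSum_sum fun j _ => (((s (expDX (latExp v) (p j))).const_smul ξ.1).add
          ((s (expDT (latExp v) (p j))).const_smul ξ.2)).smul_const (F j (fun _ => η))
      convert h1 using 1
      · funext x
        rw [_root_.sum_apply, ContinuousAlternatingMap.sum_apply, Finset.smul_sum]
        refine Finset.sum_congr rfl fun j _ => ?_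
        rw [ContinuousLinearMap.smulRight_apply, ContinuousAlternatingMap.smul_apply, lin2_apply,
          smul_smul]
        congr 1
        simp only [Complex.real_smul]
        ring
      · rw [_root_.sum_apply, ContinuousAlternatingMap.sum_apply]
        rfl
    refine (hsum ξ η).unique ?_
    refine (hsum η ξ).congr_fun fun x => ?_
    rw [fderiv_chartForm_symm k 1 (by rw [smul_trless]; exact trace_trless _ _ _) hq (ht x) ξ η]
  refine ⟨fun q hq => (hs' q hq).summable, hk, G, hGc, hG, fun x => ?_, fun q hq ξ η => ?_⟩
  · simp only [G]
    rw [Finset.sum_eq_zero fun j _ => by rw [hg0 j (x, 0) le_rfl, zero_smul], zero_add]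
  -- at `t = 0` closedness follows by continuity
  · have hc : Continuous (fderiv ℝ G) := hGc.continuous_fderiv (by simp)
    have hcl : ∀ ξ η : ℝ × ℝ, Continuous fun q => fderiv ℝ G q ξ (fun _ => η) := fun ξ η =>
      (ContinuousAlternatingMap.apply ℝ (ℝ × ℝ) (Harm k) (fun _ => η)).continuous.comp
        (hc.clm_apply continuous_const)
    have h1 : Filter.Tendsto (fun s : ℝ => (q.1, q.2 + s)) (𝓝[>] 0) (𝓝 q) := by
      have : Continuous fun s : ℝ => (q.1, q.2 + s) := by fun_prop
      have := this.tendsto 0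
      rw [add_zero] at this
      exact this.mono_left nhdsWithin_le_nhds
    refine tendsto_nhds_unique_of_eventuallyEq (((hcl ξ η).tendsto q).comp h1)
      (((hcl η ξ).tendsto q).comp h1) ?_
    filter_upwards [self_mem_nhdsWithin] with s hs
    exact hsymm _ (add_pos_of_nonneg_of_pos hq hs) ξ η

/-! ### The lattice at a cusp -/

/-- A finitely generated subgroup of `M₂(ℚ)` has bounded denominators. -/
theorem exists_denominator {J : Submodule ℤ (Matrix (Fin 2) (Fin 2) ℚ)} (hJ : J.FG) :
    ∃ N : ℕ, 0 < N ∧ ∀ x ∈ J, ∀ i j, ∃ m : ℤ, (N : ℚ) * x i j = m := by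
  refine Submodule.fg_induction (motive := fun J _ => ∃ N : ℕ, 0 < N ∧
    ∀ x ∈ J, ∀ i j, ∃ m : ℤ, (N : ℚ) * x i j = m) (fun y => ?_) (fun J J' _ _ h h' => ?_) J hJ
  · refine ⟨∏ p : Fin 2 × Fin 2, (y p.1 p.2).den, Finset.prod_pos fun p _ => (y p.1 p.2).pos,
      fun x hx i j => ?_⟩
    obtain ⟨n, rfl⟩ := Submodule.mem_span_singleton.1 hx
    obtain ⟨d, hd⟩ := Finset.dvd_prod_of_mem (fun p : Fin 2 × Fin 2 => (y p.1 p.2).den)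
      (Finset.mem_univ (i, j))
    refine ⟨d * (n * (y i j).num), ?_⟩
    have h := Rat.mul_den_eq_num (y i j)
    rw [hd, Matrix.smul_apply, zsmul_eq_mul]
    push_cast
    rw [← h]
    ring
  · obtain ⟨N, hN, h⟩ := h
    obtain ⟨N', hN', h'⟩ := h'
    refine ⟨N * N', mul_pos hN hN', fun x hx i j => ?_⟩
    obtain ⟨y, hy, z, hz, rfl⟩ := Submodule.mem_sup.1 hx
    obtain ⟨m, hm⟩ := h y hy i j
    obtain ⟨m', hm'⟩ := h' z hz i j
    refine ⟨N' * m + N * m', ?_⟩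
    rw [Matrix.add_apply]
    push_cast
    rw [← hm, ← hm']
    ring

/-- Every vector of the rational span of a subgroup has a positive multiple in the subgroup. -/
theorem exists_nsmul_mem {J : Submodule ℤ (Matrix (Fin 2) (Fin 2) ℚ)} {x : Matrix (Fin 2) (Fin 2) ℚ}
    (hx : x ∈ Submodule.span ℚ (J : Set (Matrix (Fin 2) (Fin 2) ℚ))) :
    ∃ d : ℕ, 0 < d ∧ (d : ℚ) • x ∈ J := by
  induction hx using Submodule.span_induction with
  | mem x hx => exact ⟨1, one_pos, by simpa using hx⟩
  | zero => exact ⟨1, one_pos, by simp⟩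
  | add x y _ _ hx hy =>
    obtain ⟨d, hd, h⟩ := hx
    obtain ⟨d', hd', h'⟩ := hy
    refine ⟨d * d', mul_pos hd hd', ?_⟩
    have := J.add_mem (J.smul_mem (d' : ℤ) h) (J.smul_mem (d : ℤ) h')
    rw [← Int.cast_smul_eq_zsmul ℚ, ← Int.cast_smul_eq_zsmul ℚ, smul_smul, smul_smul] at this
    convert this using 1
    rw [smul_add]
    push_cast
    rw [mul_comm (d' : ℚ)]
  | smul r x _ hx =>
    obtain ⟨d, hd, h⟩ := hx
    refine ⟨d * r.den, mul_pos hd r.pos, ?_⟩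
    have := J.smul_mem r.num h
    rw [← Int.cast_smul_eq_zsmul ℚ, smul_smul] at this
    convert this using 1
    rw [smul_smul]
    congr 1
    push_cast
    rw [mul_assoc, mul_comm (r.den : ℚ), Rat.mul_den_eq_num, mul_comm]

/-- Conjugation as a linear map. -/
def conjL (g : SL(2, ℚ)) : Matrix (Fin 2) (Fin 2) ℚ →ₗ[ℤ] Matrix (Fin 2) (Fin 2) ℚ where
  toFun := conj g
  map_add' := conj_add g
  map_smul' n x := by
    rw [← Int.cast_smul_eq_zsmul ℚ n x, conj_smul, Int.cast_smul_eq_zsmul]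
    rfl

section Cusp

variable (L : Submodule ℤ (Matrix (Fin 2) (Fin 2) ℚ)) (h : Matrix (Fin 2) (Fin 2) ℚ) (σ : SL(2, ℤ))

/-- The coset `L + h` in the coordinates of the cusp `σ ∞`: the `(b, a, c)` for which
`σ (b a; c -b) σ⁻¹` lies in `L + h`. -/
def cuspSet : Set (ℚ × ℚ × ℚ) :=
  {x | conj (toQ σ) (trless x.1 x.2.1 x.2.2) ∈ latCoset L h}

variable {L h}

theorem uCusp_eq (a : ℚ) : a • uCusp σ = conj (toQ σ) (trless 0 a 0) := by
  rw [uCusp, ← conj_smul]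
  congr 1
  ext i j
  fin_cases i <;> fin_cases j <;> simp [uVec, trless]

/-- The intersection of `L` with the line of a cusp is generated by `det L_ℓ` times the positive
basis vector. -/
theorem exists_detL (hL : IsEvenLattice L) : ∃ M : ℚ, 0 < M ∧ (M : ℝ) = detL L σ ∧
    ∀ r : ℚ, r • uCusp σ ∈ L ↔ ∃ n : ℤ, r = n * M := by
  obtain ⟨N, hN, hint⟩ := exists_denominator (hL.fg.map (conjL (toQ σ)⁻¹))
  have hNq : (0 : ℚ) < N := by exact_mod_cast hN
  have hu : uCusp σ ∈ Submodule.span ℚ (L : Set (Matrix (Fin 2) (Fin 2) ℚ)) := by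
    rw [hL.span_eq, LinearMap.mem_ker]
    change (conj (toQ σ) (uVec ℚ)).trace = 0
    rw [trace_conj]
    simp [uVec, Matrix.trace_fin_two]
  obtain ⟨d, hd, hdu⟩ := exists_nsmul_mem hu
  have hdq : (0 : ℚ) < d := by exact_mod_cast hd
  -- the multiples of `u_ℓ` in `L` have bounded denominators, so they form an infinite cyclic group
  let H : AddSubgroup ℤ :=
    { carrier := {m | ((m : ℚ) / N) • uCusp σ ∈ L}
      add_mem' := fun {a b} ha hb => by
        simp only [Set.mem_ofPred_eq] at ha hb ⊢
        rw [Int.cast_add, add_div, add_smul]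
        exact L.add_mem ha hb
      zero_mem' := by simp
      neg_mem' := fun {a} ha => by
        simp only [Set.mem_ofPred_eq] at ha ⊢
        rw [Int.cast_neg, neg_div, _root_.neg_smul]
        exact L.neg_mem ha }
  have hH : ∀ r : ℚ, r • uCusp σ ∈ L ↔ ∃ m ∈ H, r = m / N := by
    intro r
    constructor
    · intro hr
      obtain ⟨m, hm⟩ := hint _ (Submodule.mem_map_of_mem hr) 0 1
      have h1 : conjL (toQ σ)⁻¹ (r • uCusp σ) = trless 0 r 0 := by
        rw [uCusp_eq]
        exact conj_inv_conj _ _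
      rw [h1] at hm
      have hr' : r = m / N := by
        rw [eq_div_iff hNq.ne', mul_comm, ← hm]
        simp [trless]
      exact ⟨m, by change ((m : ℚ) / N) • uCusp σ ∈ L; rwa [← hr'], hr'⟩
    · rintro ⟨m, hm, rfl⟩
      exact hm
  obtain ⟨m₀, hm₀⟩ := Int.subgroup_cyclic H
  have hmem : ∀ m, m ∈ H ↔ ∃ n : ℤ, n * m₀ = m := fun m => by
    rw [hm₀, AddSubgroup.mem_closure_singleton]
    simp
  have hm0 : m₀ ≠ 0 := by
    rintro rfl
    obtain ⟨m, hm, hdm⟩ := (hH d).1 hdu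
    obtain ⟨n, hn⟩ := (hmem m).1 hm
    rw [mul_zero] at hn
    rw [← hn, Int.cast_zero, zero_div] at hdm
    exact hdq.ne' hdm
  have hM : ∀ r : ℚ, r • uCusp σ ∈ L ↔ ∃ n : ℤ, r = n * (|(m₀ : ℚ)| / N) := by
    intro r
    rw [hH]
    constructor
    · rintro ⟨m, hm, rfl⟩
      obtain ⟨n, rfl⟩ := (hmem m).1 hm
      rcases abs_choice (m₀ : ℚ) with h | h
      · exact ⟨n, by rw [h]; push_cast; ring⟩
      · exact ⟨-n, by rw [h]; push_cast; ring⟩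
    · rintro ⟨n, rfl⟩
      rcases abs_choice (m₀ : ℚ) with h | h
      · exact ⟨n * m₀, (hmem _).2 ⟨n, rfl⟩, by rw [h]; push_cast; ring⟩
      · exact ⟨-n * m₀, (hmem _).2 ⟨-n, rfl⟩, by rw [h]; push_cast; ring⟩
  have hpos : 0 < |(m₀ : ℚ)| / N := div_pos (abs_pos.2 (by exact_mod_cast hm0)) hNq
  refine ⟨|(m₀ : ℚ)| / N, hpos, ?_, hM⟩
  have hleast : IsLeast {m : ℝ | 0 < m ∧ ∃ r : ℚ, (r : ℝ) = m ∧ r • uCusp σ ∈ L}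
      ((|(m₀ : ℚ)| / N : ℚ) : ℝ) := by
    refine ⟨⟨by exact_mod_cast hpos, _, rfl, (hM _).2 ⟨1, by simp⟩⟩, ?_⟩
    rintro _ ⟨h1, r, rfl, hr⟩
    obtain ⟨n, hn⟩ := (hM r).1 hr
    have hr0 : 0 < r := by exact_mod_cast h1
    have hn0 : 0 < (n : ℚ) := by
      rw [hn] at hr0
      exact pos_of_mul_pos_left hr0 hpos.le
    have hn1 : (1 : ℚ) ≤ n := by exact_mod_cast (show (0 : ℤ) < n by exact_mod_cast hn0)
    have : |(m₀ : ℚ)| / N ≤ r := by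
      rw [hn]
      exact le_mul_of_one_le_left hpos.le hn1
    exact_mod_cast this
  exact hleast.csInf_eq.symm

theorem mem_cuspSet_iff (b a c a' : ℚ) (hx : (b, a, c) ∈ cuspSet L h σ) :
    (b, a', c) ∈ cuspSet L h σ ↔ (a' - a) • uCusp σ ∈ L := by
  have h1 : conj (toQ σ) (trless b a' c) - h = (conj (toQ σ) (trless b a c) - h) +
      (a' - a) • uCusp σ := by
    rw [uCusp_eq, sub_add_eq_add_sub, ← conj_add]
    congr 2
    ext i j
    fin_cases i <;> fin_cases j <;> simp [trless]
  change conj (toQ σ) (trless b a' c) - h ∈ L ↔ _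
  rw [h1]
  exact Submodule.add_mem_iff_right L hx

theorem isCuspSet_cuspSet (hL : IsEvenLattice L) (h : Matrix (Fin 2) (Fin 2) ℚ) {M : ℚ} (hM : 0 < M)
    (hM' : ∀ r : ℚ, r • uCusp σ ∈ L ↔ ∃ n : ℤ, r = n * M) :
    ∃ N : ℕ, IsCuspSet (cuspSet L h σ) N M := by
  obtain ⟨N, hN, hint⟩ := exists_denominator
    ((hL.fg.sup (Submodule.fg_span_singleton h)).map (conjL (toQ σ)⁻¹))
  refine ⟨N, hN, fun x hx => ?_, hM, fun b a ha a' => ?_⟩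
  · have h1 : conj (toQ σ) (trless x.1 x.2.1 x.2.2) ∈ L ⊔ Submodule.span ℤ {h} := by
      rw [← sub_add_cancel (conj (toQ σ) (trless x.1 x.2.1 x.2.2)) h]
      exact Submodule.add_mem_sup hx (Submodule.mem_span_singleton_self h)
    have h2 := hint _ (Submodule.mem_map_of_mem h1)
    have h3 : conjL (toQ σ)⁻¹ (conj (toQ σ) (trless x.1 x.2.1 x.2.2)) =
        trless x.1 x.2.1 x.2.2 := conj_inv_conj _ _
    rw [h3] at h2
    obtain ⟨m₁, h₁⟩ := h2 0 0
    obtain ⟨m₂, h₂⟩ := h2 0 1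
    obtain ⟨m₃, h₃⟩ := h2 1 0
    exact ⟨(m₁, m₂, m₃), by simpa [trless] using h₁, by simpa [trless] using h₂,
      by simpa [trless] using h₃⟩
  · rw [mem_cuspSet_iff σ b a 0 a' ha, hM']
    simp only [sub_eq_iff_eq_add']

theorem trace_eq_zero_of_mem_latCoset (hL : IsEvenLattice L) (hh : h.trace = 0)
    {y : Matrix (Fin 2) (Fin 2) ℚ} (hy : y ∈ latCoset L h) : y.trace = 0 := by
  have h1 : y - h ∈ LinearMap.ker (Matrix.traceLinearMap (Fin 2) ℚ ℚ) := by
    rw [← hL.span_eq]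
    exact Submodule.subset_span hy
  rw [LinearMap.mem_ker, map_sub] at h1
  have h2 : y.trace - h.trace = 0 := h1
  rwa [hh, sub_zero] at h2

/-- The coordinates `(b, a, c)` on the coset `L + h`. -/
def cosetEquiv (hL : IsEvenLattice L) (hh : h.trace = 0) : cuspSet L h σ ≃ latCoset L h where
  toFun x := ⟨conj (toQ σ) (trless x.1.1 x.1.2.1 x.1.2.2), x.2⟩
  invFun y := ⟨(conj (toQ σ)⁻¹ y.1 0 0, conj (toQ σ)⁻¹ y.1 0 1, conj (toQ σ)⁻¹ y.1 1 0), by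
    have ht := trace_eq_zero_of_mem_latCoset hL hh y.2
    have h1 := eq_trless (X := conj (toQ σ)⁻¹ y.1) (by rw [trace_conj, ht])
    change conj (toQ σ) (trless (conj (toQ σ)⁻¹ y.1 0 0) _ _) ∈ latCoset L h
    rw [← h1, conj_conj_inv]
    exact y.2⟩
  left_inv x := by
    refine Subtype.ext ?_
    simp only [conj_inv_conj]
    simp [trless]
  right_inv y := by
    refine Subtype.ext ?_
    have ht := trace_eq_zero_of_mem_latCoset hL hh y.2
    have h1 := eq_trless (X := conj (toQ σ)⁻¹ y.1) (by rw [trace_conj, ht])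
    change conj (toQ σ) (trless _ _ _) = y.1
    rw [← h1, conj_conj_inv]

theorem trace_mul_uCusp (X : Matrix (Fin 2) (Fin 2) ℚ) :
    (X * uCusp σ).trace = conj (toQ σ)⁻¹ X 1 0 := by
  rw [← conj_conj_inv (toQ σ) X, uCusp, conj_mul_conj, trace_conj, conj_conj_inv]
  simp [uVec, Matrix.trace_fin_two, Matrix.mul_apply, Fin.sum_univ_two]

theorem trace_mul_uCusp' (X : Matrix (Fin 2) (Fin 2) ℚ) :
    (X * uCusp' σ).trace = -conj (toQ σ)⁻¹ X 0 1 := by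
  rw [← conj_conj_inv (toQ σ) X, uCusp', conj_mul_conj, trace_conj, conj_conj_inv]
  simp [uVec', Matrix.trace_fin_two, Matrix.mul_apply, Fin.sum_univ_two]

/-- The coordinate `b` on the line `W_ℓ` spanned by `σ (1 0; 0 -1)`. -/
def wEquiv : ℚ ≃ wLine σ where
  toFun b := ⟨conj (toQ σ) (trless b 0 0), by
    refine ⟨by rw [trace_conj, trace_trless], ?_, ?_⟩
    · rw [trace_mul_uCusp, conj_inv_conj]; simp [trless]
    · rw [trace_mul_uCusp', conj_inv_conj]; simp [trless]⟩
  invFun w := conj (toQ σ)⁻¹ w.1 0 0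
  left_inv b := by simp only [conj_inv_conj]; simp [trless]
  right_inv w := by
    obtain ⟨w, h1, h2, h3⟩ := w
    refine Subtype.ext ?_
    rw [trace_mul_uCusp] at h2
    rw [trace_mul_uCusp', neg_eq_zero] at h3
    have h4 := eq_trless (X := conj (toQ σ)⁻¹ w) (by rw [trace_conj, h1])
    rw [h2, h3] at h4
    change conj (toQ σ) (trless _ 0 0) = w
    rw [← h4, conj_conj_inv]

theorem wEquiv_apply (b : ℚ) : (wEquiv σ b : Matrix (Fin 2) (Fin 2) ℚ) =
    conj (toQ σ) (trless b 0 0) := rfl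

theorem uCusp_add_wEquiv (a b : ℚ) : a • uCusp σ + wEquiv σ b = conj (toQ σ) (trless b a 0) := by
  rw [uCusp_eq, wEquiv_apply, ← conj_add]
  congr 1
  ext i j
  fin_cases i <;> fin_cases j <;> simp [trless]

open Classical in
/-- The weight of a point `w` of `W_ℓ` is `1 / det L_ℓ` if the line `ℓ + w` meets `L + h`, and zero
otherwise: at most one of the cosets in the decomposition of `(L + h) ∩ ℓ^⊥` meets that line. -/
theorem hatL_wEquiv (L : Submodule ℤ (Matrix (Fin 2) (Fin 2) ℚ)) (h : Matrix (Fin 2) (Fin 2) ℚ)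
    (b : ℚ) : hatL L h σ (wEquiv σ b) =
    if b ∈ cuspBase (cuspSet L h σ) then 1 / detL L σ else 0 := by
  rw [hatL, if_pos (wEquiv σ b).2]
  have hsub : latL L σ ⊔ latW L σ ≤ L := sup_le inf_le_left inf_le_left
  -- A coset that meets the line `ℚ u + w` is determined by any point where it does.
  have hcos : ∀ C ∈ cuspCosets L h σ, ∀ a : ℚ, a • uCusp σ + wEquiv σ b ∈ C →
      a • uCusp σ + wEquiv σ b ∈ latCoset L h ∧
      C = {y | y - (a • uCusp σ + wEquiv σ b) ∈ latL L σ ⊔ latW L σ} := by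
    rintro C ⟨x, hx, -, rfl⟩ a ha
    simp only [Set.mem_ofPred_eq] at ha
    refine ⟨?_, ?_⟩
    · change _ - h ∈ L
      rw [← sub_add_sub_cancel _ x]
      exact L.add_mem (hsub ha) hx
    · ext y
      simp only [Set.mem_ofPred_eq]
      rw [← sub_add_sub_cancel y (a • uCusp σ + wEquiv σ b) x]
      exact Submodule.add_mem_iff_left _ ha
  split_ifs with hb
  · obtain ⟨a, ha⟩ := hb
    have ha' : a • uCusp σ + wEquiv σ b ∈ latCoset L h := by
      rw [uCusp_add_wEquiv]; exact ha
    have : {C ∈ cuspCosets L h σ | ∃ a : ℚ, a • uCusp σ + wEquiv σ b ∈ C} =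
        {{y | y - (a • uCusp σ + wEquiv σ b) ∈ latL L σ ⊔ latW L σ}} := by
      ext C
      simp only [Set.mem_ofPred_eq, Set.mem_singleton_iff]
      constructor
      · rintro ⟨hC, a', ha''⟩
        obtain ⟨h1, rfl⟩ := hcos C hC a' ha''
        have h2 : (a - a') • uCusp σ ∈ latL L σ ⊔ latW L σ := by
          refine Submodule.mem_sup_left ⟨?_, ?_⟩
          · have := L.sub_mem ha' h1
            rw [sub_sub_sub_cancel_right, add_sub_add_right_eq_sub, ← sub_smul] at this
            exact this
          · exact Submodule.smul_mem _ _ (Submodule.mem_span_singleton_self _)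
        ext y
        simp only [Set.mem_ofPred_eq]
        have h3 : y - (a' • uCusp σ + wEquiv σ b) = y - (a • uCusp σ + wEquiv σ b) +
            (a - a') • uCusp σ := by
          rw [sub_smul]; abel
        rw [h3]
        exact Submodule.add_mem_iff_left _ h2
      · rintro rfl
        refine ⟨⟨_, ha', ?_, rfl⟩, a, by simp⟩
        rw [uCusp_add_wEquiv, trace_mul_uCusp, conj_inv_conj]
        simp [trless]
    rw [this, Set.ncard_singleton, Nat.cast_one]
  · have : {C ∈ cuspCosets L h σ | ∃ a : ℚ, a • uCusp σ + wEquiv σ b ∈ C} = ∅ := by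
      refine Set.eq_empty_of_forall_notMem ?_
      rintro C ⟨hC, a, ha⟩
      refine hb ⟨a, ?_⟩
      have := (hcos C hC a ha).1
      rw [uCusp_add_wEquiv] at this
      exact this
    rw [this, Set.ncard_empty]
    simp

end Cusp

/-! ### The theta series in a chart -/

theorem symAct_one (p : SymV) : symAct (1 : SL(2, ℝ)) p = p := by
  have : symAct (1 : SL(2, ℝ)) = AlgHom.id ℂ SymV := by
    refine MvPolynomial.algHom_ext fun j => ?_
    simp only [symAct, MvPolynomial.aeval_X, conj_one, AlgHom.id_apply]
    have h22 : ((√2 : ℝ) : ℂ) ^ 2 = 2 := by exact_mod_cast Real.sq_sqrt (zero_le_two (α := ℝ))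
    have h : (MvPolynomial.C (((√2 : ℝ) : ℂ) ^ 2)⁻¹ : SymV) * MvPolynomial.C 2 = 1 := by
      rw [← MvPolynomial.C_mul, h22, inv_mul_cancel₀ two_ne_zero, MvPolynomial.C_1]
    fin_cases j <;> simp [toSym, Fin.sum_univ_three, coord, e] <;> ring_nf <;> simp [h]
  rw [this]
  rfl

/-- The action of `SL₂(ℝ)` on the values of forms. -/
def rhoForm {k p : ℕ} {E : Type*} [NormedAddCommGroup E] [NormedSpace ℝ E] (g : SL(2, ℝ)) :
    (E [⋀^Fin p]→L[ℝ] Harm k) →L[ℝ] (E [⋀^Fin p]→L[ℝ] Harm k) :=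
  ContinuousLinearMap.compContinuousAlternatingMapCLM ℝ E (Harm k) (Harm k) (Fin p)
    ((rho k g).restrictScalars ℝ).toContinuousLinearMap

section rhoForm

variable {k p : ℕ} {E : Type*} [NormedAddCommGroup E] [NormedSpace ℝ E] (g g' : SL(2, ℝ))
  (f : E [⋀^Fin p]→L[ℝ] Harm k)

theorem rhoForm_apply (ξ : Fin p → E) : rhoForm g f ξ = rho k g (f ξ) := rfl

theorem rhoForm_smul (c : ℂ) : rhoForm g (c • f) = c • rhoForm g f := by
  ext1 ξ
  exact (rho k g).map_smul c (f ξ)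

theorem rhoForm_mul : rhoForm (g * g') f = rhoForm g (rhoForm g' f) := by
  ext1 ξ
  exact rho_mul g g' (f ξ)

theorem rhoForm_injective : Function.Injective (rhoForm g : (E [⋀^Fin p]→L[ℝ] Harm k) → _) := by
  refine Function.LeftInverse.injective (g := rhoForm g⁻¹) fun f => ?_
  rw [← rhoForm_mul, inv_mul_cancel]
  ext1 ξ
  refine harmVal_injective k ?_
  rw [rhoForm_apply, harmVal_rho, symAct_one]

end rhoForm

theorem toReal_conj (σ : SL(2, ℤ)) (X : Matrix (Fin 2) (Fin 2) ℚ) :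
    toReal (conj (toQ σ) X) = conj (σ : SL(2, ℝ)) (toReal X) := by
  ext i j
  fin_cases i <;> fin_cases j <;>
    simp [toReal, conj, toQ, Matrix.mul_apply, Fin.sum_univ_two, Matrix.adjugate_fin_two]

theorem toReal_trless (b a c : ℚ) : toReal (trless b a c) = trless (b : ℝ) a c := by
  ext i j
  fin_cases i <;> fin_cases j <;> simp [toReal, trless]

theorem phase_conj (τ : ℍ) (g : SL(2, ℚ)) (X : Matrix (Fin 2) (Fin 2) ℚ) :
    phase τ (conj g X) = phase τ X := by
  rw [phase, conj_mul_conj, trace_conj, phase]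

theorem norm_phase (τ : ℍ) (X : Matrix (Fin 2) (Fin 2) ℚ) : ‖phase τ X‖ = 1 := by
  rw [phase, show (Real.pi * Complex.I * ((X * X).trace : ℂ) * τ.re : ℂ) =
    ((Real.pi * (X * X).trace * τ.re : ℝ) : ℂ) * Complex.I by push_cast; ring,
    Complex.norm_exp_ofReal_mul_I]

theorem phase_trless_zero (τ : ℍ) (b a : ℚ) :
    phase τ (trless b a 0) = phase τ (trless b 0 0) := by
  simp [phase, trless, Matrix.trace_fin_two]

theorem hasSum_indicator_of_subtype {ι : Type*} {B : Set ι} {f : ι → ℂ} {s : ℂ}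
    (h : HasSum (fun b : B => f b) s) : HasSum (B.indicator f) s :=
  hasSum_subtype_iff_indicator.1 h

/-- `G` is a smooth form on the plane that extends the theta series in the chart `σ`, is closed for
`t ≥ 0`, and has at `t = 0` the boundary form with the factor `C`, which is the value of the unary
theta series of the cusp up to the power of `Im τ`. -/
structure IsChartExtension (L : Submodule ℤ (Matrix (Fin 2) (Fin 2) ℚ))
    (h : Matrix (Fin 2) (Fin 2) ℚ) (k : ℕ) (τ : ℍ) (σ : SL(2, ℤ)) (C : ℂ)
    (G : ℝ × ℝ → (ℝ × ℝ) [⋀^Fin 1]→L[ℝ] Harm k) : Prop where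
  contDiff : ContDiff ℝ ∞ G
  eq_tsum : ∀ q, 0 < q.2 → G q = (τ.im ^ (-(k : ℝ) / 2)) • ∑' x : latCoset L h,
    phase τ x • chartForm k σ (√τ.im • toReal x) q
  bd : ∀ x, G (x, 0) = C • rhoForm (σ : SL(2, ℝ)) (bdMain k x)
  symm : ∀ q, 0 ≤ q.2 → ∀ ξ η, fderiv ℝ G q ξ (fun _ => η) = fderiv ℝ G q η (fun _ => ξ)
  unary : HasSum (fun w : wLine σ => (hatL L h σ w : ℂ) * phase τ w *
    ((hermiteHt (k + 1) (√τ.im * wCoord σ w) *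
      Real.exp (-Real.pi * (√τ.im * wCoord σ w) ^ 2) : ℝ) : ℂ))
    ((τ.im ^ (((k : ℝ) + 1) / 2) : ℝ) * C)

/-- The form in the chart `σ` is the one of the standard cusp for the coset `σ⁻¹ (L + h)`, carried over
by `ρ(σ)`. -/
theorem exists_isChartExtension {L : Submodule ℤ (Matrix (Fin 2) (Fin 2) ℚ)} (hL : IsEvenLattice L)
    {h : Matrix (Fin 2) (Fin 2) ℚ} (hh : h.trace = 0) (k : ℕ) (τ : ℍ) (σ : SL(2, ℤ)) :
    (∀ q, 0 < q.2 → Summable fun x : latCoset L h =>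
      phase τ x • chartForm k σ (√τ.im • toReal x) q) ∧
    ∃ C G, IsChartExtension L h k τ σ C G := by
  have hv := τ.im_pos
  obtain ⟨M, hM, hMd, hM'⟩ := exists_detL σ hL
  obtain ⟨N, hA⟩ := isCuspSet_cuspSet σ hL h hM hM'
  let ε : ℚ × ℚ × ℚ → ℂ := fun x => phase τ (trless x.1 x.2.1 x.2.2)
  obtain ⟨hs, hk, G, hGc, hG, hG0, hGs⟩ := hA.exists_form hv (ε := ε)
    (fun x => (norm_phase τ _).le) (phase_trless_zero τ) k
  set C₀ := ∑' b : cuspBase (cuspSet L h σ), cuspMain (cuspSet L h σ) M τ.im ε b *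
    ((herm (k + 1)).eval (√2 * (√τ.im * b.1)) : ℝ) with hC₀
  have hterm : ∀ q : ℝ × ℝ, 0 < q.2 → ∀ x : cuspSet L h σ,
      phase τ (cosetEquiv σ hL hh x) • chartForm k σ (√τ.im • toReal (cosetEquiv σ hL hh x)) q =
        rhoForm (σ : SL(2, ℝ)) (cuspTerm k τ.im ε x q) := by
    intro q hq x
    have e1 : (cosetEquiv σ hL hh x : Matrix (Fin 2) (Fin 2) ℚ) =
        conj (toQ σ) (trless x.1.1 x.1.2.1 x.1.2.2) := rfl
    rw [cuspTerm, rhoForm_smul, e1, phase_conj, toReal_conj, toReal_trless, ← conj_smul]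
    congr 1
    ext1 ξ
    rw [chartForm_eq k σ _ hq, conj_inv_conj, rhoForm_apply]
    rw [trace_conj, smul_trless, trace_trless]
  have hsum : ∀ q : ℝ × ℝ, 0 < q.2 → HasSum (fun x : latCoset L h =>
      phase τ x • chartForm k σ (√τ.im • toReal x) q) (rhoForm (σ : SL(2, ℝ)) (G q)) := by
    intro q hq
    rw [← (cosetEquiv σ hL hh).hasSum_iff, hG q hq]
    refine ((rhoForm (σ : SL(2, ℝ))).hasSum (hs q hq).hasSum).congr_fun fun x => ?_
    exact hterm q hq x
  refine ⟨fun q hq => (hsum q hq).summable, (τ.im ^ (-(k : ℝ) / 2) : ℝ) * C₀,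
    fun q => (τ.im ^ (-(k : ℝ) / 2)) • rhoForm (σ : SL(2, ℝ)) (G q), ?_, fun q hq => ?_, fun x => ?_,
    fun q hq ξ η => ?_, ?_⟩
  · exact (((rhoForm (σ : SL(2, ℝ))).contDiff.comp hGc).const_smul
      (τ.im ^ (-(k : ℝ) / 2) : ℝ))
  · rw [(hsum q hq).tsum_eq]
  · simp only [hG0]
    rw [rhoForm_smul, ← Complex.coe_smul, smul_smul]
  · have hd' : HasFDerivAt (fun q => rhoForm (σ : SL(2, ℝ)) (G q))
        ((rhoForm (σ : SL(2, ℝ))).comp (fderiv ℝ G q)) q :=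
      (rhoForm (σ : SL(2, ℝ))).hasFDerivAt.comp q (hGc.differentiable (by simp) q).hasFDerivAt
    have hd : HasFDerivAt (fun q => (τ.im ^ (-(k : ℝ) / 2)) • rhoForm (σ : SL(2, ℝ)) (G q))
        ((τ.im ^ (-(k : ℝ) / 2)) • (rhoForm (σ : SL(2, ℝ))).comp (fderiv ℝ G q)) q :=
      hd'.const_smul (τ.im ^ (-(k : ℝ) / 2) : ℝ)
    rw [hd.fderiv]
    change (τ.im ^ (-(k : ℝ) / 2)) • rho k σ (fderiv ℝ G q ξ fun _ => η) =
      (τ.im ^ (-(k : ℝ) / 2)) • rho k σ (fderiv ℝ G q η fun _ => ξ)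
    rw [hGs q hq]
  · have hval : ((τ.im ^ (((k : ℝ) + 1) / 2) : ℝ) : ℂ) * ((τ.im ^ (-(k : ℝ) / 2) : ℝ) * C₀) =
        (√τ.im : ℂ) * C₀ := by
      rw [← mul_assoc, ← Complex.ofReal_mul, ← Real.rpow_add hv, Real.sqrt_eq_rpow]
      congr 3
      ring
    rw [hval, ← (wEquiv σ).hasSum_iff]
    have h1 := (hasSum_indicator_of_subtype (f := fun b : ℚ => phase τ (trless b 0 0) *
      ((1 / (√τ.im * M) * Real.exp (-(2 * Real.pi * τ.im * (b : ℝ) ^ 2)) : ℝ) : ℂ) *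
        ((herm (k + 1)).eval (√2 * (√τ.im * b)) : ℝ)) hk.hasSum).mul_left (√τ.im : ℂ)
    refine h1.congr_fun fun b => ?_
    have hw : wCoord σ (wEquiv σ b) = √2 * b := by
      rw [wCoord, wEquiv_apply, conj_inv_conj, toReal_trless, coord_trless]
      rfl
    have hs2 : (√τ.im) ^ 2 = τ.im := Real.sq_sqrt hv.le
    have h22 : (√2 : ℝ) ^ 2 = 2 := Real.sq_sqrt (by norm_num)
    have hsv : (√τ.im : ℂ) ≠ 0 := by exact_mod_cast (Real.sqrt_pos.2 hv).ne'
    have he : -Real.pi * (√τ.im * (√2 * b)) ^ 2 = -(2 * Real.pi * τ.im * (b : ℝ) ^ 2) := by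
      rw [mul_pow, mul_pow, hs2, h22]; ring
    simp only [Function.comp]
    rw [hatL_wEquiv, wEquiv_apply, phase_conj, ← wEquiv_apply, hw, he, hermiteHt_eq,
      show √τ.im * (√2 * (b : ℝ)) = √2 * (√τ.im * b) by ring, ← hMd]
    by_cases hb : b ∈ cuspBase (cuspSet L h σ)
    · rw [if_pos hb, Set.indicator_of_mem hb]
      push_cast
      field_simp
    · rw [if_neg hb, Set.indicator_of_notMem hb]
      simp

/-! ### Changes of charts -/

theorem det_eq_one_int (σ : SL(2, ℤ)) : σ 0 0 * σ 1 1 - σ 0 1 * σ 1 0 = 1 := by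
  rw [← Matrix.det_fin_two]; exact σ.2

/-- The elements of `SL₂(ℤ)` that fix the cusp `∞` are, up to sign, the translations. -/
theorem exists_translation {σ : SL(2, ℤ)} (hσ : σ 1 0 = 0) : ∃ m : ℤ,
    (∀ q, trans σ q = (q.1 + m, q.2)) ∧
    ∀ (k : ℕ) (v : Harm k), rho k (σ : SL(2, ℝ)) v = rho k (nMat m) v := by
  have hdet := det_eq_one_int σ
  rw [hσ, mul_zero, sub_zero] at hdet
  rcases Int.eq_one_or_neg_one_of_mul_eq_one' hdet with ⟨h0, h1⟩ | ⟨h0, h1⟩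
  · refine ⟨σ 0 1, fun q => ?_, fun k v => ?_⟩
    · have : chartPt σ q = chartPt 1 q + (σ 0 1 : ℝ) := by
        rw [chartPt_eq, hσ, h0, h1]; simp
      rw [trans, this, Complex.add_re, Complex.add_im, chartPt_one_re, chartPt_one_im]
      simp
    · congr 2
      ext i j
      fin_cases i <;> fin_cases j <;> simp [nMat, hσ, h0, h1]
  · refine ⟨-σ 0 1, fun q => ?_, fun k v => ?_⟩
    · have : chartPt σ q = chartPt 1 q + ((-σ 0 1 : ℤ) : ℝ) := by
        rw [chartPt_eq, hσ, h0, h1]; simp; ring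
      rw [trans, this, Complex.add_re, Complex.add_im, chartPt_one_re, chartPt_one_im]
      simp
    · rw [← rho_neg]
      congr 2
      ext i j
      fin_cases i <;> fin_cases j <;> simp [nMat, hσ, h0, h1]

theorem chartPt_one_trans (σ : SL(2, ℤ)) (q : ℝ × ℝ) : chartPt 1 (trans σ q) = chartPt σ q := by
  refine Complex.ext ?_ ?_
  · rw [chartPt_one_re]; rfl
  · rw [chartPt_one_im, trans, inv_inv]

theorem trans_snd_pos (σ : SL(2, ℤ)) {q : ℝ × ℝ} (hq : 0 < q.2) : 0 < (trans σ q).2 :=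
  inv_pos.2 (chartPt_im_pos σ hq)

theorem chartPt_trans (σ σ' : SL(2, ℤ)) {q : ℝ × ℝ} (hq : 0 < q.2) :
    chartPt σ (trans σ' q) = chartPt (σ * σ') q := by
  have hz : 0 < (chartPt 1 q).im := by rw [chartPt_one_im]; positivity
  have h1 := denom_ne_zero' σ' hz
  have h2 := denom_ne_zero' (σ * σ') hz
  have h3 := denom_ne_zero' σ (chartPt_im_pos σ' hq)
  rw [chartPt_eq σ (trans σ' q), chartPt_one_trans, chartPt_eq (σ * σ'), div_eq_div_iff h3 h2]
  have hw : chartPt σ' q * ((σ' 1 0 : ℂ) * chartPt 1 q + σ' 1 1) =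
      (σ' 0 0 : ℂ) * chartPt 1 q + σ' 0 1 := by
    rw [chartPt_eq σ']
    exact div_mul_cancel₀ _ h1
  simp only [Matrix.SpecialLinearGroup.coe_mul, Matrix.mul_apply, Fin.sum_univ_two]
  push_cast
  linear_combination ((σ 0 0 : ℂ) * σ 1 1 - σ 0 1 * σ 1 0) * hw

theorem differentiableAt_trans (σ : SL(2, ℤ)) {q : ℝ × ℝ} (hq : 0 < q.2) :
    DifferentiableAt ℝ (trans σ) q := by
  have h := differentiableAt_chartPt σ hq
  have h1 : DifferentiableAt ℝ (fun q => (chartPt σ q).re) q :=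
    Complex.reCLM.differentiableAt.comp q h
  have h2 : DifferentiableAt ℝ (fun q => (chartPt σ q).im) q :=
    Complex.imCLM.differentiableAt.comp q h
  exact h1.prodMk (h2.inv (chartPt_im_pos σ hq).ne')

/-- Pullback of the Schwartz form under a change of charts. -/
theorem chartForm_trans (k : ℕ) (σ σ' : SL(2, ℤ)) (X : Matrix (Fin 2) (Fin 2) ℝ) {q : ℝ × ℝ}
    (hq : 0 < q.2) : (chartForm k σ X (trans σ' q)).compContinuousLinearMap
      (fderiv ℝ (trans σ') q) = chartForm k (σ * σ') X q := by
  have hev : chartPt (σ * σ') =ᶠ[𝓝 q] chartPt σ ∘ trans σ' := by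
    filter_upwards [(isOpen_lt continuous_const continuous_snd).mem_nhds hq] with q' hq'
    exact (chartPt_trans σ σ' hq').symm
  have h1 : fderiv ℝ (chartPt (σ * σ')) q =
      (fderiv ℝ (chartPt σ) (trans σ' q)).comp (fderiv ℝ (trans σ') q) := by
    rw [hev.fderiv_eq]
    exact fderiv_comp q (differentiableAt_chartPt σ (trans_snd_pos σ' hq))
      (differentiableAt_trans σ' hq)
  rw [chartForm, chartForm, h1, chartPt_trans σ σ' hq]
  rfl

/-- Equivariance of the Schwartz form. -/
theorem chartForm_mul (k : ℕ) (γ σ : SL(2, ℤ)) {X : Matrix (Fin 2) (Fin 2) ℝ} (hX : X.trace = 0)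
    {q : ℝ × ℝ} (hq : 0 < q.2) : chartForm k (γ * σ) (conj (γ : SL(2, ℝ)) X) q =
      rhoForm (γ : SL(2, ℝ)) (chartForm k σ X q) := by
  ext1 ξ
  rw [rhoForm_apply, chartForm_eq k (γ * σ) (by rw [trace_conj, hX]) hq, chartForm_eq k σ hX hq,
    ← rho_mul, map_mul, mul_inv_rev, ← conj_conj, conj_inv_conj]

/-- The Schwartz form is determined by its pullback to the standard chart. -/
theorem exists_phiV_eq (k : ℕ) (z : ℍ) : ∃ (q : ℝ × ℝ) (B : ℂ →L[ℝ] ℝ × ℝ), 0 < q.2 ∧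
    ∀ X, phiV k X z = (chartForm k 1 X q).compContinuousLinearMap B := by
  have hz := z.im_pos
  have hq : 0 < (z.re, z.im⁻¹).2 := inv_pos.2 hz
  obtain ⟨D, hD, hd⟩ := hasFDerivAt_chartPt_one hq
  have hpt : chartPt 1 (z.re, z.im⁻¹) = z := by
    refine Complex.ext ?_ ?_
    · rw [chartPt_one_re]; rfl
    · rw [chartPt_one_im, inv_inv]; rfl
  -- the inverse of the derivative of the chart
  let B : ℂ →L[ℝ] ℝ × ℝ := Complex.reCLM.prod (-(z.im⁻¹ ^ 2) • Complex.imCLM)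
  have hDB : ∀ w, D (B w) = w := fun w => by
    have h1 : (B w).1 = w.re := rfl
    have h2 : (B w).2 = -(z.im⁻¹ ^ 2) * w.im := rfl
    have : z.im⁻¹⁻¹ ^ 2 * (-(z.im⁻¹ ^ 2) * w.im) = -w.im := by field_simp
    rw [hD, h1, h2, this]
    refine Complex.ext ?_ ?_ <;> simp
  refine ⟨_, B, hq, fun X => ?_⟩
  rw [chartForm, hd.fderiv, hpt, ofComplex_apply]
  ext1 ξ
  rw [ContinuousAlternatingMap.compContinuousLinearMap_apply,
    ContinuousAlternatingMap.compContinuousLinearMap_apply]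
  congr 1
  funext j
  exact (hDB (ξ j)).symm

/-- Convergence in the standard chart implies convergence on the upper half plane. -/
theorem summable_phiV {ι : Type*} {k : ℕ} {c : ι → ℂ} {X : ι → Matrix (Fin 2) (Fin 2) ℝ}
    (h : ∀ q, 0 < q.2 → Summable fun i => c i • chartForm k 1 (X i) q) (z : ℍ) :
    Summable fun i => c i • phiV k (X i) z := by
  obtain ⟨q, B, hq, hB⟩ := exists_phiV_eq k z
  have h1 := (h q hq).map (ContinuousAlternatingMap.compContinuousLinearMapCLM (F := Harm k)
    (ι := Fin 1) B) (ContinuousLinearMap.continuous _)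
  refine h1.congr fun i => ?_
  rw [hB]
  rfl

/-! ### The primitive on the boundary -/

theorem hasWeakFDerivAt_symAct_nMat (f : SymV) (x : ℝ) :
    HasWeakFDerivAt (fun y : ℝ => symAct (nMat y) f)
      (fun ξ => (ξ : ℂ) • symAct (nMat x) (raise f)) x := by
  induction f using MvPolynomial.induction_on with
  | C a =>
    have h1 : raise (MvPolynomial.C a) = 0 := Derivation.map_algebraMap raise a
    rw [h1]
    simp only [symAct, MvPolynomial.aeval_C, map_zero, smul_zero]
    exact hasWeakFDerivAt_const _ x
  | add p q hp hq =>
    simp only [map_add, smul_add]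
    exact hp.add hq
  | mul_X p j hp =>
    have hcoord : ∀ y : ℝ, symAct (nMat y) (MvPolynomial.X j) =
        vecSym fun i => (coord (conj (nMat y) (e j)) i : ℂ) := fun y => by
      rw [← toSym_eq_vecSym]; simp [symAct]
    have hconj : ∀ (y b a c : ℝ), conj (nMat y) (trless b a c) =
        trless (b + y * c) (a - 2 * y * b - y ^ 2 * c) c := fun y b a c => by
      rw [conj_trless]
      simp only [nMat, trless]
      ext i j
      fin_cases i <;> fin_cases j <;> simp <;> ring
    obtain ⟨b, a, c, he⟩ : ∃ b a c, e j = trless b a c := ⟨_, _, _, eq_trless (trace_e j)⟩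
    have hY : uVec ℝ * e j - e j * uVec ℝ = trless c (-2 * b) 0 := by
      rw [he]
      ext i j
      fin_cases i <;> fin_cases j <;> simp [uVec, trless] <;> ring
    have hy : ∀ i, ∃ D : ℝ →L[ℝ] ℂ, (∀ ξ, D ξ = (ξ : ℂ) *
        (coord (conj (nMat x) (trless c (-2 * b) 0)) i : ℂ)) ∧
        HasFDerivAt (fun y : ℝ => (coord (conj (nMat y) (e j)) i : ℂ)) D x := by
      intro i
      obtain ⟨μ, hμ⟩ := exists_linearMap_coord i
      have hd : HasDerivAt (fun y : ℝ => coord (conj (nMat y) (e j)) i)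
          (coord (conj (nMat x) (trless c (-2 * b) 0)) i) x := by
        have h1 : ∀ y : ℝ, coord (conj (nMat y) (e j)) i =
            μ (trless b a c) + y * μ (trless c (-2 * b) 0) + y ^ 2 * μ (trless 0 (-c) 0) := by
          intro y
          have h0 : trless (b + y * c) (a - 2 * y * b - y ^ 2 * c) c = trless b a c +
              y • trless c (-2 * b) 0 + y ^ 2 • trless 0 (-c) 0 := by
            ext i j
            fin_cases i <;> fin_cases j <;> simp [trless] <;> ring
          rw [he, hconj, ← hμ, h0, map_add, map_add, map_smul, map_smul, smul_eq_mul, smul_eq_mul]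
        have h2 : coord (conj (nMat x) (trless c (-2 * b) 0)) i =
            1 * μ (trless c (-2 * b) 0) + 2 * x * μ (trless 0 (-c) 0) := by
          have h0 : trless (c + x * 0) (-2 * b - 2 * x * c - x ^ 2 * 0) 0 = trless c (-2 * b) 0 +
              (2 * x) • trless 0 (-c) 0 := by
            ext i j
            fin_cases i <;> fin_cases j <;> simp [trless]
            ring
          rw [hconj, ← hμ, h0, map_add, map_smul, smul_eq_mul, one_mul]
        rw [funext h1, h2]
        have h3 := (((hasDerivAt_id x).mul_const (μ (trless c (-2 * b) 0))).const_add
          (μ (trless b a c))).fun_add (((hasDerivAt_id x).pow 2).mul_const (μ (trless 0 (-c) 0)))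
        simpa using h3
      refine ⟨_, fun ξ => ?_, hd.ofReal_comp.hasFDerivAt⟩
      simp
    have h := hp.mul_vecSym hy
    simp only [map_mul, hcoord]
    refine h.congr fun ξ => ?_
    rw [Derivation.leibniz]
    have hr : raise (MvPolynomial.X j) = toSym (trless c (-2 * b) 0) := by
      rw [← hY]
      exact MvPolynomial.mkDerivation_X _ _ _
    have hv : vecSym (fun i => (ξ : ℂ) * (coord (conj (nMat x) (trless c (-2 * b) 0)) i : ℂ)) =
        (ξ : ℂ) • symAct (nMat x) (raise (MvPolynomial.X j)) := by
      rw [hr, symAct_toSym _ (trace_trless _ _ _), toSym_eq_vecSym]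
      simp only [vecSym, Finset.smul_sum, MvPolynomial.smul_eq_C_mul, map_mul, mul_assoc]
    rw [hv, smul_eq_mul, smul_eq_mul, map_add, map_mul, map_mul, hcoord]
    simp only [MvPolynomial.smul_eq_C_mul]
    ring

theorem hasDerivAt_rho_nMat {k : ℕ} {v v' : Harm k} (h : harmVal k v' = raise (harmVal k v)) (x : ℝ) :
    HasDerivAt (fun y => rho k (nMat y) v) (rho k (nMat x) v') x := by
  obtain ⟨T, hT⟩ := LinearMap.exists_leftInverse_of_injective (harmVal k)
    (LinearMap.ker_eq_bot.2 (harmVal_injective k))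
  have hT' : ∀ w, T (harmVal k w) = w := fun w => LinearMap.congr_fun hT w
  have h1 := (hasWeakFDerivAt_symAct_nMat (harmVal k v) x).hasFDerivAt (k := k)
    (F := fun y => rho k (nMat y) v)
    (D := (ContinuousLinearMap.id ℝ ℝ).smulRight (rho k (nMat x) v')) T
    (fun y => by rw [← harmVal_rho, hT'])
    (fun ξ => by
      rw [map_smul, ← h, ← harmVal_rho, hT', Complex.coe_smul]
      rfl)
  have h2 := h1.hasDerivAt
  simpa using h2

/-- `e₂^k` is not divisible by `r²`. -/
theorem harmProj_pow_ne_zero (k : ℕ) : harmProj k (MvPolynomial.X 1 ^ k) ≠ 0 := by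
  intro h
  have hX : (MvPolynomial.X 1 ^ k : SymV).IsHomogeneous k := by
    simpa using (MvPolynomial.isHomogeneous_X ℂ (1 : Fin 3)).pow k
  obtain ⟨p, hp⟩ := rSq_dvd_sub_harmVal_harmProj hX
  rw [h, map_zero, sub_zero] at hp
  -- evaluate at a point of the cone `r² = 0` with second coordinate `1`
  have := congrArg (MvPolynomial.eval ![0, 1, 1]) hp
  simp [rSq, Fin.sum_univ_three, sgn] at this

theorem bdMain_ne_zero (k : ℕ) (x : ℝ) : bdMain k x ≠ 0 := by
  intro h
  have h1 := DFunLike.congr_fun h (fun _ => (1, 0))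
  have h2 : (-(1 / (2 : ℝ) ^ ((k : ℝ) + 1 / 2))) • (1 : ℝ) •
      rho k (nMat x) (harmProj k (MvPolynomial.X 1 ^ k)) = 0 := h1
  have h3 : (2 : ℝ) ^ ((k : ℝ) + 1 / 2) ≠ 0 := by positivity
  rw [one_smul, smul_eq_zero] at h2
  rcases h2 with h2 | h2
  · rw [neg_eq_zero, one_div, inv_eq_zero] at h2
    exact h3 h2
  · refine harmProj_pow_ne_zero k (harmVal_injective k ?_)
    have h4 := congrArg (symAct (nMat x)⁻¹) (congrArg (harmVal k) h2)
    rw [harmVal_rho, ← symAct_mul, inv_mul_cancel, symAct_one, map_zero, map_zero] at h4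
    rw [map_zero]
    exact h4

/-! ### The form on the compactification -/

section Extension

variable {L : Submodule ℤ (Matrix (Fin 2) (Fin 2) ℚ)} {h : Matrix (Fin 2) (Fin 2) ℚ}
  {k : ℕ} {τ : ℍ}

theorem eq_of_eq_of_pos {E : Type*} [TopologicalSpace E] [T2Space E] {f g : ℝ × ℝ → E}
    (hf : Continuous f) (hg : Continuous g) (x : ℝ) (h : ∀ s, 0 < s → f (x, s) = g (x, s)) :
    f (x, 0) = g (x, 0) := by
  have h1 : Filter.Tendsto (fun s : ℝ => (x, s)) (𝓝[>] 0) (𝓝 (x, 0)) :=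
    ((Continuous.prodMk_right x).tendsto 0).mono_left nhdsWithin_le_nhds
  refine tendsto_nhds_unique_of_eventuallyEq ((hf.tendsto _).comp h1) ((hg.tendsto _).comp h1) ?_
  filter_upwards [self_mem_nhdsWithin] with s hs
  exact h s hs

theorem coe_smul_form {p : ℕ} {E : Type*} [NormedAddCommGroup E] [NormedSpace ℝ E] (r : ℝ)
    (f : E [⋀^Fin p]→L[ℝ] Harm k) : (r : ℂ) • f = r • f :=
  ContinuousAlternatingMap.ext fun ξ => Complex.coe_smul r (f ξ)

theorem tsum_compContinuousLinearMap {ι E E' : Type*} [NormedAddCommGroup E] [NormedSpace ℝ E]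
    [NormedAddCommGroup E'] [NormedSpace ℝ E'] {f : ι → E [⋀^Fin 1]→L[ℝ] Harm k} (hf : Summable f)
    (D : E' →L[ℝ] E) : (∑' i, f i).compContinuousLinearMap D =
      ∑' i, (f i).compContinuousLinearMap D :=
  ((ContinuousAlternatingMap.compContinuousLinearMapCLM (F := Harm k) (ι := Fin 1)
    D).hasSum hf.hasSum).tsum_eq.symm

theorem nMat_add (x y : ℝ) : nMat (x + y) = nMat x * nMat y := by
  refine Subtype.ext ?_
  change !![1, x + y; 0, 1] = !![1, x; 0, 1] * !![1, y; 0, 1]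
  rw [Matrix.mul_fin_two]
  simp [add_comm]

/-- An element of `Γ` permutes the coset `L + h`. -/
def cosetPerm {γ : SL(2, ℤ)} (h₁ : ∀ x ∈ latCoset L h, conj (toQ γ) x ∈ latCoset L h)
    (h₂ : ∀ x ∈ latCoset L h, conj (toQ γ⁻¹) x ∈ latCoset L h) : latCoset L h ≃ latCoset L h where
  toFun x := ⟨conj (toQ γ) x, h₁ x x.2⟩
  invFun x := ⟨conj (toQ γ⁻¹) x, h₂ x x.2⟩
  left_inv x := Subtype.ext (by
    change conj (toQ γ⁻¹) (conj (toQ γ) x) = x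
    rw [toQ, toQ, map_inv, conj_inv_conj])
  right_inv x := Subtype.ext (by
    change conj (toQ γ) (conj (toQ γ⁻¹) x) = x
    rw [toQ, toQ, map_inv, conj_conj_inv])

theorem trace_smul_toReal (r : ℝ) {X : Matrix (Fin 2) (Fin 2) ℚ} (hX : X.trace = 0) :
    (r • toReal X).trace = 0 := by
  have : (toReal X).trace = (X.trace : ℝ) := by
    simp [toReal, Matrix.trace_fin_two]
  rw [Matrix.trace_smul, this, hX, Rat.cast_zero, smul_zero]

/-- Equivariance of the theta series in the interior. -/
theorem tsum_chartForm_trans (hL : IsEvenLattice L) (hh : h.trace = 0) {γ σ σ' ρ : SL(2, ℤ)}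
    (hγ : σ' * ρ = γ * σ) (h₁ : ∀ x ∈ latCoset L h, conj (toQ γ) x ∈ latCoset L h)
    (h₂ : ∀ x ∈ latCoset L h, conj (toQ γ⁻¹) x ∈ latCoset L h)
    (hs : ∀ σ : SL(2, ℤ), ∀ q, 0 < q.2 → Summable fun x : latCoset L h =>
      phase τ x • chartForm k σ (√τ.im • toReal x) q) {q : ℝ × ℝ} (hq : 0 < q.2) :
    (∑' x : latCoset L h, phase τ x • chartForm k σ' (√τ.im • toReal x)
        (trans ρ q)).compContinuousLinearMap (fderiv ℝ (trans ρ) q) =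
      rhoForm (γ : SL(2, ℝ)) (∑' x : latCoset L h,
        phase τ x • chartForm k σ (√τ.im • toReal x) q) := by
  have e1 := (ContinuousAlternatingMap.compContinuousLinearMapCLM (F := Harm k) (ι := Fin 1)
    (fderiv ℝ (trans ρ) q)).hasSum (hs σ' _ (trans_snd_pos ρ hq)).hasSum
  rw [← (cosetPerm h₁ h₂).hasSum_iff] at e1
  have e2 := (rhoForm (γ : SL(2, ℝ))).hasSum (hs σ q hq).hasSum
  refine e1.unique (e2.congr_fun fun x => ?_)
  have hx : (cosetPerm h₁ h₂ x : Matrix (Fin 2) (Fin 2) ℚ) = conj (toQ γ) x := rfl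
  have ht := trace_eq_zero_of_mem_latCoset hL hh x.2
  have e3 : ∀ (c : ℂ) (f : (ℝ × ℝ) [⋀^Fin 1]→L[ℝ] Harm k),
      ContinuousAlternatingMap.compContinuousLinearMapCLM (fderiv ℝ (trans ρ) q) (c • f) =
        c • f.compContinuousLinearMap (fderiv ℝ (trans ρ) q) := fun _ _ => rfl
  simp only [Function.comp]
  rw [e3, hx, chartForm_trans k σ' ρ _ hq, hγ, phase_conj, toReal_conj, ← conj_smul,
    chartForm_mul k γ σ (trace_smul_toReal _ ht) hq, rhoForm_smul]

theorem rhoForm_bdMain {ρ : SL(2, ℤ)} {m : ℤ}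
    (hρ : ∀ (k : ℕ) (v : Harm k), rho k (ρ : SL(2, ℝ)) v = rho k (nMat m) v) (x : ℝ) :
    rhoForm (ρ : SL(2, ℝ)) (bdMain k x) = bdMain k (x + m) := by
  ext1 ξ
  have hn : nMat (x + m) = nMat m * nMat x := by rw [add_comm, nMat_add]
  rw [rhoForm_apply, hρ]
  change rho k (nMat m) ((-(1 / (2 : ℝ) ^ ((k : ℝ) + 1 / 2))) • (ξ 0).1 • rho k (nMat x) _) =
    (-(1 / (2 : ℝ) ^ ((k : ℝ) + 1 / 2))) • (ξ 0).1 • rho k (nMat (x + m)) _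
  rw [hn, rho_mul, ← Complex.coe_smul, ← Complex.coe_smul, map_smul, map_smul, Complex.coe_smul,
    Complex.coe_smul]

variable {C C' : ℂ} {G G' : ℝ × ℝ → (ℝ × ℝ) [⋀^Fin 1]→L[ℝ] Harm k} {γ σ σ' ρ : SL(2, ℤ)}

theorem IsChartExtension.trans_of_pos (hG : IsChartExtension L h k τ σ C G)
    (hG' : IsChartExtension L h k τ σ' C' G') (hL : IsEvenLattice L) (hh : h.trace = 0)
    (hγ : σ' * ρ = γ * σ) (h₁ : ∀ x ∈ latCoset L h, conj (toQ γ) x ∈ latCoset L h)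
    (h₂ : ∀ x ∈ latCoset L h, conj (toQ γ⁻¹) x ∈ latCoset L h) {q : ℝ × ℝ} (hq : 0 < q.2) :
    (G' (trans ρ q)).compContinuousLinearMap (fderiv ℝ (trans ρ) q) =
      rhoForm (γ : SL(2, ℝ)) (G q) := by
  have hs := fun σ => (exists_isChartExtension hL hh k τ σ).1
  have e := tsum_chartForm_trans hL hh hγ h₁ h₂ hs hq
  rw [hG.eq_tsum q hq, hG'.eq_tsum _ (trans_snd_pos ρ hq), map_smul, ← e]
  rfl

theorem fderiv_trans_of_translation {m : ℤ} (hm : ∀ q, trans ρ q = (q.1 + m, q.2)) (q : ℝ × ℝ) :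
    fderiv ℝ (trans ρ) q = ContinuousLinearMap.id ℝ (ℝ × ℝ) := by
  have : trans ρ = fun q => q + ((m : ℝ), 0) := funext fun q => by rw [hm]; ext <;> simp
  rw [this, fderiv_add_const]
  exact fderiv_id

/-- On the boundary the change of charts is a translation, and equivariance there follows by
continuity. -/
theorem IsChartExtension.trans_of_eq_zero (hG : IsChartExtension L h k τ σ C G)
    (hG' : IsChartExtension L h k τ σ' C' G') (hL : IsEvenLattice L) (hh : h.trace = 0)
    (hγ : σ' * ρ = γ * σ) (h₁ : ∀ x ∈ latCoset L h, conj (toQ γ) x ∈ latCoset L h)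
    (h₂ : ∀ x ∈ latCoset L h, conj (toQ γ⁻¹) x ∈ latCoset L h) {m : ℤ}
    (hm : ∀ q, trans ρ q = (q.1 + m, q.2)) (x : ℝ) :
    G' (x + m, 0) = rhoForm (γ : SL(2, ℝ)) (G (x, 0)) := by
  refine eq_of_eq_of_pos (f := fun q : ℝ × ℝ => G' (q.1 + m, q.2))
    (g := fun q => rhoForm (γ : SL(2, ℝ)) (G q)) (hG'.contDiff.continuous.comp (by fun_prop))
    ((rhoForm (γ : SL(2, ℝ))).continuous.comp hG.contDiff.continuous) x fun s hs => ?_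
  have e := hG.trans_of_pos hG' hL hh hγ h₁ h₂ (q := (x, s)) hs
  rw [hm, fderiv_trans_of_translation hm] at e
  exact e

/-- The factors of the boundary forms at equivalent cusps agree. -/
theorem IsChartExtension.const_eq (hG : IsChartExtension L h k τ σ C G)
    (hG' : IsChartExtension L h k τ σ' C' G') (hL : IsEvenLattice L) (hh : h.trace = 0)
    (hγ : σ' * ρ = γ * σ) (h₁ : ∀ x ∈ latCoset L h, conj (toQ γ) x ∈ latCoset L h)
    (h₂ : ∀ x ∈ latCoset L h, conj (toQ γ⁻¹) x ∈ latCoset L h) (hρ : ρ 1 0 = 0) : C' = C := by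
  obtain ⟨m, hm, hv⟩ := exists_translation hρ
  have e := hG.trans_of_eq_zero hG' hL hh hγ h₁ h₂ hm 0
  rw [hG.bd, hG'.bd, rhoForm_smul, ← rhoForm_mul, ← map_mul, ← hγ, map_mul, rhoForm_mul,
    rhoForm_bdMain hv] at e
  have h0 : rhoForm (σ' : SL(2, ℝ)) (bdMain k (0 + m)) ≠ 0 := fun h0 =>
    bdMain_ne_zero k (0 + m) (rhoForm_injective (σ' : SL(2, ℝ)) (by rw [h0, map_zero]))
  exact smul_left_injective ℂ h0 e

/-- The unary theta series of a multiple of the Schwartz function of the cusp. -/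
theorem IsChartExtension.hasSum_thetaBdTerm {p : ℕ} (hG : IsChartExtension L h k τ σ C G)
    {φ : SL(2, ℤ) → ℝ → ℝ → ℝ [⋀^Fin p]→L[ℝ] Harm k} {x c : ℝ} {K : ℝ [⋀^Fin p]→L[ℝ] Harm k}
    (hφ : ∀ w, φ σ w x = (c * hermiteHt (k + 1) w * Real.exp (-Real.pi * w ^ 2)) • K) :
    HasSum (fun w : wLine σ => thetaBdTerm φ L h τ σ x w)
      ((((τ.im ^ (((k : ℝ) + 1) / 2) : ℝ) * C) * (c : ℂ)) • K) := by
  refine ((hG.unary.mul_right (c : ℂ)).smul_const K).congr_fun fun w => ?_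
  rw [thetaBdTerm, hφ, ← coe_smul_form, ← coe_smul_form, smul_smul, smul_smul]
  congr 1
  push_cast
  ring

theorem IsChartExtension.thetaBd_eq {p : ℕ} (hG : IsChartExtension L h k τ σ C G)
    {φ : SL(2, ℤ) → ℝ → ℝ → ℝ [⋀^Fin p]→L[ℝ] Harm k} {x c : ℝ} {K : ℝ [⋀^Fin p]→L[ℝ] Harm k}
    (hφ : ∀ w, φ σ w x = (c * hermiteHt (k + 1) w * Real.exp (-Real.pi * w ^ 2)) • K) :
    thetaBd φ L h τ σ x = (C * (c : ℂ)) • K := by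
  rw [thetaBd, (hG.hasSum_thetaBdTerm hφ).tsum_eq, ← coe_smul_form, smul_smul]
  congr 1
  have h1 : τ.im ^ (-((k : ℝ) + 1) / 2) * τ.im ^ (((k : ℝ) + 1) / 2) = 1 := by
    rw [← Real.rpow_add τ.im_pos, neg_div, neg_add_cancel, Real.rpow_zero]
  have h2 : ((τ.im ^ (-((k : ℝ) + 1) / 2) : ℝ) : ℂ) * ((τ.im ^ (((k : ℝ) + 1) / 2) : ℝ) : ℂ) = 1 := by
    exact_mod_cast h1
  rw [← mul_assoc, ← mul_assoc, h2, one_mul]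

theorem IsChartExtension.extDerivWithin_eq_zero (hG : IsChartExtension L h k τ σ C G) {q : ℝ × ℝ}
    (hq : q ∈ halfPlane) : extDerivWithin G halfPlane q = 0 := by
  have hu : UniqueDiffWithinAt ℝ halfPlane q := by
    have h1 : UniqueDiffOn ℝ ((Set.univ : Set ℝ) ×ˢ Set.Ici (0 : ℝ)) :=
      uniqueDiffOn_univ.prod (uniqueDiffOn_Ici 0)
    have h2 : halfPlane = (Set.univ : Set ℝ) ×ˢ Set.Ici (0 : ℝ) := by
      ext q; simp [halfPlane]
    rw [h2] at hq ⊢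
    exact h1 q hq
  have hd : DifferentiableAt ℝ G q := hG.contDiff.differentiable (by simp) q
  ext1 ξ
  rw [extDerivWithin, ContinuousAlternatingMap.alternatizeUncurryFin_apply, hd.fderivWithin hu,
    Fin.sum_univ_two]
  have e0 : (0 : Fin 2).removeNth ξ = fun _ => ξ 1 := by
    funext i; rw [Subsingleton.elim i 0]; rfl
  have e1 : (1 : Fin 2).removeNth ξ = fun _ => ξ 0 := by
    funext i; rw [Subsingleton.elim i 0]; rfl
  rw [e0, e1, hG.symm q hq (ξ 0) (ξ 1)]
  simp

end Extension

/-! ### The boundary -/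

theorem restr_bdMain (k : ℕ) (σ : SL(2, ℤ)) (x : ℝ) :
    (rhoForm (σ : SL(2, ℝ)) (bdMain k x)).compContinuousLinearMap (ContinuousLinearMap.inl ℝ ℝ ℝ) =
      (-(1 / (2 : ℝ) ^ ((k : ℝ) + 1 / 2))) • oneForm (ContinuousLinearMap.id ℝ ℝ)
        (rho k ((σ : SL(2, ℝ)) * nMat x) (harmProj k (MvPolynomial.X 1 ^ k))) := by
  refine ContinuousAlternatingMap.ext fun ξ => ?_
  change rho k (σ : SL(2, ℝ)) ((-(1 / (2 : ℝ) ^ ((k : ℝ) + 1 / 2))) • ξ 0 • rho k (nMat x) _) =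
    (-(1 / (2 : ℝ) ^ ((k : ℝ) + 1 / 2))) • ξ 0 • rho k ((σ : SL(2, ℝ)) * nMat x) _
  rw [rho_mul, ← Complex.coe_smul, ← Complex.coe_smul, map_smul, map_smul, Complex.coe_smul,
    Complex.coe_smul]

/-- The section `g n(x) v_{-2}` is a primitive of a multiple of `g n(x) π_k(e₂^k) dx`. -/
theorem hasDerivAt_rho_mul_nMat_vMinusTwo {k : ℕ} (hk : 0 < k) (g : SL(2, ℝ)) (x : ℝ) :
    HasDerivAt (fun y => rho k (g * nMat y) (vMinusTwo k)) (((k : ℝ) * √2 ^ k) •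
      rho k (g * nMat x) (harmProj k (MvPolynomial.X 1 ^ k))) x := by
  have h1 := hasDerivAt_rho_nMat (raise_vMinusTwo hk).symm x
  let R : Harm k →L[ℝ] Harm k := ((rho k g).restrictScalars ℝ).toContinuousLinearMap
  have h2 : HasDerivAt (fun y => rho k g (rho k (nMat y) (vMinusTwo k)))
      (rho k g (rho k (nMat x) (((k : ℂ) * (√2 : ℂ) ^ k) • harmProj k (MvPolynomial.X 1 ^ k)))) x :=
    R.hasFDerivAt.comp_hasDerivAt x h1
  have h3 : (((k : ℝ) * √2 ^ k : ℝ) : ℂ) = (k : ℂ) * (√2 : ℂ) ^ k := by push_cast; rfl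
  rw [map_smul, map_smul, ← h3, Complex.coe_smul] at h2
  simpa only [rho_mul] using h2

theorem contDiff_constOfIsEmpty {k : ℕ} {f : ℝ → Harm k} (hf : ContDiff ℝ ∞ f) :
    ContDiff ℝ ∞ fun x => ContinuousAlternatingMap.constOfIsEmpty ℝ ℝ (Fin 0) (f x) := by
  let T : Harm k →ₗ[ℝ] (ℝ [⋀^Fin 0]→L[ℝ] Harm k) :=
    { toFun := fun w => ContinuousAlternatingMap.constOfIsEmpty ℝ ℝ (Fin 0) w
      map_add' := fun w w' => rfl
      map_smul' := fun c w => rfl }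
  exact (LinearMap.toContinuousLinearMap T).contDiff.comp hf

/-- The normalizations of `φ^{N_ℓ}` and `ϕ^{N_ℓ}` match through `R v_{-2} = k 2^{k/2} π_k(e₂^k)`. -/
theorem const_psi_mul {k : ℕ} (hk : 0 < k) :
    -(1 / ((2 : ℝ) ^ (3 * (k : ℝ) / 2 + 1 / 2) * k)) * ((k : ℝ) * √2 ^ k) =
      -(1 / (2 : ℝ) ^ ((k : ℝ) + 1 / 2)) := by
  have hk' : (k : ℝ) ≠ 0 := by exact_mod_cast hk.ne'
  have h1 : √2 ^ k = (2 : ℝ) ^ ((k : ℝ) / 2) := by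
    rw [Real.sqrt_eq_rpow, ← Real.rpow_natCast, ← Real.rpow_mul zero_le_two]
    congr 1
    ring
  have h2 : (2 : ℝ) ^ (3 * (k : ℝ) / 2 + 1 / 2) =
      (2 : ℝ) ^ ((k : ℝ) + 1 / 2) * (2 : ℝ) ^ ((k : ℝ) / 2) := by
    rw [← Real.rpow_add two_pos]
    congr 1
    ring
  have h3 : (2 : ℝ) ^ ((k : ℝ) / 2) ≠ 0 := by positivity
  rw [h1, h2]
  field_simp

section Assembly

variable {L : Submodule ℤ (Matrix (Fin 2) (Fin 2) ℚ)} {h : Matrix (Fin 2) (Fin 2) ℚ}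
  {k : ℕ} {τ : ℍ} {Γ : Subgroup SL(2, ℤ)} {C : SL(2, ℤ) → ℂ} {Θ : ChartForm k 1}

theorem isForm_of_isChartExtension (hL : IsEvenLattice L) (hh : h.trace = 0)
    (hΓL : ∀ γ ∈ Γ, ∀ x ∈ latCoset L h, conj (toQ γ) x ∈ latCoset L h)
    (hΘ : ∀ σ, IsChartExtension L h k τ σ (C σ) (Θ σ)) : IsForm Γ Θ := by
  refine ⟨fun σ => (hΘ σ).contDiff.contDiffOn, fun γ hγ σ σ' q q' ⟨hq, hq'⟩ ξ => ?_⟩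
  have hc : σ' * (σ'⁻¹ * (γ * σ)) = γ * σ := mul_inv_cancel_left _ _
  rcases hq with hq | ⟨hq, hρ⟩
  · rw [hq']
    exact DFunLike.congr_fun ((hΘ σ).trans_of_pos (hΘ σ') hL hh hc (hΓL γ hγ)
      (hΓL γ⁻¹ (inv_mem hγ)) hq) ξ
  · obtain ⟨m, hm, -⟩ := exists_translation hρ
    obtain ⟨x, t⟩ := q
    obtain rfl : t = 0 := hq
    rw [hq', hm, fderiv_trans_of_translation hm]
    exact DFunLike.congr_fun ((hΘ σ).trans_of_eq_zero (hΘ σ') hL hh hc (hΓL γ hγ)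
      (hΓL γ⁻¹ (inv_mem hγ)) hm x) ξ

theorem extends_of_isChartExtension (hL : IsEvenLattice L) (hh : h.trace = 0)
    (hΘ : ∀ σ, IsChartExtension L h k τ σ (C σ) (Θ σ)) : Extends Θ (thetaV k L h τ) := by
  intro σ q hq
  have hs := summable_phiV (exists_isChartExtension hL hh k τ 1).1 (ofComplex (chartPt σ q))
  have h1 := tsum_compContinuousLinearMap hs (fderiv ℝ (chartPt σ) q)
  have h2 : ∀ f : ℂ [⋀^Fin 1]→L[ℝ] Harm k, ((τ.im ^ (-(k : ℝ) / 2)) • f).compContinuousLinearMap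
      (fderiv ℝ (chartPt σ) q) = (τ.im ^ (-(k : ℝ) / 2)) •
        f.compContinuousLinearMap (fderiv ℝ (chartPt σ) q) := fun _ => rfl
  rw [(hΘ σ).eq_tsum q hq, thetaV, h2]
  congr 1
  exact h1.symm

theorem restrBd_eq_thetaBd_phiN (hΘ : ∀ σ, IsChartExtension L h k τ σ (C σ) (Θ σ)) :
    restrBd Θ = thetaBd (phiN k) L h τ := by
  funext σ x
  have h2 : ∀ f : (ℝ × ℝ) [⋀^Fin 1]→L[ℝ] Harm k, (C σ • f).compContinuousLinearMap
      (ContinuousLinearMap.inl ℝ ℝ ℝ) = C σ • f.compContinuousLinearMap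
        (ContinuousLinearMap.inl ℝ ℝ ℝ) := fun _ => rfl
  rw [(hΘ σ).thetaBd_eq (c := -(1 / (2 : ℝ) ^ ((k : ℝ) + 1 / 2))) (fun w => rfl), restrBd,
    (hΘ σ).bd, h2, restr_bdMain, mul_smul, coe_smul_form]

theorem thetaBd_psiN_eq (hΘ : ∀ σ, IsChartExtension L h k τ σ (C σ) (Θ σ)) (σ : SL(2, ℤ)) :
    thetaBd (psiN k) L h τ σ = fun x => ContinuousAlternatingMap.constOfIsEmpty ℝ ℝ (Fin 0)
      ((C σ * ((-(1 / ((2 : ℝ) ^ (3 * (k : ℝ) / 2 + 1 / 2) * k)) : ℝ) : ℂ)) •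
        rho k ((σ : SL(2, ℝ)) * nMat x) (vMinusTwo k)) := by
  funext x
  rw [(hΘ σ).thetaBd_eq (c := -(1 / ((2 : ℝ) ^ (3 * (k : ℝ) / 2 + 1 / 2) * k))) (fun w => rfl)]
  rfl

theorem isBdForm_thetaBd_psiN (hL : IsEvenLattice L) (hh : h.trace = 0)
    (hΓL : ∀ γ ∈ Γ, ∀ x ∈ latCoset L h, conj (toQ γ) x ∈ latCoset L h)
    (hΘ : ∀ σ, IsChartExtension L h k τ σ (C σ) (Θ σ)) :
    IsBdForm Γ (thetaBd (psiN k) L h τ) := by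
  refine ⟨fun σ => ?_, fun γ hγ σ σ' x x' ⟨hq, hq'⟩ ξ => ?_⟩
  · rw [thetaBd_psiN_eq hΘ]
    refine contDiff_constOfIsEmpty (ContDiff.const_smul _ ?_)
    simp only [rho_mul]
    exact ((rho k (σ : SL(2, ℝ))).restrictScalars ℝ).toContinuousLinearMap.contDiff.comp
      (contDiff_rho_nMat (vMinusTwo k))
  · have hc : σ' * (σ'⁻¹ * (γ * σ)) = γ * σ := mul_inv_cancel_left _ _
    have hρ : (σ'⁻¹ * (γ * σ)) 1 0 = 0 := (hq.resolve_left (lt_irrefl _)).2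
    have hC := (hΘ σ).const_eq (hΘ σ') hL hh hc (hΓL γ hγ) (hΓL γ⁻¹ (inv_mem hγ)) hρ
    obtain ⟨m, hm, hv⟩ := exists_translation hρ
    have hx : x' = m + x := by
      rw [hm] at hq'
      rw [add_comm]
      exact congrArg Prod.fst hq'
    have hr : rho k ((σ' : SL(2, ℝ)) * nMat x') (vMinusTwo k) =
        rho k (γ : SL(2, ℝ)) (rho k ((σ : SL(2, ℝ)) * nMat x) (vMinusTwo k)) := by
      rw [hx, nMat_add, rho_mul, rho_mul, ← hv, ← rho_mul (σ' : SL(2, ℝ)), ← map_mul, hc, map_mul,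
        rho_mul, rho_mul (σ : SL(2, ℝ))]
    rw [thetaBd_psiN_eq hΘ, thetaBd_psiN_eq hΘ, hC]
    generalize C σ * ((-(1 / ((2 : ℝ) ^ (3 * (k : ℝ) / 2 + 1 / 2) * k)) : ℝ) : ℂ) = c
    change c • rho k ((σ' : SL(2, ℝ)) * nMat x') (vMinusTwo k) =
      rho k (γ : SL(2, ℝ)) (c • rho k ((σ : SL(2, ℝ)) * nMat x) (vMinusTwo k))
    rw [map_smul, hr]

theorem restrBd_eq_dBd_thetaBd_psiN (hk : 0 < k)
    (hΘ : ∀ σ, IsChartExtension L h k τ σ (C σ) (Θ σ)) :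
    restrBd Θ = dBd (thetaBd (psiN k) L h τ) := by
  funext σ x
  have hder := (hasDerivAt_rho_mul_nMat_vMinusTwo hk (σ : SL(2, ℝ)) x).const_smul
    (C σ * ((-(1 / ((2 : ℝ) ^ (3 * (k : ℝ) / 2 + 1 / 2) * k)) : ℝ) : ℂ))
  have hder' : HasDerivAt (fun x => (C σ * ((-(1 / ((2 : ℝ) ^ (3 * (k : ℝ) / 2 + 1 / 2) * k)) : ℝ) :
      ℂ)) • rho k ((σ : SL(2, ℝ)) * nMat x) (vMinusTwo k)) _ x := hder
  rw [restrBd_eq_thetaBd_phiN hΘ, (hΘ σ).thetaBd_eq (c := -(1 / (2 : ℝ) ^ ((k : ℝ) + 1 / 2)))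
    (fun w => rfl), dBd, thetaBd_psiN_eq hΘ, extDeriv_constOfIsEmpty, hder'.hasFDerivAt.fderiv]
  refine ContinuousAlternatingMap.ext fun ξ => ?_
  change (C σ * ((-(1 / (2 : ℝ) ^ ((k : ℝ) + 1 / 2)) : ℝ) : ℂ)) • ξ 0 •
      rho k ((σ : SL(2, ℝ)) * nMat x) (harmProj k (MvPolynomial.X 1 ^ k)) =
    ξ 0 • (C σ * ((-(1 / ((2 : ℝ) ^ (3 * (k : ℝ) / 2 + 1 / 2) * k)) : ℝ) : ℂ)) •
      ((k : ℝ) * √2 ^ k) • rho k ((σ : SL(2, ℝ)) * nMat x) (harmProj k (MvPolynomial.X 1 ^ k))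
  rw [← const_psi_mul hk, ← Complex.coe_smul, ← Complex.coe_smul, ← Complex.coe_smul, smul_smul,
    smul_smul, smul_smul]
  congr 1
  push_cast
  ring

end Assembly

end Spectacle
end

theorem mainTheorem8
    (L : Submodule ℤ (Matrix (Fin 2) (Fin 2) ℚ)) (hL : Spectacle.IsEvenLattice L)
    (h : Matrix (Fin 2) (Fin 2) ℚ) (hh : Spectacle.IsDual L h)
    (Γ : Subgroup SL(2, ℤ)) (hΓ : CongruenceSubgroup.IsCongruenceSubgroup Γ)
    (hΓtf : ∀ γ ∈ Γ, IsOfFinOrder γ → γ = 1)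
    (hΓL : ∀ γ ∈ Γ, ∀ x ∈ Spectacle.latCoset L h,
      Spectacle.conj (Spectacle.toQ γ) x ∈ Spectacle.latCoset L h)
    (k : ℕ) (τ : UpperHalfPlane) :
    -- the theta series converge
    (∀ z, Summable fun x : Spectacle.latCoset L h => Spectacle.thetaVTerm k τ z x) ∧
    (∀ σ x, Summable fun w : Spectacle.wLine σ =>
      Spectacle.thetaBdTerm (Spectacle.phiN k) L h τ σ x w) ∧
    (0 < k → ∀ σ x, Summable fun w : Spectacle.wLine σ =>
      Spectacle.thetaBdTerm (Spectacle.psiN k) L h τ σ x w) ∧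
    -- extension, restriction to the boundary circles, primitives, cocycle
    ∃ Θ : Spectacle.ChartForm k 1,
      Spectacle.IsForm Γ Θ ∧
      Spectacle.Extends Θ (Spectacle.thetaV k L h τ) ∧
      Spectacle.restrBd Θ = Spectacle.thetaBd (Spectacle.phiN k) L h τ ∧
      (0 < k →
        Spectacle.IsBdForm Γ (Spectacle.thetaBd (Spectacle.psiN k) L h τ) ∧
        Spectacle.restrBd Θ = Spectacle.dBd (Spectacle.thetaBd (Spectacle.psiN k) L h τ) ∧
        Spectacle.IsConeCocycle Γ (Θ, Spectacle.thetaBd (Spectacle.psiN k) L h τ)) := by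
  choose C Θ hΘ using fun σ => (Spectacle.exists_isChartExtension hL hh.1 k τ σ).2
  have hform := Spectacle.isForm_of_isChartExtension hL hh.1 hΓL hΘ
  refine ⟨Spectacle.summable_phiV (Spectacle.exists_isChartExtension hL hh.1 k τ 1).1,
    fun σ x => ((hΘ σ).hasSum_thetaBdTerm (c := -(1 / (2 : ℝ) ^ ((k : ℝ) + 1 / 2)))
      fun w => rfl).summable,
    fun _ σ x => ((hΘ σ).hasSum_thetaBdTerm
      (c := -(1 / ((2 : ℝ) ^ (3 * (k : ℝ) / 2 + 1 / 2) * k))) fun w => rfl).summable,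
    Θ, hform, Spectacle.extends_of_isChartExtension hL hh.1 hΘ,
    Spectacle.restrBd_eq_thetaBd_phiN hΘ, fun hk => ?_⟩
  have hbd := Spectacle.isBdForm_thetaBd_psiN hL hh.1 hΓL hΘ
  have hd := Spectacle.restrBd_eq_dBd_thetaBd_psiN hk hΘ
  refine ⟨hbd, hd, hform, hbd, fun σ q hq => (hΘ σ).extDerivWithin_eq_zero hq, ?_⟩
  change Spectacle.restrBd Θ - Spectacle.dBd (Spectacle.thetaBd (Spectacle.psiN k) L h τ) = 0
  rw [hd, sub_self]
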